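/- Let $\tau:L\to M$ be a smooth real vector bundle of finite rank over a smooth (finite-dimensional, Hausdorff, second countable) manifold, with a Lie algebroid structure with bracket $[\cdot,\cdot]$ on $\Gamma(L)$ and anchor $a$, and let $\Phi\in\Gamma(L^*)$ be a $1$-cocycle, $d\Phi=0$. Put $\mathcal A^{x}(L)=\Gamma(\bigwedge^{x+1}L)$ for $x\ge -1$, write $x,y$ for the degrees of $X\in\mathcal A^x(L)$, $Y\in\mathcal A^y(L)$, let $i_\Phi$ be the contraction with $\Phi$ in the first place ($i_\Phi f=0$ for functions), and for $\mu\in\Gamma(L^*)$ let $\iota_\mu\in C^\infty(L)$ be the fibrewise linear function $\iota_\mu(v)=\langle\mu,v\rangle$. For $V=C^\infty(L)$, the skew-symmetric $(a+1)$-linear maps $V^{a+1}\to V$ have degree $a\ge-1$. Their wedge product is the sum over shuffles of $\operatorname{sgn}(\sigma)\,A(\dots)B(\dots)$, and their Nijenhuis–Richardson bracket is $[A,B]^{NR}=-i_AB+(-1)^{ab}i_BA$ with $i_BA(f_0,\dots,f_{a+b})=\sum_\sigma \operatorname{sgn}(\sigma)A(B(f_{\sigma(0)},\dots,f_{\sigma(b)}),f_{\sigma(b+1)},\dots,f_{\sigma(a+b)})$,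 the sum over unshuffles. Multivector fields on $L$ are the operators that are derivations in each variable; first-order multidifferential operators are those that are differential operators of order at most one in each variable. $I$ is the identity map of $V$. There are a unique linear *vertical lift* $X\mapsto X^v$ and a unique linear *complete lift* $X\mapsto X^c$ from $\mathcal A(L)$ to multivector fields on $L$, sending $\mathcal A^x(L)$ to $(x+1)$-vector fields, such that $f^v=f\circ\tau$, $X^v(F)(v)=\frac{d}{dt}\big|_{t=0}F(v+tX(\tau(v)))$ for $X\in\Gamma(L)$, $(X\wedge Y)^v=X^v\wedge Y^v$, respectively $f^c=\iota_{df}$, $X^c(\iota_\mu)=\iota_{\pounds_X\mu}$ for $X\in\Gamma(L)$, $(X\wedge Y)^c=X^c\wedge Y^v+X^v\wedge Y^c$. There is a unique graded bilinear bracket $[\cdot,\cdot]^{SN}$ on $\mathcal A(L)$ (Schouten–Nijenhuis) with $[X,Y]^{SN}=-(-1)^{xy}[Y,X]^{SN}$, $[X,Y\wedge Z]^{SN}=[X,Y]^{SN}\wedge Z+(-1)^{x(y+1)}Y\wedge[X,Z]^{SN}$, $[X,f]^{SN}=a(X)(f)$ and $[X,Y]^{SN}=[X,Y]$ for $X,Y\in\Gamma(L)$,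 $f\in C^\infty(M)$. The Schouten–Jacobi bracket is $[X,Y]^\Phi=[X,Y]^{SN}+x\,X\wedge i_\Phi Y-(-1)^x y\,i_\Phi X\wedge Y$. Put $d^\Phi f(X)=a(X)(f)+\Phi(X)f$; for a one-form $\mu$ put $d^\Phi\mu=d\mu+\Phi\wedge\mu$, and $\pounds^\Phi_X\mu=i_Xd^\Phi\mu+d^\Phi(i_X\mu)$. The *Jacobi lift* $\hat X_\Phi=X^c-x\,\iota_\Phi X^v+I\wedge(i_\Phi X)^v$ of $X\in\mathcal A^x(L)$ is a first-order multidifferential operator on $L$, and (a) $\hat f_\Phi=\iota_{d^\Phi f}$ for $f\in C^\infty(M)$; (b) $\hat X_\Phi(\iota_\mu)=\iota_{\pounds^\Phi_X\mu}$ and $\hat X_\Phi(1)=\Phi(X)\circ\tau$ for $X\in\Gamma(L)$, $\mu\in\Gamma(L^*)$; (c) $(X\wedge Y)\hat{}_\Phi=\hat X_\Phi\wedge Y^v+X^v\wedge\hat Y_\Phi-\iota_\Phi\,(X^v\wedge Y^v)$ for $X,Y\in\mathcal A(L)$; (d) $[\hat X_\Phi,\hat Y_\Phi]^{NR}=([X,Y]^\Phi)\hat{}_\Phi$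 for $X,Y\in\mathcal A(L)$. -/

import Mathlib

open Bundle Topology Module
open scoped Manifold ContDiff

set_option linter.unusedSectionVars false

noncomputable section

namespace JacobiAlgebroid

/-! ### Skew-symmetric multilinear operators on a commutative algebra -/

section Operators

variable {W : Type*} [CommRing W] [Algebra ℝ W]

/-- Skew-symmetric `k`-linear operators on `W`; their degree as elements of the graded Lie algebra
is `k - 1`. -/
abbrev AltOp (W : Type*) [CommRing W] [Algebra ℝ W] (k : ℕ) : Type _ :=
  W [⋀^Fin k]→ₗ[ℝ] W

/-- The operator with no argument given by an element of `W`. -/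
def constOp (w : W) : AltOp W 0 :=
  AlternatingMap.constOfIsEmpty ℝ W (Fin 0) w

/-- The identity map of `W` as a `1`-linear operator. -/
def idOp : AltOp W 1 :=
  AlternatingMap.ofSubsingleton ℝ W W (0 : Fin 1) LinearMap.id

/-- The wedge product of a `k`-linear and an `l`-linear operator: the sum over shuffles `σ` of
`sign σ * A (x (σ 0), …) * B (x (σ k), …)`.  The number of arguments `m` of the result is `k + l`
(in any other case the value is the junk value `0`). -/
def wedge {k l : ℕ} (m : ℕ) (A : AltOp W k) (B : AltOp W l) : AltOp W m :=
  if h : k + l = m then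
    ((LinearMap.mul' ℝ W).compAlternatingMap (A.domCoprod B)).domDomCongr
      (finSumFinEquiv.trans (finCongr h))
  else 0

/-- The multilinear map `(x, y) ↦ A (B (x 0, …, x (l - 1)), y 0, …, y (a - 1))`. -/
def insertFirst {a l : ℕ} (B : AltOp W l) (A : AltOp W (a + 1)) :
    MultilinearMap ℝ (fun _ : Fin l ⊕ Fin a => W) W :=
  (A.toMultilinearMap.curryLeft.compMultilinearMap B.toMultilinearMap).uncurrySum

/-- The insertion `i_B A` of the `l`-linear operator `B` into the `k`-linear operator `A`:
`i_B A (x 0, …) = ∑ σ, sign σ * A (B (x (σ 0), …, x (σ (l - 1))), x (σ l), …)`, the sum over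
unshuffles `σ`, written as the sum over all permutations divided by `l! (k - 1)!`; it is `0` for
`k = 0`.  The number of arguments `m` of the result is `k + l - 1` (in any other case the value is
the junk value `0`). -/
def insertion (m : ℕ) {l : ℕ} (B : AltOp W l) : {k : ℕ} → AltOp W k → AltOp W m
  | 0, _ => 0
  | a + 1, A =>
    if h : l + a = m then
      ((l.factorial * a.factorial : ℕ) : ℝ)⁻¹ •
        MultilinearMap.alternatization
          ((insertFirst B A).domDomCongr (finSumFinEquiv.trans (finCongr h)))
    else 0

/-- The Nijenhuis–Richardson bracket `[A, B] = - i_A B + (-1) ^ (a b) i_B A`, where `a = k - 1` and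
`b = l - 1` are the degrees. For `k = l = 0` it vanishes. -/
def nrBracket {k l : ℕ} (A : AltOp W k) (B : AltOp W l) : AltOp W (k + l - 1) :=
  - insertion (k + l - 1) A B
    + ((-1 : ℝ) ^ (((k : ℤ) - 1) * ((l : ℤ) - 1))) • insertion (k + l - 1) B A

/-- `A` is a derivation in each variable separately. -/
def IsMultiDerivation {k : ℕ} (A : AltOp W k) : Prop :=
  ∀ (i : Fin k) (x : Fin k → W) (f g : W),
    A (Function.update x i (f * g)) =
      f * A (Function.update x i g) + g * A (Function.update x i f)

/-- A linear operator `D` is a differential operator of order at most one: `[[D, f], g] = 0`, where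
`f` and `g` stand for the multiplications by `f` and `g`. -/
def IsFirstOrder (D : W →ₗ[ℝ] W) : Prop :=
  ∀ f g : W, ⁅⁅D, LinearMap.mulLeft ℝ f⁆, LinearMap.mulLeft ℝ g⁆ = 0

/-- `A` is a first-order differential operator in each variable separately. -/
def IsFirstOrderMultiDiff {k : ℕ} (A : AltOp W k) : Prop :=
  ∀ (i : Fin k) (x : Fin k → W), IsFirstOrder (A.toMultilinearMap.toLinearMap x i)

end Operators

/-! ### Functions, sections and one-forms -/

section Bundle

variable (n : ℕ) {M : Type*} [TopologicalSpace M] [ChartedSpace (EuclideanSpace ℝ (Fin n)) M]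

/-- The algebra of smooth functions on `M`. -/
abbrev Fn (M : Type*) [TopologicalSpace M] [ChartedSpace (EuclideanSpace ℝ (Fin n)) M] : Type _ :=
  C^∞⟮𝓡 n, M; 𝓘(ℝ), ℝ⟯

variable (F : Type*) [NormedAddCommGroup F] [NormedSpace ℝ F]
  (E : M → Type*) [TopologicalSpace (TotalSpace F E)] [∀ x, AddCommGroup (E x)]
  [∀ x, Module ℝ (E x)] [∀ x, TopologicalSpace (E x)] [FiberBundle F E] [VectorBundle ℝ F E]

/-- The smooth sections of the vector bundle `E` (with model fibre `F`). -/
abbrev Sec : Type _ := Cₛ^∞⟮𝓡 n; F, E⟯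

/-- The algebra of smooth functions on the total space of the vector bundle. -/
abbrev TotFn : Type _ := C^∞⟮(𝓡 n).prod 𝓘(ℝ, F), TotalSpace F E; 𝓘(ℝ), ℝ⟯

/-- Sections can be multiplied by smooth functions. -/
instance : SMul (Fn n M) (Sec n F E) :=
  ⟨fun f s => ⟨fun p => f p • s p, f.contMDiff.smul_section s.contMDiff⟩⟩

variable {n F E} in
@[simp] theorem smul_apply (f : Fn n M) (s : Sec n F E) (p : M) : (f • s) p = f p • s p := rfl

/-- The smooth sections form a module over the smooth functions. -/
instance : Module (Fn n M) (Sec n F E) where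
  one_smul s := by ext p; exact one_smul ℝ (s p)
  mul_smul f g s := by ext p; exact mul_smul (f p) (g p) (s p)
  smul_zero f := by ext p; exact smul_zero (f p)
  smul_add f s t := by ext p; exact smul_add (f p) (s p) (t p)
  add_smul f g s := by ext p; exact add_smul (f p) (g p) (s p)
  zero_smul s := by ext p; exact zero_smul ℝ (s p)

/-- One-forms on `E`, i.e. sections of the dual bundle, as the `C^∞(M)`-linear maps from sections
of `E` to functions. -/
abbrev OneForm : Type _ := Sec n F E →ₗ[Fn n M] Fn n M

variable {n F E} in
/-- Finite sums of sections are computed pointwise. -/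
theorem sec_sum_apply {ι : Type*} (S : Finset ι) (s : ι → Sec n F E) (p : M) :
    (∑ i ∈ S, s i) p = ∑ i ∈ S, s i p :=
  (congrFun (map_sum (ContMDiffSection.coeAddHom (𝓡 n) F ∞ E) s S) p).trans
    (Finset.sum_apply p S _)

end Bundle

section Pairing

variable {n : ℕ} {M : Type*} [TopologicalSpace M] [ChartedSpace (EuclideanSpace ℝ (Fin n)) M]
  {F : Type*} [NormedAddCommGroup F] [NormedSpace ℝ F]
  {E : M → Type*} [TopologicalSpace (TotalSpace F E)] [∀ x, AddCommGroup (E x)]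
  [∀ x, Module ℝ (E x)] [∀ x, TopologicalSpace (E x)] [FiberBundle F E] [VectorBundle ℝ F E]
  [IsManifold (𝓡 n) ∞ M] [T2Space M] [FiniteDimensional ℝ F] [ContMDiffVectorBundle ∞ F E (𝓡 n)]

/-- Near every point there is a frame consisting of global smooth sections. -/
theorem exists_frame (p₀ : M) :
    ∃ (ψ : Fn n M) (s : Fin (finrank ℝ F) → Sec n F E)
      (c : Fin (finrank ℝ F) → TotalSpace F E → ℝ),
      (∀ᶠ p in 𝓝 p₀, ψ p = 1) ∧
      (∀ᶠ p in 𝓝 p₀, ∀ i (v : E p),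
        ContMDiffAt ((𝓡 n).prod 𝓘(ℝ, F)) 𝓘(ℝ) ∞ (c i) ⟨p, v⟩) ∧
      (∀ t : Sec n F E, ∃ a : Fin (finrank ℝ F) → Fn n M, ∀ i p, a i p = ψ p * c i ⟨p, t p⟩) ∧
      (∀ p (v : E p), ψ p • v = ∑ i, c i ⟨p, v⟩ • s i p) := by
  set e := trivializationAt F E p₀ with he
  have hp₀ : p₀ ∈ e.baseSet := FiberBundle.mem_baseSet_trivializationAt F E p₀
  have hnhd : e.baseSet ∈ 𝓝 p₀ := e.open_baseSet.mem_nhds hp₀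
  obtain ⟨ψ, hψ, -⟩ := (SmoothBumpFunction.nhds_basis_support (I := 𝓡 n) hnhd).mem_iff.1 hnhd
  let b := finBasis ℝ F
  let ψ' : Fn n M := ⟨ψ, ψ.contMDiff⟩
  let c : Fin (finrank ℝ F) → TotalSpace F E → ℝ := fun i x => b.repr (e x).2 i
  have hrepr : ∀ i, ContDiff ℝ ∞ (fun w : F => b.repr w i) := fun i =>
    ((b.coord i).toContinuousLinearMap).contDiff
  have hc : ∀ p ∈ e.baseSet, ∀ i (v : E p),
      ContMDiffAt ((𝓡 n).prod 𝓘(ℝ, F)) 𝓘(ℝ) ∞ (c i) ⟨p, v⟩ := by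
    intro p hp i v
    have h1 : ContMDiffAt ((𝓡 n).prod 𝓘(ℝ, F)) ((𝓡 n).prod 𝓘(ℝ, F)) ∞ e ⟨p, v⟩ :=
      (e.contMDiffOn (IB := 𝓡 n) (n := ∞)).contMDiffAt
        (e.open_source.mem_nhds (e.mem_source.2 hp))
    exact ((hrepr i).contMDiff.contMDiffAt).comp _ (contMDiffAt_snd.comp _ h1)
  refine ⟨ψ', fun i => ⟨_, ContMDiffOn.smul_section_of_tsupport (u := e.baseSet)
    (ψ.contMDiff.contMDiffOn) e.open_baseSet hψ (e.contMDiffOn_localFrame_baseSet ∞ b i)⟩, c,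
    ψ.eventuallyEq_one, ?_, ?_, ?_⟩
  · filter_upwards [hnhd] with p hp i v using hc p hp i v
  · intro t
    refine ⟨fun i => ⟨fun p => ψ p * c i ⟨p, t p⟩, ?_⟩, fun i p => rfl⟩
    apply contMDiff_of_tsupport
    intro p hp
    have hp' : p ∈ e.baseSet := hψ (closure_mono (Function.support_mul_subset_left _ _) hp)
    exact ψ.contMDiffAt.mul ((hc p hp' i (t p)).comp p (t.contMDiff p))
  · intro p v
    by_cases hp : p ∈ e.baseSet
    · have hv : v = ∑ i, c i ⟨p, v⟩ • e.localFrame b i p := by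
        conv_lhs => rw [← (e.basisAt b hp).sum_repr v]
        refine Finset.sum_congr rfl fun i _ => ?_
        simp [c, hp, Trivialization.basisAt]
      conv_lhs => rw [hv]
      rw [Finset.smul_sum]
      refine Finset.sum_congr rfl fun i _ => ?_
      exact smul_comm _ _ _
    · have h0 : ψ p = 0 := by
        by_contra h
        exact hp (hψ (subset_tsupport _ h))
      change ψ p • v = ∑ i, c i ⟨p, v⟩ • (ψ p • e.localFrame b i p)
      simp [h0]

/-- Every vector of the bundle is a value of a global smooth section. -/
theorem exists_section (x : TotalSpace F E) : ∃ s : Sec n F E, s x.proj = x.2 := by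
  obtain ⟨ψ, s, c, h1, -, -, h4⟩ := exists_frame (n := n) (F := F) (E := E) x.proj
  refine ⟨∑ i, c i x • s i, ?_⟩
  have h := h4 x.proj x.2
  rw [h1.self_of_nhds, one_smul] at h
  rw [sec_sum_apply, h]
  rfl

/-- The value of a one-form on a section, computed in a frame. -/
theorem oneForm_apply_frame (μ : OneForm n F E) {ψ : Fn n M} {s : Fin (finrank ℝ F) → Sec n F E}
    {c : Fin (finrank ℝ F) → TotalSpace F E → ℝ}
    (h3 : ∀ t : Sec n F E, ∃ a : Fin (finrank ℝ F) → Fn n M, ∀ i p, a i p = ψ p * c i ⟨p, t p⟩)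
    (h4 : ∀ p (v : E p), ψ p • v = ∑ i, c i ⟨p, v⟩ • s i p)
    {p : M} (hp : ψ p = 1) (t : Sec n F E) :
    μ t p = ∑ i, c i ⟨p, t p⟩ * μ (s i) p := by
  obtain ⟨a, ha⟩ := h3 t
  have key : (ψ * ψ) • t = ∑ i, a i • s i := by
    ext q
    rw [sec_sum_apply]
    have h := congrArg (fun w => ψ q • w) (h4 q (t q))
    simp only [Finset.smul_sum, smul_smul] at h
    simp only [smul_apply, ha]
    exact h
  have h := congrArg (fun f : Fn n M => f p) (congrArg μ key)
  simp only [map_sum, map_smul, smul_eq_mul] at h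
  have hsum : (∑ i, a i * μ (s i)) p = ∑ i, a i p * μ (s i) p := by
    have := congrFun (map_sum (ContMDiffMap.coeFnAddMonoidHom (I := 𝓡 n) (N := M) (I' := 𝓘(ℝ)) (G := ℝ) (n := ∞))
      (fun i => a i * μ (s i)) Finset.univ) p
    simpa using this
  rw [hsum] at h
  simpa [ha, hp] using h

/-- For a section `μ` of the dual bundle there is exactly one function `ι_μ` on the total space,
linear along the fibres, whose value at the vector `s p` is `⟨μ, s⟩ (p)`. -/
theorem existsUnique_iota (μ : OneForm n F E) :
    ∃! f : TotFn n F E, ∀ (s : Sec n F E) (p : M), f ⟨p, s p⟩ = μ s p := by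
  choose σ hσ using exists_section (n := n) (F := F) (E := E)
  have hwd : ∀ (s t : Sec n F E) (p : M), s p = t p → μ s p = μ t p := by
    intro s t p h
    obtain ⟨ψ, s', c, h1, -, h3, h4⟩ := exists_frame (n := n) (F := F) (E := E) p
    rw [oneForm_apply_frame μ h3 h4 h1.self_of_nhds, oneForm_apply_frame μ h3 h4 h1.self_of_nhds, h]
  refine ⟨⟨fun x => μ (σ x) x.proj, ?_⟩, ?_, ?_⟩
  · rintro ⟨p₀, v₀⟩
    obtain ⟨ψ, s, c, h1, h2, h3, h4⟩ := exists_frame (n := n) (F := F) (E := E) p₀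
    have hsm : ContMDiffAt ((𝓡 n).prod 𝓘(ℝ, F)) 𝓘(ℝ) ∞
        (fun x : TotalSpace F E => ∑ i, c i x * μ (s i) x.proj) ⟨p₀, v₀⟩ := by
      refine ContMDiffAt.sum fun i _ => ?_
      refine (h2.self_of_nhds i v₀).mul ?_
      exact ((μ (s i)).contMDiff _).comp _ (contMDiff_proj E _)
    refine hsm.congr_of_eventuallyEq ?_
    have hcont : ContinuousAt (TotalSpace.proj : TotalSpace F E → M) ⟨p₀, v₀⟩ :=
      (FiberBundle.continuous_proj F E).continuousAt
    filter_upwards [hcont.eventually h1] with x hx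
    rw [oneForm_apply_frame μ h3 h4 hx, hσ]
  · intro s p
    exact hwd _ _ p (hσ ⟨p, s p⟩)
  · intro g hg
    ext x
    have h := hg (σ x) x.proj
    rw [hσ] at h
    exact h

/-- The function `ι_μ` on the total space, linear along the fibres, given by `ι_μ(v) = ⟨μ, v⟩`. -/
def iota (μ : OneForm n F E) : TotFn n F E := (existsUnique_iota μ).choose

theorem iota_apply (μ : OneForm n F E) (s : Sec n F E) (p : M) : iota μ ⟨p, s p⟩ = μ s p :=
  (existsUnique_iota μ).choose_spec.1 s p

/-- The value of the one-form `μ` at the point `p`, a linear form on the fibre. -/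
def formAt (μ : OneForm n F E) (p : M) : E p →ₗ[ℝ] ℝ where
  toFun v := iota μ ⟨p, v⟩
  map_add' v w := by
    obtain ⟨s, hs⟩ := exists_section (n := n) (⟨p, v⟩ : TotalSpace F E)
    obtain ⟨t, ht⟩ := exists_section (n := n) (⟨p, w⟩ : TotalSpace F E)
    have hs' : s p = v := hs
    have ht' : t p = w := ht
    have h : (s + t) p = v + w := by rw [← hs', ← ht']; rfl
    rw [← h, ← hs', ← ht', iota_apply, iota_apply, iota_apply, map_add]
    rfl
  map_smul' r v := by
    obtain ⟨s, hs⟩ := exists_section (n := n) (⟨p, v⟩ : TotalSpace F E)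
    have hs' : s p = v := hs
    have h : (algebraMap ℝ (Fn n M) r • s) p = r • v := by rw [← hs']; rfl
    rw [← h, ← hs', iota_apply, iota_apply, map_smul]
    rfl

theorem formAt_apply (μ : OneForm n F E) (s : Sec n F E) (p : M) : formAt μ p (s p) = μ s p :=
  iota_apply μ s p

end Pairing

/-! ### Lie algebroids and their Cartan calculus -/

section Algebroid

variable (n : ℕ) {M : Type*} [TopologicalSpace M] [ChartedSpace (EuclideanSpace ℝ (Fin n)) M]
  (F : Type*) [NormedAddCommGroup F] [NormedSpace ℝ F]
  (E : M → Type*) [TopologicalSpace (TotalSpace F E)] [∀ x, AddCommGroup (E x)]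
  [∀ x, Module ℝ (E x)] [∀ x, TopologicalSpace (E x)] [FiberBundle F E] [VectorBundle ℝ F E]

/-- A Lie algebroid structure on the vector bundle `E`: a Lie bracket on the sections and a
`C^∞(M)`-linear anchor from sections to vector fields (derivations of `C^∞(M)`), related by the
Leibniz rule. -/
structure LieAlgebroid where
  /-- the bracket of sections -/
  bracket : Sec n F E →ₗ[ℝ] Sec n F E →ₗ[ℝ] Sec n F E
  /-- the anchor -/
  anchor : Sec n F E →ₗ[Fn n M] Derivation ℝ (Fn n M) (Fn n M)
  bracket_self : ∀ X, bracket X X = 0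
  jacobi : ∀ X Y Z,
    bracket (bracket X Y) Z = bracket X (bracket Y Z) - bracket Y (bracket X Z)
  leibniz : ∀ (X : Sec n F E) (f : Fn n M) (Y : Sec n F E),
    bracket X (f • Y) = f • bracket X Y + anchor X f • Y

variable {n F E} (A : LieAlgebroid n F E) (Φ : OneForm n F E)

namespace LieAlgebroid

/-- The first-order operator `[X, f]^Φ = a(X)(f) + Φ(X) f` of a section `X` on functions. -/
def act (X : Sec n F E) (f : Fn n M) : Fn n M := A.anchor X f + Φ X * f

/-- The differential `d^Φ f` of a function: `d^Φ f (X) = [X, f]^Φ`. -/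
def dFun (f : Fn n M) : OneForm n F E where
  toFun X := A.act Φ X f
  map_add' X Y := by
    simp only [act, map_add, Derivation.add_apply]
    ring
  map_smul' g X := by
    simp only [act, map_smul, Derivation.smul_apply, smul_eq_mul, RingHom.id_apply]
    ring

/-- The differential `d^Φ μ` of a one-form:
`d^Φ μ (X, Y) = [X, μ(Y)]^Φ - [Y, μ(X)]^Φ - μ([X, Y])`. -/
def dForm (μ : OneForm n F E) (X Y : Sec n F E) : Fn n M :=
  A.act Φ X (μ Y) - A.act Φ Y (μ X) - μ (A.bracket X Y)

/-- The one-form `Φ` is a `1`-cocycle: `d Φ = 0` for the (untwisted) Lie algebroid differential. -/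
def IsCocycle : Prop := ∀ X Y : Sec n F E, A.dForm 0 Φ X Y = 0

/-- The Lie derivative `£^Φ_X μ = i_X d^Φ μ + d^Φ i_X μ` of a one-form. -/
def lieDer (X : Sec n F E) (μ : OneForm n F E) : OneForm n F E where
  toFun Y := A.dForm Φ μ X Y + A.dFun Φ (μ X) Y
  map_add' Y Z := by
    simp only [dForm, act, map_add, Derivation.add_apply]
    ring
  map_smul' g Y := by
    simp only [dForm, act, map_smul, Derivation.smul_apply, smul_eq_mul, RingHom.id_apply,
      A.leibniz, map_add, Derivation.leibniz]
    ring

end LieAlgebroid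

end Algebroid

/-! ### Multisections -/

section Multi

variable (n : ℕ) {M : Type*} [TopologicalSpace M] [ChartedSpace (EuclideanSpace ℝ (Fin n)) M]
  (F : Type*) [NormedAddCommGroup F] [NormedSpace ℝ F]
  (E : M → Type*) [TopologicalSpace (TotalSpace F E)] [∀ x, AddCommGroup (E x)]
  [∀ x, Module ℝ (E x)] [∀ x, TopologicalSpace (E x)] [FiberBundle F E] [VectorBundle ℝ F E]

/-- Finite sums of families `f · s_1 ∧ … ∧ s_k` with a smooth function `f` and smooth sections
`s_i`. -/
def decSpan (k : ℕ) : Submodule ℝ (∀ p, ExteriorAlgebra ℝ (E p)) :=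
  Submodule.span ℝ {Z | ∃ (f : Fn n M) (s : Fin k → Sec n F E),
    Z = fun p => f p • ExteriorAlgebra.ιMulti ℝ k (fun i => s i p)}

/-- The smooth sections of the `k`-th exterior power of the bundle: the families of elements of the
exterior algebras of the fibres which near every point are finite sums of terms
`f · s_1 ∧ … ∧ s_k` with a smooth function `f` and smooth sections `s_i`. -/
def MultiSec (k : ℕ) : Submodule ℝ (∀ p, ExteriorAlgebra ℝ (E p)) where
  carrier := {X | ∀ p₀, ∃ Y ∈ decSpan n F E k, ∀ᶠ p in 𝓝 p₀, X p = Y p}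
  add_mem' := by
    intro X X' hX hX' p₀
    obtain ⟨Y, hY, h⟩ := hX p₀
    obtain ⟨Y', hY', h'⟩ := hX' p₀
    refine ⟨Y + Y', add_mem hY hY', ?_⟩
    filter_upwards [h, h'] with p h1 h2
    simp [h1, h2]
  zero_mem' := fun p₀ => ⟨0, zero_mem _, by simp⟩
  smul_mem' := by
    intro r X hX p₀
    obtain ⟨Y, hY, h⟩ := hX p₀
    refine ⟨r • Y, Submodule.smul_mem _ r hY, ?_⟩
    filter_upwards [h] with p h1
    simp [h1]

variable {n F E}

theorem dec_mem {k : ℕ} (f : Fn n M) (s : Fin k → Sec n F E) :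
    (fun p => f p • ExteriorAlgebra.ιMulti ℝ k (fun i => s i p)) ∈ decSpan n F E k :=
  Submodule.subset_span ⟨f, s, rfl⟩

theorem decSpan_le_multiSec (k : ℕ) : decSpan n F E k ≤ MultiSec n F E k :=
  fun X hX _ => ⟨X, hX, by simp⟩

/-- A smooth function as an element of degree `0` for the wedge product. -/
def ofFn (f : Fn n M) : MultiSec n F E 0 :=
  ⟨fun p => algebraMap ℝ (ExteriorAlgebra ℝ (E p)) (f p), by
    apply decSpan_le_multiSec
    have h := dec_mem (E := E) (F := F) (k := 0) f (fun i => i.elim0)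
    simpa [Algebra.algebraMap_eq_smul_one] using h⟩

/-- A smooth section as an element of degree `1` for the wedge product. -/
def ofSec (s : Sec n F E) : MultiSec n F E 1 :=
  ⟨fun p => ExteriorAlgebra.ι ℝ (s p), by
    apply decSpan_le_multiSec
    have h := dec_mem (E := E) (F := F) (k := 1) (1 : Fn n M) (fun _ => s)
    simpa [ExteriorAlgebra.ιMulti_apply] using h⟩

theorem decSpan_mul {k l : ℕ} {X Y : ∀ p, ExteriorAlgebra ℝ (E p)} (hX : X ∈ decSpan n F E k)
    (hY : Y ∈ decSpan n F E l) : X * Y ∈ decSpan n F E (k + l) := by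
  induction hX using Submodule.span_induction with
  | mem X hX =>
    obtain ⟨f, s, rfl⟩ := hX
    induction hY using Submodule.span_induction with
    | mem Y hY =>
      obtain ⟨g, t, rfl⟩ := hY
      have h := dec_mem (k := k + l) (f * g) (Fin.append s t)
      convert h using 1
      funext p
      have h2 : (fun i => Fin.append s t i p) = Fin.append (fun i => s i p) (fun i => t i p) := by
        funext i
        refine Fin.addCases (fun i => ?_) (fun i => ?_) i <;> simp
      rw [h2, ← ExteriorAlgebra.ιMulti_mul_ιMulti]
      simp [smul_smul, mul_comm]
    | zero => simp
    | add Y Y' _ _ h h' => rw [mul_add]; exact add_mem h h'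
    | smul r Y _ h => rw [mul_smul_comm]; exact Submodule.smul_mem _ r h
  | zero => simp
  | add X X' _ _ h h' => rw [add_mul]; exact add_mem h h'
  | smul r X _ h => rw [smul_mul_assoc]; exact Submodule.smul_mem _ r h

/-- The wedge product of multisections. -/
def mulSec {k l : ℕ} (X : MultiSec n F E k) (Y : MultiSec n F E l) :
    MultiSec n F E (k + l) :=
  ⟨fun p => X.1 p * Y.1 p, by
    intro p₀
    obtain ⟨X', hX', h⟩ := X.2 p₀
    obtain ⟨Y', hY', h'⟩ := Y.2 p₀
    refine ⟨X' * Y', decSpan_mul hX' hY', ?_⟩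
    filter_upwards [h, h'] with p h1 h2
    simp [h1, h2]⟩

variable [IsManifold (𝓡 n) ∞ M] [T2Space M] [FiniteDimensional ℝ F]
  [ContMDiffVectorBundle ∞ F E (𝓡 n)]

/-- Pointwise contraction with a one-form. -/
def contractRaw (Φ : OneForm n F E) :
    (∀ p, ExteriorAlgebra ℝ (E p)) →ₗ[ℝ] (∀ p, ExteriorAlgebra ℝ (E p)) :=
  LinearMap.pi fun p => (CliffordAlgebra.contractLeft (formAt Φ p)).comp (LinearMap.proj p)

theorem contractRaw_ιMulti_mem (Φ : OneForm n F E) (k : ℕ) (s : Fin k → Sec n F E) :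
    contractRaw Φ (fun p => ExteriorAlgebra.ιMulti ℝ k (fun i => s i p)) ∈
      decSpan n F E (k - 1) := by
  induction k with
  | zero =>
    have h : contractRaw Φ (fun p => ExteriorAlgebra.ιMulti ℝ 0 (fun i => s i p)) = 0 := by
      funext p
      simp [contractRaw, ExteriorAlgebra.ιMulti_zero_apply, CliffordAlgebra.contractLeft_one]
    rw [h]
    exact zero_mem _
  | succ k ih =>
    have h1 : (fun p => Φ (s 0) p • ExteriorAlgebra.ιMulti ℝ k (fun i => s i.succ p)) ∈
        decSpan n F E k := dec_mem (Φ (s 0)) (fun i => s i.succ)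
    have h2 : (fun p => ExteriorAlgebra.ι ℝ (s 0 p)) *
        contractRaw Φ (fun p => ExteriorAlgebra.ιMulti ℝ k (fun i => s i.succ p)) ∈
        decSpan n F E k := by
      rcases k with _ | k
      · have h : contractRaw Φ (fun p => ExteriorAlgebra.ιMulti ℝ 0 (fun i => s i.succ p)) = 0 := by
          funext p
          simp [contractRaw, ExteriorAlgebra.ιMulti_zero_apply, CliffordAlgebra.contractLeft_one]
        rw [h, mul_zero]
        exact zero_mem _
      · have h3 : (fun p => ExteriorAlgebra.ι ℝ (s 0 p)) ∈ decSpan n F E 1 := by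
          have h := dec_mem (E := E) (F := F) (k := 1) (1 : Fn n M) (fun _ => s 0)
          simpa [ExteriorAlgebra.ιMulti_apply] using h
        have h4 := decSpan_mul h3 (ih (fun i => s i.succ))
        rwa [show 1 + (k + 1 - 1) = k + 1 by omega] at h4
    rw [Nat.add_sub_cancel]
    convert sub_mem h1 h2 using 1
    funext p
    simp only [contractRaw, LinearMap.pi_apply, LinearMap.comp_apply, LinearMap.proj_apply,
      Pi.sub_apply, Pi.mul_apply]
    rw [ExteriorAlgebra.ιMulti_succ_apply]
    refine (CliffordAlgebra.contractLeft_ι_mul (formAt Φ p) (s 0 p) _).trans ?_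
    rw [formAt_apply]
    rfl

theorem contractRaw_mem (Φ : OneForm n F E) {k : ℕ} {X : ∀ p, ExteriorAlgebra ℝ (E p)}
    (hX : X ∈ decSpan n F E k) : contractRaw Φ X ∈ decSpan n F E (k - 1) := by
  induction hX using Submodule.span_induction with
  | mem X hX =>
    obtain ⟨f, s, rfl⟩ := hX
    have hf := dec_mem (E := E) (F := F) (k := 0) f (fun i => i.elim0)
    have h := decSpan_mul hf (contractRaw_ιMulti_mem Φ k s)
    rw [Nat.zero_add] at h
    convert h using 1
    funext p
    simp [contractRaw, ExteriorAlgebra.ιMulti_zero_apply]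
  | zero => simp
  | add X X' _ _ h h' => rw [map_add]; exact add_mem h h'
  | smul r X _ h => rw [map_smul]; exact Submodule.smul_mem _ r h

/-- The contraction `i_Φ X` of a multisection with a one-form: `Φ` is inserted in the first place,
so that `i_Φ (s_1 ∧ … ∧ s_k) = ∑ (-1) ^ (i + 1) Φ(s_i) s_1 ∧ … (omit s_i) … ∧ s_k`; it is `0` on
functions. -/
def contract (Φ : OneForm n F E) {k : ℕ} (X : MultiSec n F E k) : MultiSec n F E (k - 1) :=
  ⟨contractRaw Φ X.1, by
    intro p₀
    obtain ⟨X', hX', h⟩ := X.2 p₀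
    refine ⟨contractRaw Φ X', contractRaw_mem Φ hX', ?_⟩
    filter_upwards [h] with p h1
    simp [contractRaw, h1]⟩

theorem mul_contract_mem (Φ : OneForm n F E) {k l : ℕ} (X : MultiSec n F E k)
    (Y : MultiSec n F E l) :
    (fun p => X.1 p * (contract Φ Y).1 p) ∈ MultiSec n F E (k + l - 1) ∧
    (fun p => (contract Φ X).1 p * Y.1 p) ∈ MultiSec n F E (k + l - 1) := by
  have h0 : ∀ Z : MultiSec n F E 0, (contract Φ Z).1 = 0 := by
    intro Z
    funext p
    obtain ⟨Z', hZ', h⟩ := Z.2 p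
    have hz : ∀ W ∈ decSpan n F E 0, contractRaw Φ W = 0 := by
      intro W hW
      induction hW using Submodule.span_induction with
      | mem W hW =>
        obtain ⟨f, s, rfl⟩ := hW
        funext q
        simp [contractRaw, ExteriorAlgebra.ιMulti_zero_apply, CliffordAlgebra.contractLeft_one]
      | zero => simp
      | add X X' _ _ h h' => rw [map_add, h, h', add_zero]
      | smul r X _ h => rw [map_smul, h, smul_zero]
    have h1 : contractRaw Φ Z.1 p = contractRaw Φ Z' p := by
      simp [contractRaw, h.self_of_nhds]
    change contractRaw Φ Z.1 p = 0
    rw [h1, hz Z' hZ']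
    rfl
  constructor
  · rcases l with _ | l
    · have h : (fun p => X.1 p * (contract Φ Y).1 p) = 0 := by
        funext p
        simp [h0]
      rw [h]
      exact zero_mem _
    · exact (mulSec X (contract Φ Y)).2
  · rcases k with _ | k
    · have h : (fun p => (contract Φ X).1 p * Y.1 p) = 0 := by
        funext p
        simp [h0]
      rw [h]
      exact zero_mem _
    · rw [show k + 1 + l - 1 = k + 1 - 1 + l by omega]
      exact (mulSec (contract Φ X) Y).2

end Multi

/-! ### Lifts and brackets -/

section Lifts

variable (n : ℕ) {M : Type*} [TopologicalSpace M] [ChartedSpace (EuclideanSpace ℝ (Fin n)) M]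
  (F : Type*) [NormedAddCommGroup F] [NormedSpace ℝ F]
  (E : M → Type*) [TopologicalSpace (TotalSpace F E)] [∀ x, AddCommGroup (E x)]
  [∀ x, Module ℝ (E x)] [∀ x, TopologicalSpace (E x)] [FiberBundle F E] [VectorBundle ℝ F E]
  [IsManifold (𝓡 n) ∞ M] [T2Space M] [FiniteDimensional ℝ F] [ContMDiffVectorBundle ∞ F E (𝓡 n)]

/-- The pullback `f ∘ τ` of a function along the bundle projection `τ`. -/
def pullback (f : Fn n M) : TotFn n F E :=
  ⟨fun x => f x.proj, f.contMDiff.comp (contMDiff_proj E)⟩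

/-- Families of linear maps from multisections of `E` to skew-symmetric multilinear operators on
the functions of the total space. -/
abbrev Lift : Type _ := ∀ k : ℕ, MultiSec n F E k →ₗ[ℝ] AltOp (TotFn n F E) k

/-- The defining properties of the vertical lift of multisections to multivector fields on the
total space: functions are pulled back, the vertical lift of a section is the vector field with
flow `v ↦ v + t X`, and wedge products are preserved. Multivector fields are the multiderivations
of the algebra of functions. -/
structure IsVerticalLift (v : Lift n F E) : Prop where
  multiDerivation : ∀ k X, IsMultiDerivation (v k X)
  function : ∀ f : Fn n M, v 0 (ofFn f) = constOp (pullback n F E f)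
  sec : ∀ (X : Sec n F E) (G : TotFn n F E) (x : TotalSpace F E),
    v 1 (ofSec X) ![G] x = deriv (fun t : ℝ => G ⟨x.proj, x.2 + t • X x.proj⟩) 0
  wedge : ∀ k l (X : MultiSec n F E k) (Y : MultiSec n F E l),
    v (k + l) (mulSec X Y) = wedge (k + l) (v k X) (v l Y)

/-- The vertical lift `X ↦ X^v`. -/
def verticalLift : Lift n F E := Classical.epsilon (IsVerticalLift n F E)

variable {n F E} (A : LieAlgebroid n F E) (Φ : OneForm n F E)

namespace LieAlgebroid

/-- The defining properties of the complete lift of multisections to multivector fields on the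
total space: `f^c = ι_{d f}`, `X^c(ι_μ) = ι_{£_X μ}`, `(X ∧ Y)^c = X^c ∧ Y^v + X^v ∧ Y^c`, with the
untwisted differential and Lie derivative. -/
structure IsCompleteLift (c : Lift n F E) : Prop where
  multiDerivation : ∀ k X, IsMultiDerivation (c k X)
  function : ∀ f : Fn n M, c 0 (ofFn f) = constOp (iota (A.dFun 0 f))
  sec : ∀ (X : Sec n F E) (μ : OneForm n F E),
    c 1 (ofSec X) ![iota μ] = iota (A.lieDer 0 X μ)
  wedge : ∀ k l (X : MultiSec n F E k) (Y : MultiSec n F E l),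
    c (k + l) (mulSec X Y) =
      wedge (k + l) (c k X) (verticalLift n F E l Y) +
        wedge (k + l) (verticalLift n F E k X) (c l Y)

/-- The complete lift `X ↦ X^c`. -/
def completeLift : Lift n F E := Classical.epsilon A.IsCompleteLift

/-- The defining properties of the Schouten–Nijenhuis bracket of multisections: a graded
skew-symmetric bracket which is a derivation for the wedge product and extends the bracket of
sections and the action `[X, f] = a(X)(f)` of sections on functions. A `k`-section has degree
`k - 1`; the bracket of two functions has degree `-2`, hence vanishes. -/
structure IsSchoutenNijenhuis
    (B : ∀ k l : ℕ, MultiSec n F E k →ₗ[ℝ] MultiSec n F E l →ₗ[ℝ] MultiSec n F E (k + l - 1)) :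
    Prop where
  fun_fun : B 0 0 = 0
  sec_fun : ∀ (X : Sec n F E) (f : Fn n M), B 1 0 (ofSec X) (ofFn f) = ofFn (A.anchor X f)
  sec_sec : ∀ X Y : Sec n F E, B 1 1 (ofSec X) (ofSec Y) = ofSec (A.bracket X Y)
  skew : ∀ k l (X : MultiSec n F E k) (Y : MultiSec n F E l),
    (B k l X Y).1 = - ((-1 : ℝ) ^ (((k : ℤ) - 1) * ((l : ℤ) - 1))) • (B l k Y X).1
  leibniz : ∀ k l m (X : MultiSec n F E k) (Y : MultiSec n F E l) (Z : MultiSec n F E m),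
    (B k (l + m) X (mulSec Y Z)).1 =
      (B k l X Y).1 * Z.1 + ((-1 : ℝ) ^ (((k : ℤ) - 1) * l)) • (Y.1 * (B k m X Z).1)

/-- The Schouten–Nijenhuis bracket of the Lie algebroid. -/
def schoutenNijenhuis (k l : ℕ) :
    MultiSec n F E k →ₗ[ℝ] MultiSec n F E l →ₗ[ℝ] MultiSec n F E (k + l - 1) :=
  Classical.epsilon A.IsSchoutenNijenhuis k l

/-- The Schouten–Jacobi bracket
`[X, Y]^Φ = [X, Y] + x X ∧ i_Φ Y - (-1) ^ x y i_Φ X ∧ Y`, where `x = k - 1` and `y = l - 1` are the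
degrees of `X` and `Y`. -/
def schoutenJacobi {k l : ℕ} (X : MultiSec n F E k) (Y : MultiSec n F E l) :
    MultiSec n F E (k + l - 1) :=
  A.schoutenNijenhuis k l X Y
    + ((k : ℝ) - 1) • ⟨fun p => X.1 p * (contract Φ Y).1 p, (mul_contract_mem Φ X Y).1⟩
    - ((-1 : ℝ) ^ ((k : ℤ) - 1) * ((l : ℝ) - 1)) •
        ⟨fun p => (contract Φ X).1 p * Y.1 p, (mul_contract_mem Φ X Y).2⟩

/-- The Jacobi lift `X^c - x ι_Φ X^v + I ∧ (i_Φ X)^v`, where `x = k - 1` is the degree of `X`. (For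
`k = 0` the last term is `0`.) -/
def jacobiLift {k : ℕ} (X : MultiSec n F E k) : AltOp (TotFn n F E) k :=
  A.completeLift k X
    - ((k : ℝ) - 1) • iota Φ • verticalLift n F E k X
    + wedge k idOp (verticalLift n F E (k - 1) (contract Φ X))

end LieAlgebroid

end Lifts

end JacobiAlgebroid

end

open JacobiAlgebroid

set_option linter.unusedSimpArgs false

noncomputable section

namespace JacobiAlgebroid

/-! ### The algebra of functions of lists -/

section ListAlgebra

/-! Everything is compared as operators on the total space. An alternating operator is stored as a
function of argument lists (`tot`), zero off its arity, so operators of all degrees live in one ring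
under the shuffle product and degrees such as `k + l - 1` cause no casts. Inserting an argument
(`cur`) is an antiderivation of this ring, and the identities for products, insertions and brackets
follow by induction on the list. The central one is `nr_mul`: for a first-order `A`, the bracket
with `B * C` obeys the graded Leibniz rule up to the extra term ± A(1, …) ∧ B ∧ C.

The vertical lift of X at a vector over p evaluates X(p) on the fibre differentials of the
arguments. It is therefore multiplicative, and it is injective (`vl_injective`), so identities
between multisections may be checked after lifting. The complete lift along a section σ is a
polarization of X: the value X(d_v G, …) is differentiated along a(σ), and the terms are added in
which one d_v G is replaced by d(σ*G) - £_σ(d_v G). Polarization is a derivation, which gives the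
product rule. These lifts exist locally and glue.

Uniqueness rests on two facts: multisections are locally generated by functions and sections
(`multiSec_induction`), and a derivation of the functions on the total space is determined by its
values on pullbacks and fibrewise linear functions (`derivation_ext`, from Hadamard's lemma). The
Schouten–Nijenhuis bracket is the multisection whose vertical lift is [X^c, Y^v]; it is skew because
[X^c, Y^v] = [X^v, Y^c] (`nr_cl_vl`).

When the Jacobi lift of X is evaluated with 1 as an argument, only I ∧ (i_Φ X)^v contributes, and
the result is (i_Φ X)^v (`cur_one_jl`). Direct expansion gives (c), and shows that the bracket of
the Jacobi lift of X with Y^v is ([X, Y]^Φ)^v (`vl_schoutenJacobi`). For (d), let T(X, Y) be the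
difference of the two sides. By (c) and `nr_mul`, T(X, Y ∧ Z) = T(X, Y) ∧ Z^v ± Y^v ∧ T(X, Z): the
extra terms cancel because the Jacobi lift commutes with contraction by Φ (`jl_contract`), which
needs dΦ = 0. By graded symmetry T then vanishes as soon as it does on functions and sections. There
the claim is that a + Φ is a representation on functions (`act_bracket`) and that the lifts of
sections, first-order operators in one variable, have the right commutators. -/

/-- Functions of finite lists, with the signed shuffle product. -/
def ListFun (S K : Type*) : Type _ := List S → K

namespace ListFun

variable {S K : Type*} [CommRing K]

instance : AddCommGroup (ListFun S K) := inferInstanceAs (AddCommGroup (List S → K))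

instance {R : Type*} [CommRing R] [Algebra R K] : Module R (ListFun S K) :=
  inferInstanceAs (Module R (List S → K))

theorem ext {f g : ListFun S K} (h : ∀ xs : List S, f xs = g xs) : f = g := funext h

@[simp] theorem add_apply (f g : ListFun S K) (xs : List S) : (f + g) xs = f xs + g xs := rfl
@[simp] theorem sub_apply (f g : ListFun S K) (xs : List S) : (f - g) xs = f xs - g xs := rfl
@[simp] theorem neg_apply (f : ListFun S K) (xs : List S) : (-f) xs = -f xs := rfl
@[simp] theorem zero_apply (xs : List S) : (0 : ListFun S K) xs = 0 := rfl
@[simp] theorem smul_apply {R : Type*} [CommRing R] [Algebra R K] (r : R) (f : ListFun S K)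
    (xs : List S) : (r • f) xs = r • f xs := rfl

/-- Insertion of `x` as the first argument. -/
def cur (x : S) (f : ListFun S K) : ListFun S K := fun xs => f (x :: xs)

/-- The grade involution. -/
def inv (f : ListFun S K) : ListFun S K := fun xs => (-1) ^ xs.length * f xs

/-- The signed sum over all splittings of a list into two complementary sublists. -/
def shuf (T : List S → List S → K) : List S → K
  | [] => T [] []
  | x :: xs => shuf (fun u w => T (x :: u) w) xs + shuf (fun u w => (-1) ^ u.length * T u (x :: w)) xs

theorem shuf_add (T T' : List S → List S → K) (xs : List S) :
    shuf (fun u w => T u w + T' u w) xs = shuf T xs + shuf T' xs := by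
  induction xs generalizing T T' with
  | nil => rfl
  | cons x xs ih => simp only [shuf, mul_add, ih]; ring

theorem shuf_mul (c : K) (T : List S → List S → K) (xs : List S) :
    shuf (fun u w => c * T u w) xs = c * shuf T xs := by
  induction xs generalizing T with
  | nil => rfl
  | cons x xs ih => simp only [shuf, mul_left_comm _ c, ih]; ring

theorem shuf_smul {R : Type*} [CommRing R] [Algebra R K] (c : R) (T : List S → List S → K)
    (xs : List S) : shuf (fun u w => c • T u w) xs = c • shuf T xs := by
  simp only [Algebra.smul_def, shuf_mul]

theorem shuf_neg (T : List S → List S → K) (xs : List S) :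
    shuf (fun u w => - T u w) xs = - shuf T xs := by
  simpa using shuf_mul (-1) T xs

theorem shuf_zero (xs : List S) : shuf (fun _ _ => (0 : K)) xs = 0 := by
  simpa using shuf_mul 0 (fun _ _ => (0 : K)) xs

instance : Mul (ListFun S K) := ⟨fun f g => shuf fun u w => f u * g w⟩

instance : One (ListFun S K) := ⟨fun xs => if xs = [] then 1 else 0⟩

theorem mul_def (f g : ListFun S K) (xs : List S) :
    (f * g) xs = shuf (fun u w => f u * g w) xs := rfl

theorem mul_nil (f g : ListFun S K) : (f * g) [] = f [] * g [] := rfl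

theorem one_nil : (1 : ListFun S K) [] = 1 := rfl

@[simp] theorem cur_apply (x : S) (f : ListFun S K) (xs : List S) : cur x f xs = f (x :: xs) := rfl

theorem inv_apply (f : ListFun S K) (xs : List S) : inv f xs = (-1) ^ xs.length * f xs := rfl

@[simp] theorem cur_one (x : S) : cur x (1 : ListFun S K) = 0 := rfl
@[simp] theorem cur_add (x : S) (f g : ListFun S K) : cur x (f + g) = cur x f + cur x g := rfl
@[simp] theorem cur_sub (x : S) (f g : ListFun S K) : cur x (f - g) = cur x f - cur x g := rfl
@[simp] theorem cur_neg (x : S) (f : ListFun S K) : cur x (-f) = -cur x f := rfl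
@[simp] theorem cur_zero (x : S) : cur x (0 : ListFun S K) = 0 := rfl
@[simp] theorem cur_smul {R : Type*} [CommRing R] [Algebra R K] (x : S) (r : R)
    (f : ListFun S K) : cur x (r • f) = r • cur x f := rfl

@[simp] theorem inv_smul {R : Type*} [CommRing R] [Algebra R K] (r : R)
    (f : ListFun S K) : inv (r • f) = r • inv f :=
  ext fun xs => by simp only [inv_apply, smul_apply, mul_smul_comm]
@[simp] theorem inv_one : inv (1 : ListFun S K) = 1 := by
  refine ext fun xs => ?_
  rcases xs with _ | ⟨x, xs⟩
  · simp [inv_apply]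
  · change _ * (0 : K) = 0
    simp
@[simp] theorem inv_inv (f : ListFun S K) : inv (inv f) = f := by
  refine ext fun xs => ?_
  rw [inv_apply, inv_apply, ← mul_assoc, ← mul_pow]
  simp
@[simp] theorem cur_inv (x : S) (f : ListFun S K) : cur x (inv f) = -inv (cur x f) :=
  ext fun xs => by simp only [cur_apply, inv_apply, neg_apply, List.length_cons]; ring

/-- The first argument goes to one factor or the other, and passing `f` costs the grade involution.
This recursion drives every induction on lists below. -/
theorem mul_cons (f g : ListFun S K) (x : S) (xs : List S) :
    (f * g) (x :: xs) = (cur x f * g) xs + (inv f * cur x g) xs := by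
  simp only [mul_def, shuf, cur_apply, inv_apply, mul_assoc]

protected theorem add_mul' (f g h : ListFun S K) : (f + g) * h = f * h + g * h :=
  ext fun xs => by simp only [mul_def, add_apply, _root_.add_mul, shuf_add]

protected theorem mul_add' (f g h : ListFun S K) : f * (g + h) = f * g + f * h :=
  ext fun xs => by simp only [mul_def, add_apply, _root_.mul_add, shuf_add]

protected theorem zero_mul' (f : ListFun S K) : 0 * f = 0 :=
  ext fun xs => by simp only [mul_def, zero_apply, MulZeroClass.zero_mul, shuf_zero]

protected theorem mul_zero' (f : ListFun S K) : f * 0 = 0 :=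
  ext fun xs => by simp only [mul_def, zero_apply, MulZeroClass.mul_zero, shuf_zero]

protected theorem neg_mul' (f g : ListFun S K) : -f * g = -(f * g) :=
  ext fun xs => by simp only [mul_def, neg_apply, _root_.neg_mul, shuf_neg]

protected theorem mul_neg' (f g : ListFun S K) : f * -g = -(f * g) :=
  ext fun xs => by simp only [mul_def, neg_apply, _root_.mul_neg, shuf_neg]

protected theorem smul_mul' {R : Type*} [CommRing R] [Algebra R K] (r : R) (f g : ListFun S K) :
    r • f * g = r • (f * g) :=
  ext fun xs => by simp only [mul_def, smul_apply, smul_mul_assoc, shuf_smul]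

protected theorem mul_smul' {R : Type*} [CommRing R] [Algebra R K] (r : R) (f g : ListFun S K) :
    f * r • g = r • (f * g) :=
  ext fun xs => by simp only [mul_def, smul_apply, mul_smul_comm, shuf_smul]

theorem inv_mul (f g : ListFun S K) : inv (f * g) = inv f * inv g := by
  refine ext fun xs => ?_
  induction xs generalizing f g with
  | nil => simp [inv_apply, mul_nil]
  | cons x xs ih =>
    have h : inv (f * g) (x :: xs) = -(inv (cur x f * g) xs + inv (inv f * cur x g) xs) := by
      simp only [inv_apply, mul_cons, List.length_cons]
      ring
    rw [h, ih, ih, mul_cons, cur_inv, cur_inv, ListFun.neg_mul', ListFun.mul_neg']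
    simp only [neg_apply]
    ring

theorem cur_mul (x : S) (f g : ListFun S K) : cur x (f * g) = cur x f * g + inv f * cur x g :=
  ext fun xs => mul_cons f g x xs

protected theorem mul_assoc' (f g h : ListFun S K) : f * g * h = f * (g * h) := by
  refine ext fun xs => ?_
  induction xs generalizing f g h with
  | nil => simp only [mul_nil, mul_assoc]
  | cons x xs ih =>
    rw [mul_cons, mul_cons, cur_mul, cur_mul, ListFun.add_mul', ListFun.mul_add', inv_mul]
    simp only [add_apply, ih]
    ring

protected theorem one_mul' (f : ListFun S K) : 1 * f = f := by
  refine ext fun xs => ?_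
  induction xs generalizing f with
  | nil => simp [mul_nil, one_nil]
  | cons x xs ih => rw [mul_cons, cur_one, inv_one, ih, ListFun.zero_mul']; simp

protected theorem mul_one' (f : ListFun S K) : f * 1 = f := by
  refine ext fun xs => ?_
  induction xs generalizing f with
  | nil => simp [mul_nil, one_nil]
  | cons x xs ih => rw [mul_cons, cur_one, ih, ListFun.mul_zero']; simp

instance : Ring (ListFun S K) :=
  { (inferInstance : AddCommGroup (ListFun S K)), (inferInstance : Mul (ListFun S K)),
    (inferInstance : One (ListFun S K)) with
    left_distrib := ListFun.mul_add'
    right_distrib := ListFun.add_mul'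
    zero_mul := ListFun.zero_mul'
    mul_zero := ListFun.mul_zero'
    mul_assoc := ListFun.mul_assoc'
    one_mul := ListFun.one_mul'
    mul_one := ListFun.mul_one' }

instance {R : Type*} [CommRing R] [Algebra R K] : Algebra R (ListFun S K) :=
  Algebra.ofModule ListFun.smul_mul' fun r f g => ListFun.mul_smul' r f g

/-- Even elements are central and odd elements commute up to the grade involution. -/
theorem comm_aux (xs : List S) : ∀ f g : ListFun S K,
    (inv f = f → (f * g) xs = (g * f) xs) ∧ (inv f = -f → (f * g) xs = (inv g * f) xs) := by
  induction xs with
  | nil =>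
    intro f g
    refine ⟨fun _ => ?_, fun _ => ?_⟩
    · simp only [mul_nil, mul_comm]
    · rw [mul_nil, mul_nil, inv_apply, List.length_nil, pow_zero, one_mul, mul_comm]
  | cons x xs ih =>
    intro f g
    -- Inserting an argument flips the parity, so the even and the odd statement feed each other and
    -- have to be proved together.
    have hc : inv (cur x f) = -cur x (inv f) := by simp
    refine ⟨fun h => ?_, fun h => ?_⟩
    · rw [h] at hc
      rw [mul_cons, mul_cons, h, (ih _ _).1 h, (ih _ _).2 hc]
      ring
    · rw [h, cur_neg, neg_neg] at hc
      rw [mul_cons, mul_cons, h, inv_inv, (ih _ _).1 hc, cur_inv]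
      simp only [neg_mul, neg_apply]
      rw [(ih f (cur x g)).2 h]
      ring

theorem comm_of_even {f : ListFun S K} (h : inv f = f) (g : ListFun S K) : f * g = g * f :=
  ext fun xs => (comm_aux xs f g).1 h

theorem comm_of_odd {f : ListFun S K} (h : inv f = -f) (g : ListFun S K) : f * g = inv g * f :=
  ext fun xs => (comm_aux xs f g).2 h

/-- `f` vanishes on lists whose length is not `k`. -/
def IsHom (k : ℕ) (f : ListFun S K) : Prop := ∀ xs : List S, xs.length ≠ k → f xs = 0

theorem IsHom.inv_eq {k : ℕ} {f : ListFun S K} (h : IsHom k f) : inv f = (-1 : K) ^ k • f := by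
  refine ext fun xs => ?_
  by_cases hx : xs.length = k
  · simp [inv_apply, hx]
  · simp [inv_apply, h xs hx]

theorem IsHom.cur {k : ℕ} {f : ListFun S K} (h : IsHom (k + 1) f) (x : S) : IsHom k (cur x f) :=
  fun xs hx => h _ (by simpa using hx)

theorem IsHom.cur_zero {f : ListFun S K} (h : IsHom 0 f) (x : S) : ListFun.cur x f = 0 :=
  ext fun xs => h _ (by simp)

theorem IsHom.mul {k l : ℕ} {f g : ListFun S K} (hf : IsHom k f) (hg : IsHom l g) :
    IsHom (k + l) (f * g) := by
  have key : ∀ (xs : List S) (T : List S → List S → K),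
      (∀ u w, u.length + w.length = xs.length → T u w = 0) → shuf T xs = 0 := by
    intro xs
    induction xs with
    | nil => intro T h; exact h [] [] rfl
    | cons x xs ih =>
      intro T h
      rw [shuf, ih, ih, add_zero]
      · intro u w hu
        rw [h _ _ (by simp only [List.length_cons]; omega), mul_zero]
      · intro u w hu
        exact h _ _ (by simp only [List.length_cons]; omega)
  intro xs hx
  refine key xs _ fun u w huw => ?_
  by_cases hu : u.length = k
  · rw [hg w (by omega), mul_zero]
  · rw [hf u hu, zero_mul]

end ListFun

end ListAlgebra

/-! ### Insertion of one operator into another, and the Nijenhuis–Richardson bracket. -/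

section Insertion

namespace ListFun

variable {W : Type*} [CommRing W] [Algebra ℝ W]

/-- The insertion `i_B A` for functions of lists. -/
def ins (B A : ListFun W W) : ListFun W W := shuf fun u w => A (B u :: w)

/-- `A` is real multilinear and skew-symmetric. -/
structure IsAlt {K : Type*} [CommRing K] [Algebra ℝ K] (A : ListFun W K) : Prop where
  add : ∀ us x y vs, A (us ++ (x + y) :: vs) = A (us ++ x :: vs) + A (us ++ y :: vs)
  smul : ∀ us (r : ℝ) x vs, A (us ++ (r • x) :: vs) = r • A (us ++ x :: vs)
  swap : ∀ us x y vs, A (us ++ x :: y :: vs) = - A (us ++ y :: x :: vs)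

/-- `A` is a derivation in each argument. -/
def IsDer (A : ListFun W W) : Prop :=
  ∀ us f g vs, A (us ++ (f * g) :: vs) = f * A (us ++ g :: vs) + g * A (us ++ f :: vs)

/-- `A` is a first-order differential operator in each argument. -/
def IsFirst (A : ListFun W W) : Prop :=
  ∀ us f g vs, A (us ++ (f * g) :: vs) =
    f * A (us ++ g :: vs) + g * A (us ++ f :: vs) - f * g * A (us ++ 1 :: vs)

section

variable {K : Type*} [CommRing K] [Algebra ℝ K] {A B : ListFun W K}

theorem IsAlt.cur (h : IsAlt A) (x : W) : IsAlt (cur x A) :=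
  ⟨fun us => h.add (x :: us), fun us => h.smul (x :: us), fun us => h.swap (x :: us)⟩

theorem IsAlt.cur_add (h : IsAlt A) (x y : W) :
    ListFun.cur (x + y) A = ListFun.cur x A + ListFun.cur y A := ext fun xs => h.add [] x y xs

theorem IsAlt.cur_smul (h : IsAlt A) (r : ℝ) (x : W) :
    ListFun.cur (r • x) A = r • ListFun.cur x A := ext fun xs => h.smul [] r x xs

theorem IsAlt.cur_zero (h : IsAlt A) : ListFun.cur (0 : W) A = 0 := by
  simpa using h.cur_smul 0 0

theorem IsAlt.cur_cur (h : IsAlt A) (x y : W) :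
    ListFun.cur y (ListFun.cur x A) = -ListFun.cur x (ListFun.cur y A) :=
  ext fun xs => h.swap [] x y xs

theorem isAlt_of_cur (hadd : ∀ x y, cur (x + y) A = cur x A + cur y A)
    (hsmul : ∀ (r : ℝ) x, cur (r • x) A = r • cur x A)
    (hswap : ∀ x y, cur y (cur x A) = -cur x (cur y A)) (hcur : ∀ x, IsAlt (cur x A)) :
    IsAlt A := by
  refine ⟨fun us => ?_, fun us => ?_, fun us => ?_⟩
  · rcases us with _ | ⟨z, us⟩
    · exact fun x y vs => congrFun (hadd x y) vs
    · exact (hcur z).add us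
  · rcases us with _ | ⟨z, us⟩
    · exact fun r x vs => congrFun (hsmul r x) vs
    · exact (hcur z).smul us
  · rcases us with _ | ⟨z, us⟩
    · exact fun x y vs => congrFun (hswap x y) vs
    · exact (hcur z).swap us

theorem IsAlt.invF (hA : IsAlt A) : IsAlt (inv A) :=
  ⟨fun us x y vs => by
      simp only [inv_apply, hA.add, List.length_append, List.length_cons]; ring,
   fun us r x vs => by
      simp only [inv_apply, hA.smul, List.length_append, List.length_cons, mul_smul_comm],
   fun us x y vs => by
      simp only [inv_apply, hA.swap us x, List.length_append, List.length_cons]; ring⟩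

theorem IsAlt.mul (hA : IsAlt A) (hB : IsAlt B) : IsAlt (A * B) := by
  have key : ∀ (us : List W) (A B : ListFun W K), IsAlt A → IsAlt B →
      (∀ x y vs, (A * B) (us ++ (x + y) :: vs) = (A * B) (us ++ x :: vs) + (A * B) (us ++ y :: vs)) ∧
      (∀ (r : ℝ) x vs, (A * B) (us ++ (r • x) :: vs) = r • (A * B) (us ++ x :: vs)) ∧
      (∀ x y vs, (A * B) (us ++ x :: y :: vs) = - (A * B) (us ++ y :: x :: vs)) := by
    intro us
    induction us with
    | nil =>
      intro A B hA hB
      refine ⟨fun x y vs => ?_, fun r x vs => ?_, fun x y vs => ?_⟩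
      · simp only [List.nil_append, mul_cons, hA.cur_add, hB.cur_add, add_mul, mul_add, add_apply]
        ring
      · simp only [List.nil_append, mul_cons, hA.cur_smul, hB.cur_smul, smul_mul_assoc,
          mul_smul_comm, smul_apply, smul_add]
      · simp only [List.nil_append, mul_cons, cur_inv, neg_mul, neg_apply, inv_inv,
          hA.cur_cur x y, hB.cur_cur x y, mul_neg]
        ring
    | cons z us ih =>
      intro A B hA hB
      obtain ⟨a1, a2, a3⟩ := ih (ListFun.cur z A) B (hA.cur z) hB
      obtain ⟨b1, b2, b3⟩ := ih (inv A) (ListFun.cur z B) hA.invF (hB.cur z)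
      refine ⟨fun x y vs => ?_, fun r x vs => ?_, fun x y vs => ?_⟩
      · simp only [List.cons_append, mul_cons, a1, b1]; ring
      · simp only [List.cons_append, mul_cons, a2, b2, smul_add]
      · simp only [List.cons_append, mul_cons, a3 x y, b3 x y]; ring
  exact ⟨fun us => (key us A B hA hB).1, fun us => (key us A B hA hB).2.1,
    fun us => (key us A B hA hB).2.2⟩

end

variable {A B C : ListFun W W}

theorem IsDer.cur (h : IsDer A) (x : W) : IsDer (cur x A) := fun us => h (x :: us)
theorem IsFirst.cur (h : IsFirst A) (x : W) : IsFirst (cur x A) := fun us => h (x :: us)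

theorem IsDer.cur_mul (h : IsDer A) (f g : W) :
    ListFun.cur (f * g) A = f • ListFun.cur g A + g • ListFun.cur f A := ext fun xs => h [] f g xs

theorem IsDer.apply_one (h : IsDer A) (us vs : List W) : A (us ++ 1 :: vs) = 0 := by
  simpa using h us 1 1 vs

theorem IsDer.cur_one (h : IsDer A) : ListFun.cur 1 A = 0 := ext fun xs => h.apply_one [] xs

theorem IsDer.isFirst (h : IsDer A) : IsFirst A := fun us f g vs => by
  rw [h us f g vs, h.apply_one, mul_zero, sub_zero]

theorem ins_nil (B A : ListFun W W) : ins B A [] = A [B []] := rfl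

/-- The argument `x` is used either by `B` or by `A`. In the second case it stands behind the value
of `B`; swapping the two gives the minus sign, and the shuffle sign is absorbed into `inv B` by
linearity of `A`. -/
theorem ins_cons (B : ListFun W W) (hA : IsAlt A) (x : W) (xs : List W) :
    ins B A (x :: xs) = ins (cur x B) A xs - ins (inv B) (cur x A) xs := by
  simp only [ins, shuf, cur_apply, sub_eq_add_neg, ← shuf_neg]
  congr 2
  funext u w
  have h1 := hA.swap [] (B u) x w
  have h2 := (hA.cur x).smul [] ((-1) ^ u.length) (B u) w
  simp only [List.nil_append, cur_apply] at h1 h2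
  have h3 : inv B u = ((-1 : ℝ) ^ u.length) • B u := by
    rw [inv_apply, Algebra.smul_def]; simp
  rw [h1, h3, h2, Algebra.smul_def]
  simp

theorem ins_add_right (B A A' : ListFun W W) : ins B (A + A') = ins B A + ins B A' :=
  ext fun xs => shuf_add _ _ xs

theorem ins_neg_right (B A : ListFun W W) : ins B (-A) = -ins B A :=
  ext fun xs => shuf_neg _ xs

theorem ins_smul_right {R : Type*} [CommRing R] [Algebra R W] (r : R) (B A : ListFun W W) :
    ins B (r • A) = r • ins B A :=
  ext fun xs => shuf_smul r _ xs

theorem ins_add_left (B B' : ListFun W W) (hA : IsAlt A) : ins (B + B') A = ins B A + ins B' A := by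
  refine ext fun xs => ?_
  rw [add_apply, ins, ins, ins, ← shuf_add]
  congr 1
  funext u w
  exact hA.add [] _ _ w

theorem ins_smul_left (r : ℝ) (B : ListFun W W) (hA : IsAlt A) : ins (r • B) A = r • ins B A := by
  refine ext fun xs => ?_
  rw [smul_apply, ins, ins, ← shuf_smul]
  congr 1
  funext u w
  exact hA.smul [] _ _ w

theorem ins_neg_left (B : ListFun W W) (hA : IsAlt A) : ins (-B) A = -ins B A := by
  simpa using ins_smul_left (-1) B hA

theorem ins_zero_left (hA : IsAlt A) : ins 0 A = 0 := by
  simpa using ins_smul_left 0 0 hA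

/-- The value of `B` occupies one slot of `A`, so the lengths seen by `A` and `B` add up to one more
than the length of the list. -/
theorem inv_ins (B : ListFun W W) (hA : IsAlt A) : inv (ins B A) = -ins (inv B) (inv A) := by
  refine ext fun xs => ?_
  induction xs generalizing A B with
  | nil => simp [inv_apply, ins_nil]
  | cons x xs ih =>
    have h : inv (ins B A) (x :: xs) =
        -(inv (ins (cur x B) A) xs - inv (ins (inv B) (cur x A)) xs) := by
      simp only [inv_apply, ins_cons B hA, List.length_cons]
      ring
    rw [h, ih _ hA, ih _ (hA.cur x), neg_apply, neg_apply, neg_apply, ins_cons _ hA.invF,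
      cur_inv, cur_inv, ins_neg_left _ hA.invF, ins_neg_right]
    simp only [neg_apply]

theorem cur_ins (B : ListFun W W) (hA : IsAlt A) (x : W) :
    cur x (ins B A) = ins (cur x B) A - ins (inv B) (cur x A) :=
  ext fun xs => ins_cons B hA x xs

/-- The insertion of `A` into a product. -/
theorem ins_mul_aux (xs : List W) : ∀ A B C : ListFun W W, IsAlt B → IsAlt C →
    (inv A = A → ins A (B * C) xs = (ins A B * C) xs + (inv B * ins A C) xs) ∧
    (inv A = -A → ins A (B * C) xs = (ins A B * C) xs + (B * ins A C) xs) := by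
  induction xs with
  | nil =>
    intro A B C hB hC
    have h : ∀ x, (B * C) [x] = B [x] * C [] + inv B [] * C [x] := fun x => mul_cons B C x []
    have h' : inv B [] = B [] := by simp [inv_apply]
    simp only [ins_nil, h, mul_nil, h', implies_true, and_self]
  | cons x xs ih =>
    intro A B C hB hC
    have hBC := hB.mul hC
    have hc : inv (cur x A) = -cur x (inv A) := by simp
    refine ⟨fun h => ?_, fun h => ?_⟩
    · rw [h] at hc
      rw [ins_cons A hBC, mul_cons, mul_cons, cur_mul, h, ins_add_right, cur_ins _ hB,
        cur_ins _ hC, inv_ins _ hB, h, inv_inv, cur_inv,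
        add_apply, (ih (cur x A) B C hB hC).2 hc, (ih A (cur x B) C (hB.cur x) hC).1 h,
        (ih A (inv B) (cur x C) hB.invF (hC.cur x)).1 h]
      simp only [sub_mul, mul_sub, add_apply, sub_apply, inv_inv, neg_mul, neg_apply, h]
      ring
    · rw [h, cur_neg, neg_neg] at hc
      rw [ins_cons A hBC, mul_cons, mul_cons, cur_mul, h, ins_add_right, cur_ins _ hB,
        cur_ins _ hC, inv_ins _ hB, h, ins_neg_left _ (hB.cur x), ins_neg_left _ (hC.cur x),
        ins_neg_left _ hB.invF, ins_neg_left _ ((hB.cur x).mul hC),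
        ins_neg_left _ (hB.invF.mul (hC.cur x))]
      simp only [sub_mul, mul_sub, add_apply, sub_apply, neg_mul, neg_apply, mul_neg, neg_neg]
      rw [(ih (cur x A) B C hB hC).1 hc, (ih A (cur x B) C (hB.cur x) hC).2 h,
        (ih A (inv B) (cur x C) hB.invF (hC.cur x)).2 h]
      ring

/-- The insertion of a product into a first-order operator. -/
theorem mul_ins_aux (xs : List W) : ∀ (A B C : ListFun W W) (γ η τ : ℝ), IsAlt A → IsFirst A →
    inv C = γ • C → inv A = η • A →
    (γ = 1 ∧ η = 1 ∧ τ = 1 ∨ γ = 1 ∧ η = -1 ∧ τ = 1 ∨ γ = -1 ∧ η = -1 ∧ τ = 1 ∨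
      γ = -1 ∧ η = 1 ∧ τ = -1) →
    ins (B * C) A xs = (B * ins C A) xs + τ • (ins B A * C) xs - (B * C * cur 1 A) xs := by
  -- Only parities matter: `γ` is that of `C`, `η` that of `A`, and `τ` is the Koszul sign, equal to
  -- -1 only for odd `C` and even `A`. Moving `x` into `C` flips `γ` and moving it into `A` flips
  -- `η`, so the four cases call each other.
  induction xs with
  | nil =>
    intro A B C γ η τ hA hF hC hη h
    have hm : (B * C) [] = B [] * C [] := rfl
    have h1 := hF [] (B []) (C []) []
    simp only [List.nil_append] at h1
    simp only [ins_nil, mul_nil, h1, cur_apply]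
    rcases h with h | h | h | ⟨rfl, -, -⟩
    iterate 3
      rw [h.2.2, one_smul]
      ring
    -- With `τ = -1` the first-order rule alone would give the wrong sign on the empty list, but an
    -- odd `C` vanishes there.
    have h2 := congrFun hC []
    simp only [inv_apply, smul_apply, List.length_nil, pow_zero, one_mul, neg_smul, one_smul] at h2
    have h3 : (2 : ℝ) • C [] = 0 := by
      rw [two_smul]
      exact eq_neg_iff_add_eq_zero.1 h2
    have h4 : C [] = 0 := (smul_eq_zero.1 h3).resolve_left (by norm_num)
    rw [h4]
    simp
  | cons x xs ih =>
    intro A B C γ η τ hA hF hC hη h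
    have hcC : inv (cur x C) = (-γ) • cur x C := by
      have : inv (cur x C) = -cur x (inv C) := by simp
      rw [this, hC, cur_smul, neg_smul]
    have hcA : inv (cur x A) = (-η) • cur x A := by
      have : inv (cur x A) = -cur x (inv A) := by simp
      rw [this, hη, cur_smul, neg_smul]
    have hiC : inv (inv C) = γ • inv C := by rw [hC, inv_smul, hC]
    rw [ins_cons _ hA, cur_mul, ins_add_left _ _ hA, inv_mul, add_apply, mul_cons, mul_cons,
      mul_cons, cur_ins _ hA, cur_ins _ hA, inv_ins _ hA, hA.cur_cur, cur_mul, inv_mul]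
    rcases h with ⟨rfl, rfl, rfl⟩ | ⟨rfl, rfl, rfl⟩ | ⟨rfl, rfl, rfl⟩ | ⟨rfl, rfl, rfl⟩
    · rw [ih A (cur x B) C 1 1 1 hA hF hC hη (by norm_num),
        ih A (inv B) (cur x C) (-1) 1 (-1) hA hF hcC hη (by norm_num),
        ih (cur x A) (inv B) (inv C) 1 (-1) 1 (hA.cur x) (hF.cur x) hiC hcA (by norm_num), hC, hη]
      simp only [one_smul, neg_smul, neg_neg, add_mul, sub_mul, mul_sub, neg_mul, mul_neg,
        add_apply, sub_apply, neg_apply, mul_assoc]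
      ring
    · rw [ih A (cur x B) C 1 (-1) 1 hA hF hC hη (by norm_num),
        ih A (inv B) (cur x C) (-1) (-1) 1 hA hF hcC hη (by norm_num),
        ih (cur x A) (inv B) (inv C) 1 1 1 (hA.cur x) (hF.cur x) hiC (by simpa using hcA)
          (by norm_num), hC, hη]
      simp only [one_smul, neg_smul, neg_neg, add_mul, sub_mul, mul_sub, neg_mul, mul_neg,
        add_apply, sub_apply, neg_apply, ins_neg_right, mul_assoc]
      ring
    · rw [ih A (cur x B) C (-1) (-1) 1 hA hF hC hη (by norm_num),
        ih A (inv B) (cur x C) 1 (-1) 1 hA hF (by simpa using hcC) hη (by norm_num),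
        ih (cur x A) (inv B) (inv C) (-1) 1 (-1) (hA.cur x) (hF.cur x) hiC (by simpa using hcA)
          (by norm_num), hC, hη]
      simp only [one_smul, neg_smul, neg_neg, add_mul, sub_mul, mul_sub, neg_mul, mul_neg,
        add_apply, sub_apply, neg_apply, ins_neg_right, ins_neg_left _ (hA.cur x), mul_assoc]
      ring
    · rw [ih A (cur x B) C (-1) 1 (-1) hA hF hC hη (by norm_num),
        ih A (inv B) (cur x C) 1 1 1 hA hF (by simpa using hcC) hη (by norm_num),
        ih (cur x A) (inv B) (inv C) (-1) (-1) 1 (hA.cur x) (hF.cur x) hiC hcA (by norm_num),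
        hC, hη]
      simp only [one_smul, neg_smul, neg_neg, add_mul, sub_mul, mul_sub, neg_mul, mul_neg,
        add_apply, sub_apply, neg_apply, ins_neg_left _ (hA.cur x), mul_assoc]
      ring

theorem neg_one_pow_cases (k : ℕ) : (-1 : ℝ) ^ k = 1 ∨ (-1 : ℝ) ^ k = -1 :=
  neg_one_pow_eq_or ℝ k

theorem IsHom.inv_eq_real {k : ℕ} {f : ListFun W W} (h : IsHom k f) :
    inv f = (-1 : ℝ) ^ k • f := by
  rw [h.inv_eq]
  rcases Nat.even_or_odd k with hk | hk <;> simp [hk.neg_one_pow]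

theorem neg_one_zpow_sub (k : ℕ) (j : ℤ) : (-1 : ℝ) ^ (((k : ℤ) - 1) * j) =
    if Even j then 1 else -(-1) ^ k := by
  split_ifs with hj
  · exact Even.neg_one_zpow (hj.mul_left _)
  · rw [Int.not_even_iff_odd] at hj
    rcases Nat.even_or_odd k with hk | hk
    · have : Odd (((k : ℤ) - 1) * j) := by
        rw [Int.odd_mul]
        exact ⟨by rw [Int.odd_sub]; simpa using hk, hj⟩
      rw [this.neg_one_zpow, hk.neg_one_pow]
    · have : Even (((k : ℤ) - 1) * j) := by
        rw [Int.even_mul]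
        left
        rw [Int.even_sub]
        simpa using hk
      rw [this.neg_one_zpow, hk.neg_one_pow, neg_neg]

/-- The Nijenhuis–Richardson bracket of a `k`-linear and an `l`-linear operator. -/
def nr (k l : ℕ) (A B : ListFun W W) : ListFun W W :=
  -ins A B + ((-1 : ℝ) ^ (((k : ℤ) - 1) * ((l : ℤ) - 1))) • ins B A

theorem nr_skew (k l : ℕ) (A B : ListFun W W) :
    nr k l A B = -((-1 : ℝ) ^ (((k : ℤ) - 1) * ((l : ℤ) - 1))) • nr l k B A := by
  have h : ((-1 : ℝ) ^ (((k : ℤ) - 1) * ((l : ℤ) - 1))) *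
      ((-1 : ℝ) ^ (((k : ℤ) - 1) * ((l : ℤ) - 1))) = 1 := by
    rw [← zpow_add₀ (by norm_num)]
    exact Even.neg_one_zpow (Even.add_self _)
  rw [nr, nr, mul_comm ((l : ℤ) - 1)]
  rw [smul_add, smul_smul, neg_mul, h]
  module

/-- The Leibniz rule for the Nijenhuis–Richardson bracket with a first-order operator. -/
theorem nr_mul {k l m : ℕ} {A B C : ListFun W W} (hA : IsAlt A) (hF : IsFirst A) (hB : IsAlt B)
    (hC : IsAlt C) (hk : IsHom k A) (hl : IsHom l B) (hm : IsHom m C) :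
    nr k (l + m) A (B * C) = nr k l A B * C +
      ((-1 : ℝ) ^ (((k : ℤ) - 1) * l)) • (B * nr k m A C) +
      (-1 : ℝ) ^ k • (cur 1 A * B * C) := by
  -- Insertion into a product is a graded derivation for any operator; being of first order is
  -- needed only in `h2`, where the product is inserted into `A`.
  have h1 : ins A (B * C) = ins A B * C + ((-1 : ℝ) ^ (((k : ℤ) - 1) * l)) • (B * ins A C) := by
    refine ext fun xs => ?_
    obtain ⟨e, o⟩ := ins_mul_aux xs A B C hB hC
    rw [hk.inv_eq_real] at e o
    rw [neg_one_zpow_sub, add_apply, smul_apply]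
    rcases Nat.even_or_odd k with hk' | hk'
    · rw [e (by simp [hk'.neg_one_pow]), hl.inv_eq_real, hk'.neg_one_pow]
      rcases Nat.even_or_odd l with hl' | hl'
      · have : Even (l : ℤ) := by exact_mod_cast hl'
        simp [hl'.neg_one_pow, this]
      · have : ¬ Even (l : ℤ) := by simpa using hl'
        simp [hl'.neg_one_pow, this]
    · rw [o (by simp [hk'.neg_one_pow]), hk'.neg_one_pow]
      simp
  have h2 : ins (B * C) A = B * ins C A + ((-1 : ℝ) ^ (((k : ℤ) - 1) * m)) • (ins B A * C) -
      B * C * cur 1 A := by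
    refine ext fun xs => ?_
    rw [mul_ins_aux xs A B C ((-1) ^ m) ((-1) ^ k) ((-1 : ℝ) ^ (((k : ℤ) - 1) * m)) hA hF
      hm.inv_eq_real hk.inv_eq_real]
    · rfl
    · rw [neg_one_zpow_sub]
      rcases Nat.even_or_odd k with hk' | hk' <;> rcases Nat.even_or_odd m with hm' | hm' <;>
      · simp [hk'.neg_one_pow, hm'.neg_one_pow, hm']
  -- The sign of moving the contraction with 1, of arity `k - 1`, to the front combines with the
  -- sign of the bracket to `(-1) ^ k`, independently of `l` and `m`.
  have h3 : B * C * cur 1 A = ((-1 : ℝ) ^ (((k : ℤ) - 1) * (l + m))) • (cur 1 A * B * C) := by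
    have hBC := (hl.mul hm).inv_eq_real
    rw [mul_assoc (cur 1 A), neg_one_zpow_sub]
    rcases Nat.even_or_odd (l + m) with h | h
    · have : Even ((l : ℤ) + m) := by exact_mod_cast h
      rw [if_pos this, one_smul]
      exact comm_of_even (by simpa [h.neg_one_pow] using hBC) _
    · have : ¬ Even ((l : ℤ) + m) := by
        rw [Int.not_even_iff_odd]
        exact_mod_cast h
      rw [if_neg this, comm_of_odd (by simpa [h.neg_one_pow] using hBC)]
      have hc : inv (cur 1 A) = -cur 1 (inv A) := by simp
      rw [hc, hk.inv_eq_real, cur_smul, ← neg_smul, smul_mul_assoc]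
  rw [nr, nr, nr, h1, h2, h3]
  simp only [neg_one_zpow_sub]
  rcases neg_one_pow_cases k with hk' | hk' <;>
  rcases Nat.even_or_odd l with hl' | hl' <;> rcases Nat.even_or_odd m with hm' | hm' <;>
  · have e1 := hl'
    have e2 := hm'
    try simp only [← Nat.not_even_iff_odd] at e1
    try simp only [← Nat.not_even_iff_odd] at e2
    simp only [hk', Nat.cast_add, Int.even_sub, Int.even_add, Int.even_coe_nat, e1, e2,
      Int.not_even_one, iff_true, iff_false, not_true_eq_false, not_false_eq_true, if_true,
      if_false, neg_neg, one_smul, neg_smul, add_mul, mul_add, neg_mul, mul_neg, iff_self]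
    abel

end ListFun
end Insertion

/-! ### Alternating sums over permutations versus sums over shuffles. -/

section PermSum

open Equiv ListFun

variable {W K : Type*} [CommRing K]

/-- The composite sends `p` to 0, so `p` can be read off as the preimage of 0, and then the
rearrangement of the other indices; equality of cardinalities does the rest. -/
theorem cons_comp_perm_bijective (m : ℕ) : Function.Bijective
    (fun q : Fin (m + 1) × Perm (Fin m) => Perm.decomposeFin.symm (0, q.2) * q.1.cycleRange) := by
  rw [Fintype.bijective_iff_injective_and_card]
  constructor
  · rintro ⟨p, e⟩ ⟨p', e'⟩ h
    have h' := congrArg (fun τ : Perm (Fin (m + 1)) => τ.symm 0) h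
    have hz : ∀ e : Perm (Fin m), (Perm.decomposeFin.symm (0, e)).symm 0 = 0 := fun e => by
      rw [Equiv.symm_apply_eq]
      simp
    have hp : ∀ (p : Fin (m + 1)) (e : Perm (Fin m)),
        (Perm.decomposeFin.symm (0, e) * p.cycleRange).symm 0 = p := by
      intro p e
      rw [Equiv.symm_apply_eq]
      simp
    simp only [hp] at h'
    subst h'
    have h2 := mul_right_cancel h
    have h3 := Perm.decomposeFin.symm.injective h2
    simpa using h3
  · simp [Fintype.card_perm, Nat.factorial_succ]

/-- The alternating sum over all rearrangements. -/
def permSum (m : ℕ) (G : List W → K) (v : Fin m → W) : K :=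
  ∑ σ : Perm (Fin m), Perm.sign σ • G (List.ofFn (v ∘ σ))

theorem ofFn_insertNth {m : ℕ} (p : Fin (m + 1)) (x : W) (v : Fin m → W) :
    List.ofFn (p.insertNth (α := fun _ => W) x v) = (List.ofFn v).insertIdx p x := by
  apply List.ext_getElem
  · rw [List.length_insertIdx_of_le_length (by simpa using Fin.is_le p)]
    simp
  · intro i h1 h2
    simp only [List.length_ofFn] at h1
    rw [List.getElem_ofFn, List.getElem_insertIdx]
    have hi : i < m + 1 := h1
    split_ifs with h h'
    · rw [Fin.insertNth_apply_below (by exact h), List.getElem_ofFn, eq_rec_constant]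
      rfl
    · have : (⟨i, hi⟩ : Fin (m + 1)) = p := Fin.ext h'
      rw [this, Fin.insertNth_apply_same]
    · rw [Fin.insertNth_apply_above (show p < ⟨i, hi⟩ from by
        rw [Fin.lt_def]; change (p : ℕ) < i; omega)]
      simp [Fin.pred]

/-- Laplace expansion according to the position `p` at which `x` lands; the cycle bringing it there
has sign `(-1) ^ p`. -/
theorem permSum_cons (m : ℕ) (G : List W → K) (x : W) (v : Fin m → W) :
    permSum (m + 1) G (Fin.cons (α := fun _ => W) x v) =
      ∑ p ∈ Finset.range (m + 1), (-1) ^ p * permSum m (fun l => G (l.insertIdx p x)) v := by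
  rw [Finset.sum_range, permSum, ← (cons_comp_perm_bijective m).sum_comp, Fintype.sum_prod_type]
  refine Finset.sum_congr rfl fun p _ => ?_
  rw [permSum, Finset.mul_sum]
  refine Finset.sum_congr rfl fun e _ => ?_
  have h1 : (Fin.cons (α := fun _ => W) x v) ∘
      (Perm.decomposeFin.symm (0, e) * p.cycleRange : Perm (Fin (m + 1))) =
      p.insertNth (α := fun _ => W) x (v ∘ e) := by
    rw [← Fin.cons_comp_cycleRange]
    funext i
    simp only [Function.comp_apply, Perm.mul_apply]
    refine Fin.cases ?_ (fun j => ?_) (p.cycleRange i)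
    · simp
    · simp
  rw [h1, ofFn_insertNth, Perm.sign_mul, Fin.sign_cycleRange, Perm.decomposeFin.symm_sign]
  rcases neg_one_pow_eq_or ℤˣ (p : ℕ) with h | h <;> rcases neg_one_pow_eq_or K (p : ℕ) with h' | h'
  all_goals
    rcases Nat.even_or_odd (p : ℕ) with hp | hp <;>
    simp [hp.neg_one_pow, Units.smul_def]

theorem swap_insertIdx {f : List W → K}
    (hf : ∀ us x y vs, f (us ++ x :: y :: vs) = - f (us ++ y :: x :: vs)) (x : W) (u : List W) :
    ∀ p ≤ u.length, f (u.insertIdx p x) = (-1) ^ p * f (x :: u) := by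
  induction u generalizing f with
  | nil =>
    intro p hp
    obtain rfl : p = 0 := by simpa using hp
    simp
  | cons y u ih =>
    intro p hp
    rcases p with _ | p
    · simp
    · have h := ih (f := fun l => f (y :: l)) (fun us => hf (y :: us)) p (by simpa using hp)
      have h' := hf [] y x u
      simp only [List.nil_append] at h'
      rw [List.insertIdx_succ_cons, h, h', pow_succ]
      simp

theorem take_insertIdx_succ (x : W) (l : List W) :
    ∀ p k, p ≤ k → p ≤ l.length → (l.insertIdx p x).take (k + 1) = (l.take k).insertIdx p x := by
  induction l with
  | nil =>
    intro p k _ hp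
    obtain rfl : p = 0 := by simpa using hp
    simp
  | cons y l ih =>
    intro p k h hp
    rcases p with _ | p
    · simp
    · rcases k with _ | k
      · omega
      · simp only [List.insertIdx_succ_cons, List.take_succ_cons]
        rw [ih p k (by omega) (by simpa using hp)]

theorem drop_insertIdx_succ (x : W) (l : List W) :
    ∀ p k, p ≤ k → p ≤ l.length → (l.insertIdx p x).drop (k + 1) = l.drop k := by
  induction l with
  | nil =>
    intro p k _ hp
    obtain rfl : p = 0 := by simpa using hp
    simp
  | cons y l ih =>
    intro p k h hp
    rcases p with _ | p
    · simp
    · rcases k with _ | k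
      · omega
      · simp only [List.insertIdx_succ_cons, List.drop_succ_cons]
        rw [ih p k (by omega) (by simpa using hp)]

theorem take_insertIdx_add (x : W) (l : List W) :
    ∀ k q, (k + q) ≤ l.length → (l.insertIdx (k + q) x).take k = l.take k := by
  induction l with
  | nil =>
    intro k q h
    obtain ⟨rfl, rfl⟩ : k = 0 ∧ q = 0 := by simpa using h
    simp
  | cons y l ih =>
    intro k q h
    rcases k with _ | k
    · simp
    · rw [Nat.add_right_comm, List.insertIdx_succ_cons, List.take_succ_cons, List.take_succ_cons,
        ih k q (by simp only [List.length_cons] at h; omega)]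

theorem drop_insertIdx_add (x : W) (l : List W) :
    ∀ k q, (k + q) ≤ l.length → (l.insertIdx (k + q) x).drop k = (l.drop k).insertIdx q x := by
  induction l with
  | nil =>
    intro k q h
    obtain ⟨rfl, rfl⟩ : k = 0 ∧ q = 0 := by simpa using h
    simp
  | cons y l ih =>
    intro k q h
    rcases k with _ | k
    · simp
    · rw [Nat.add_right_comm, List.insertIdx_succ_cons, List.drop_succ_cons, List.drop_succ_cons,
        ih k q (by simp only [List.length_cons] at h; omega)]

theorem permSum_congr (m : ℕ) {G G' : List W → K} (v : Fin m → W)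
    (h : ∀ l : List W, l.length = m → G l = G' l) : permSum m G v = permSum m G' v :=
  Finset.sum_congr rfl fun σ _ => by rw [h _ (by simp)]

theorem permSum_mul (m : ℕ) (c : K) (G : List W → K) (v : Fin m → W) :
    permSum m (fun l => c * G l) v = c * permSum m G v := by
  rw [permSum, permSum, Finset.mul_sum]
  refine Finset.sum_congr rfl fun σ _ => ?_
  rw [mul_smul_comm]

/-- The alternating sum over all permutations is a multiple of the sum over shuffles. -/
theorem permSum_eq_shuf (m : ℕ) : ∀ (k a : ℕ) (T : List W → List W → K) (v : Fin m → W),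
    k + a = m → (∀ u w, u.length ≠ k ∨ w.length ≠ a → T u w = 0) →
    (∀ us x y vs w, T (us ++ x :: y :: vs) w = - T (us ++ y :: x :: vs) w) →
    (∀ u us x y vs, T u (us ++ x :: y :: vs) = - T u (us ++ y :: x :: vs)) →
    permSum m (fun l => T (l.take k) (l.drop k)) v =
      ((k.factorial * a.factorial : ℕ) : K) * shuf T (List.ofFn v) := by
  induction m with
  | zero =>
    intro k a T v h _ _ _
    obtain ⟨rfl, rfl⟩ : k = 0 ∧ a = 0 := by omega
    simp [permSum, shuf]
  | succ m ih =>
    intro k a T v h h0 h1 h2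
    obtain ⟨x, v, rfl⟩ : ∃ x v', v = Fin.cons (α := fun _ => W) x v' :=
      ⟨v 0, Fin.tail v, (Fin.cons_self_tail v).symm⟩
    rw [permSum_cons, show Finset.range (m + 1) = Finset.range (k + a) by rw [h],
      Finset.sum_range_add]
    -- Positions `p < k` lie in the first block. Moving `x` to the front of the block cancels `(-1)
    -- ^ p`, so all `k` positions contribute equally, which turns the factor (k - 1)! of the
    -- induction hypothesis into k!.
    have e1 : ∑ p ∈ Finset.range k, (-1) ^ p *
        permSum m (fun l => T ((l.insertIdx p x).take k) ((l.insertIdx p x).drop k)) v =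
        ((k.factorial * a.factorial : ℕ) : K) * shuf (fun u w => T (x :: u) w) (List.ofFn v) := by
      rcases k with _ | k
      · have : (fun (u w : List W) => T (x :: u) w) = fun _ _ => 0 := by
          funext u w
          exact h0 _ _ (Or.inl (by simp))
        rw [this, shuf_zero]
        simp
      · have hs : ∀ p ∈ Finset.range (k + 1), (-1) ^ p *
            permSum m (fun l => T ((l.insertIdx p x).take (k + 1))
              ((l.insertIdx p x).drop (k + 1))) v =
            ((k.factorial * a.factorial : ℕ) : K) * shuf (fun u w => T (x :: u) w) (List.ofFn v) := by
          intro p hp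
          rw [Finset.mem_range] at hp
          rw [← ih k a (fun u w => T (x :: u) w) v (by omega)
            (fun u w hu => h0 _ _ (by simpa using hu)) (fun us => h1 (x :: us)) (fun u => h2 _),
            ← permSum_mul]
          refine permSum_congr m v fun l hl => ?_
          have ht : (l.insertIdx p x).take (k + 1) = (l.take k).insertIdx p x := by
            rw [take_insertIdx_succ x l p k (by omega) (by omega)]
          have hd : (l.insertIdx p x).drop (k + 1) = l.drop k := by
            rw [drop_insertIdx_succ x l p k (by omega) (by omega)]
          rw [ht, hd, swap_insertIdx (f := fun u => T u (l.drop k)) (fun us x y vs => h1 us x y vs _)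
            x (l.take k) p (by rw [List.length_take]; omega), ← mul_assoc, ← mul_pow]
          simp
        rw [Finset.sum_congr rfl hs, Finset.sum_const, Finset.card_range, Nat.factorial_succ]
        push_cast
        rw [nsmul_eq_mul]
        push_cast
        ring
    -- Positions `k + q` lie in the second block. Moving `x` to its front cancels `(-1) ^ q`, and
    -- the remaining `(-1) ^ k` is the shuffle sign of passing the first block.
    have e2 : ∑ q ∈ Finset.range a, (-1) ^ (k + q) *
        permSum m (fun l => T ((l.insertIdx (k + q) x).take k) ((l.insertIdx (k + q) x).drop k)) v =
        ((k.factorial * a.factorial : ℕ) : K) *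
          shuf (fun u w => (-1) ^ u.length * T u (x :: w)) (List.ofFn v) := by
      rcases a with _ | a
      · have : (fun (u w : List W) => (-1) ^ u.length * T u (x :: w)) = fun _ _ => 0 := by
          funext u w
          rw [h0 _ _ (Or.inr (by simp)), mul_zero]
        rw [this, shuf_zero]
        simp
      · have hs : ∀ q ∈ Finset.range (a + 1), (-1) ^ (k + q) *
            permSum m (fun l => T ((l.insertIdx (k + q) x).take k)
              ((l.insertIdx (k + q) x).drop k)) v =
            ((k.factorial * a.factorial : ℕ) : K) *
              shuf (fun u w => (-1) ^ u.length * T u (x :: w)) (List.ofFn v) := by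
          intro q hq
          rw [Finset.mem_range] at hq
          rw [← ih k a (fun u w => (-1) ^ u.length * T u (x :: w)) v (by omega)
            (fun u w hu => by rw [h0 _ _ (by simpa using hu), mul_zero])
            (fun us y z vs w => by rw [h1 us y z]; simp) (fun u us y z vs => by
              have := h2 u (x :: us) y z vs
              simp only [List.cons_append] at this
              rw [this]; simp), ← permSum_mul]
          refine permSum_congr m v fun l hl => ?_
          have ht : (l.insertIdx (k + q) x).take k = l.take k := by
            rw [take_insertIdx_add x l k q (by omega)]
          have hd : (l.insertIdx (k + q) x).drop k = (l.drop k).insertIdx q x := by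
            rw [drop_insertIdx_add x l k q (by omega)]
          rw [ht, hd, swap_insertIdx (f := fun w => T (l.take k) w) (fun us x y vs => h2 _ us x y vs)
            x (l.drop k) q (by rw [List.length_drop]; omega), List.length_take, min_eq_left (by omega),
            ← mul_assoc, pow_add, mul_assoc ((-1) ^ k), ← mul_pow]
          simp
        rw [Finset.sum_congr rfl hs, Finset.sum_const, Finset.card_range, Nat.factorial_succ]
        push_cast
        rw [nsmul_eq_mul]
        push_cast
        ring
    rw [e1, e2, List.ofFn_cons, shuf, mul_add]

end PermSum

/-! ### Alternating maps as functions of lists. -/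

section Tot

open Equiv ListFun

variable {W : Type*} [CommRing W] [Algebra ℝ W]

/-- A multilinear operator as a function of lists. -/
def tot {k : ℕ} (A : AltOp W k) : ListFun W W := fun xs =>
  if h : xs.length = k then A (fun i => xs.get (i.cast h.symm)) else 0

theorem tot_ofFn {k : ℕ} (A : AltOp W k) (v : Fin k → W) : tot A (List.ofFn v) = A v := by
  rw [tot, dif_pos (List.length_ofFn)]
  congr 1
  funext i
  simp

theorem exists_ofFn {k : ℕ} (xs : List W) (h : xs.length = k) : ∃ v : Fin k → W, xs = List.ofFn v := by
  subst h
  exact ⟨xs.get, (List.ofFn_get xs).symm⟩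

theorem tot_isHom {k : ℕ} (A : AltOp W k) : IsHom k (tot A) := fun _ h => dif_neg h

theorem eq_of_isHom {k : ℕ} {f g : ListFun W W} (hf : IsHom k f) (hg : IsHom k g)
    (h : ∀ v : Fin k → W, f (List.ofFn v) = g (List.ofFn v)) : f = g := by
  refine ListFun.ext fun xs => ?_
  by_cases hx : xs.length = k
  · obtain ⟨v, rfl⟩ := exists_ofFn xs hx
    exact h v
  · rw [hf xs hx, hg xs hx]

theorem tot_injective {k : ℕ} : Function.Injective (tot : AltOp W k → ListFun W W) := by
  intro A B h
  refine AlternatingMap.ext fun v => ?_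
  rw [← tot_ofFn A, h, tot_ofFn]

theorem tot_add {k : ℕ} (A B : AltOp W k) : tot (A + B) = tot A + tot B :=
  eq_of_isHom (tot_isHom _) (fun xs h => by simp [tot_isHom A xs h, tot_isHom B xs h]) fun v => by
    simp [tot_ofFn]

theorem tot_neg {k : ℕ} (A : AltOp W k) : tot (-A) = -tot A :=
  eq_of_isHom (tot_isHom _) (fun xs h => by simp [tot_isHom A xs h]) fun v => by
    simp [tot_ofFn]

theorem tot_sub {k : ℕ} (A B : AltOp W k) : tot (A - B) = tot A - tot B := by
  rw [sub_eq_add_neg, tot_add, tot_neg, sub_eq_add_neg]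

theorem tot_zero {k : ℕ} : tot (0 : AltOp W k) = 0 :=
  eq_of_isHom (tot_isHom _) (fun _ _ => rfl) fun v => by simp [tot_ofFn]

theorem tot_smul_real {k : ℕ} (r : ℝ) (A : AltOp W k) : tot (r • A) = r • tot A :=
  eq_of_isHom (tot_isHom _) (fun xs h => by simp [tot_isHom A xs h]) fun v => by
    simp [tot_ofFn]

theorem tot_smul {k : ℕ} (r : W) (A : AltOp W k) : tot (r • A) = r • tot A :=
  eq_of_isHom (tot_isHom _) (fun xs h => by simp [tot_isHom A xs h]) fun v => by
    simp [tot_ofFn]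

theorem cur_tot {k : ℕ} (A : AltOp W (k + 1)) (x : W) : cur x (tot A) = tot (A.curryLeft x) :=
  eq_of_isHom ((tot_isHom A).cur x) (tot_isHom _) fun v => by
    rw [tot_ofFn, cur_apply]
    have : x :: List.ofFn v = List.ofFn (Matrix.vecCons x v) := by
      rw [List.ofFn_succ]
      simp
    rw [this, tot_ofFn, AlternatingMap.curryLeft_apply_apply]

theorem tot_isAlt {k : ℕ} (A : AltOp W k) : IsAlt (tot A) := by
  induction k with
  | zero =>
    have h : ∀ us (x : W) vs, tot A (us ++ x :: vs) = 0 := fun us x vs =>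
      tot_isHom A _ (by simp)
    exact ⟨fun _ _ _ _ => by simp [h], fun _ _ _ _ => by simp [h], fun _ _ _ _ => by simp [h]⟩
  | succ k ih =>
    refine isAlt_of_cur (fun x y => ?_) (fun r x => ?_) (fun x y => ?_) (fun x => ?_)
    · rw [cur_tot, cur_tot, cur_tot, map_add, tot_add]
    · rw [cur_tot, cur_tot, map_smul, tot_smul_real]
    · rcases k with _ | k
      · rw [cur_tot, cur_tot, (tot_isHom _).cur_zero, (tot_isHom _).cur_zero, neg_zero]
      · rw [cur_tot, cur_tot, cur_tot, cur_tot, ← tot_neg]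
        congr 1
        -- Skew-symmetry of the first two arguments by polarizing the vanishing on equal arguments.
        have h := A.curryLeft_same (x + y)
        simp only [map_add, AlternatingMap.curryLeft_add, LinearMap.add_apply,
          AlternatingMap.curryLeft_same, zero_add, add_zero] at h
        rw [add_comm] at h
        exact eq_neg_of_add_eq_zero_left h
    · rw [cur_tot]
      exact ih _

theorem tot_constOp (w : W) : tot (constOp w) = w • (1 : ListFun W W) := by
  refine ListFun.ext fun xs => ?_
  rcases xs with _ | ⟨x, xs⟩
  · simp [tot, constOp, one_nil]
  · rw [tot_isHom _ _ (by simp), ListFun.smul_apply]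
    change 0 = w • (0 : W)
    simp

theorem tot_idOp_apply (x : W) : tot idOp [x] = x := by
  simp [tot, idOp]

theorem cur_tot_idOp (x : W) : cur x (tot idOp) = x • (1 : ListFun W W) := by
  refine ListFun.ext fun xs => ?_
  rcases xs with _ | ⟨y, xs⟩
  · rw [cur_apply, tot_idOp_apply]
    simp [one_nil]
  · rw [cur_apply, tot_isHom _ _ (by simp), ListFun.smul_apply]
    change 0 = x • (0 : W)
    simp

/-- With `exists_append`, the dictionary between conditions "in the i-th variable" stated by
`Function.update` and those stated by splitting a list. -/
theorem exists_update {k : ℕ} (us vs : List W) (h : us.length + 1 + vs.length = k) :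
    ∃ (v : Fin k → W) (i : Fin k), ∀ y, us ++ y :: vs = List.ofFn (Function.update v i y) := by
  obtain ⟨v, hv⟩ := exists_ofFn (k := k) (us ++ 0 :: vs)
    (by simp only [List.length_append, List.length_cons]; omega)
  refine ⟨v, ⟨us.length, by omega⟩, fun y => ?_⟩
  apply List.ext_getElem
  · simp only [List.length_append, List.length_cons, List.length_ofFn]; omega
  · intro i h1 h2
    have hi : i < k := by simpa using h2
    have hvi : (us ++ 0 :: vs)[i]'(by
        simp only [List.length_append, List.length_cons]; omega) = v ⟨i, hi⟩ := by
      simp [hv]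
    rw [List.getElem_ofFn, Function.update_apply]
    split_ifs with h'
    · obtain rfl : i = us.length := congrArg Fin.val h'
      simp
    · have h'' : i ≠ us.length := fun h => h' (Fin.ext h)
      rw [← hvi]
      by_cases hlt : i < us.length
      · rw [List.getElem_append_left hlt, List.getElem_append_left hlt]
      · rw [List.getElem_append_right (by omega), List.getElem_append_right (by omega)]
        obtain ⟨j, hj⟩ : ∃ j, i - us.length = j + 1 := ⟨i - us.length - 1, by omega⟩
        simp [hj]

theorem exists_append {k : ℕ} (v : Fin k → W) (i : Fin k) :
    ∃ us vs : List W, ∀ y, List.ofFn (Function.update v i y) = us ++ y :: vs := by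
  refine ⟨(List.ofFn v).take i, (List.ofFn v).drop (i + 1), fun y => ?_⟩
  have hi : (i : ℕ) < (List.ofFn v).length := by simp
  have hs : (List.ofFn v).set i y = _ := List.set_eq_take_append_cons_drop
  rw [if_pos hi] at hs
  rw [← hs]
  apply List.ext_getElem
  · simp
  · intro j h1 h2
    rw [List.getElem_ofFn, List.getElem_set, Function.update_apply]
    by_cases h : (i : ℕ) = j
    · have : (⟨j, by simpa using h1⟩ : Fin k) = i := Fin.ext h.symm
      simp [h, this]
    · have : (⟨j, by simpa using h1⟩ : Fin k) ≠ i := fun h' => h (by rw [← h'])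
      simp [h, this]

theorem isMultiDerivation_iff {k : ℕ} (A : AltOp W k) : IsMultiDerivation A ↔ IsDer (tot A) := by
  constructor
  · intro h us f g vs
    by_cases hk : us.length + 1 + vs.length = k
    · obtain ⟨v, i, hv⟩ := exists_update us vs hk
      rw [hv, hv, hv, tot_ofFn, tot_ofFn, tot_ofFn, h]
    · have : ∀ x : W, tot A (us ++ x :: vs) = 0 := fun x => tot_isHom A _ (by
        simp only [List.length_append, List.length_cons]; omega)
      simp [this]
  · intro h i v f g
    obtain ⟨us, vs, hv⟩ := exists_append v i
    rw [← tot_ofFn, ← tot_ofFn, ← tot_ofFn, hv, hv, hv, h]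

theorem isFirstOrderMultiDiff_of_isFirst {k : ℕ} {A : AltOp W k} (h : IsFirst (tot A)) :
    IsFirstOrderMultiDiff A := by
  intro i v f g
  obtain ⟨us, vs, hv⟩ := exists_append v i
  have hD : ∀ y, (A.toMultilinearMap.toLinearMap v i) y = tot A (us ++ y :: vs) := fun y => by
    rw [← hv, tot_ofFn]
    rfl
  refine LinearMap.ext fun x => ?_
  simp only [Ring.lie_def, LinearMap.sub_apply, Module.End.mul_apply, LinearMap.mulLeft_apply,
    hD, LinearMap.zero_apply]
  rw [h us f (g * x), h us f x, h us g x]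
  ring

/-- By skew-symmetry one argument is as good as another: the product is moved to the front by
transpositions, whose signs are the same in all terms. -/
theorem isDer_of_cur {A : ListFun W W} (hA : IsAlt A)
    (h : ∀ f g, cur (f * g) A = f • cur g A + g • cur f A) : IsDer A := by
  intro us
  induction us using List.reverseRecOn with
  | nil => exact fun f g vs => congrFun (h f g) vs
  | append_singleton us x ih =>
    intro f g vs
    simp only [List.append_assoc, List.singleton_append]
    rw [hA.swap us x, hA.swap us x, hA.swap us x, ih]
    ring

theorem isFirst_of_cur {A : ListFun W W} (hA : IsAlt A)
    (h : ∀ f g, cur (f * g) A = f • cur g A + g • cur f A - (f * g) • cur 1 A) : IsFirst A := by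
  intro us
  induction us using List.reverseRecOn with
  | nil => exact fun f g vs => congrFun (h f g) vs
  | append_singleton us x ih =>
    intro f g vs
    simp only [List.append_assoc, List.singleton_append]
    rw [hA.swap us x, hA.swap us x, hA.swap us x, hA.swap us x, ih]
    ring

theorem shuf_eq_zero {S K : Type*} [CommRing K] (xs : List S) : ∀ T : List S → List S → K,
    (∀ u w, u.length + w.length = xs.length → T u w = 0) → shuf T xs = 0 := by
  induction xs with
  | nil => intro T h; exact h [] [] rfl
  | cons x xs ih =>
    intro T h
    rw [shuf, ih, ih, add_zero]
    · intro u w hu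
      rw [h _ _ (by simp only [List.length_cons]; omega), mul_zero]
    · intro u w hu
      exact h _ _ (by simp only [List.length_cons]; omega)

/-- The bridge between alternatization over all permutations and the recursive shuffle sum. Since
`T` is skew in each block, permutations inside the blocks contribute equally, whence the factorials.
-/
theorem alternatization_eq_shuf {k a m : ℕ} (h : k + a = m)
    (f : MultilinearMap ℝ (fun _ : Fin k ⊕ Fin a => W) W) (T : List W → List W → W)
    (hT : ∀ u w, T (List.ofFn u) (List.ofFn w) = f (Sum.elim u w))
    (h0 : ∀ u w, u.length ≠ k ∨ w.length ≠ a → T u w = 0)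
    (h1 : ∀ us x y vs w, T (us ++ x :: y :: vs) w = - T (us ++ y :: x :: vs) w)
    (h2 : ∀ u us x y vs, T u (us ++ x :: y :: vs) = - T u (us ++ y :: x :: vs))
    (v : Fin m → W) :
    MultilinearMap.alternatization (f.domDomCongr (finSumFinEquiv.trans (finCongr h))) v =
      ((k.factorial * a.factorial : ℕ) : W) * shuf T (List.ofFn v) := by
  rw [← permSum_eq_shuf m k a T v h h0 h1 h2, MultilinearMap.alternatization_apply, permSum]
  refine Finset.sum_congr rfl fun σ _ => ?_
  congr 1
  subst h
  have e : ∀ v : Fin (k + a) → W, List.ofFn v =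
      List.ofFn (fun i => v (Fin.castAdd a i)) ++ List.ofFn (fun i => v (Fin.natAdd k i)) := by
    intro v
    rw [← List.ofFn_fin_append]
    congr 1
    funext i
    refine Fin.addCases (fun i => ?_) (fun i => ?_) i <;> simp
  rw [e (v ∘ σ), List.take_left' (by simp), List.drop_left' (by simp), hT,
    MultilinearMap.domDomCongr_apply, MultilinearMap.domDomCongr_apply]
  congr 1
  funext i
  rcases i with i | i <;> simp

/-- `AlternatingMap.domCoprod` sums over permutations modulo block permutations. Both sides become
the same full alternatization after multiplication by k! l!, which is invertible over the reals. -/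
theorem tot_wedge {k l m : ℕ} (h : k + l = m) (A : AltOp W k) (B : AltOp W l) :
    tot (wedge m A B) = tot A * tot B := by
  refine eq_of_isHom (k := m) (tot_isHom _) (h ▸ (tot_isHom A).mul (tot_isHom B)) fun v => ?_
  have hA := tot_isAlt A
  have hB := tot_isAlt B
  have key := alternatization_eq_shuf h
    ((LinearMap.mul' ℝ W).compMultilinearMap
      (MultilinearMap.domCoprod A.toMultilinearMap B.toMultilinearMap))
    (fun u w => tot A u * tot B w) (fun u w => by simp [tot_ofFn])
    (fun u w h => by
      rcases h with h | h
      · rw [tot_isHom A u h, zero_mul]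
      · rw [tot_isHom B w h, mul_zero])
    (fun us x y vs w => by rw [hA.swap us x y]; ring)
    (fun u us x y vs => by rw [hB.swap us x y]; ring) v
  have hfac : ((k.factorial * l.factorial : ℕ) : ℝ) ≠ 0 := by positivity
  have hcast : ∀ w : W, ((k.factorial * l.factorial : ℕ) : W) * w =
      ((k.factorial * l.factorial : ℕ) : ℝ) • w := fun w => by
    rw [Algebra.smul_def, map_natCast]
  rw [tot_ofFn]
  rw [hcast] at key
  refine smul_right_injective W hfac ?_
  refine Eq.trans ?_ key
  rw [wedge, dif_pos h]
  have h3 := MultilinearMap.domCoprod_alternization_eq A B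
  rw [Fintype.card_fin, Fintype.card_fin] at h3
  subst h
  have h4 := congrArg (LinearMap.mul' ℝ W) (congrArg (fun f => f (v ∘ finSumFinEquiv)) h3)
  rw [AlternatingMap.smul_apply, map_nsmul, ← Nat.cast_smul_eq_nsmul ℝ] at h4
  refine h4.symm.trans ?_
  rw [MultilinearMap.alternatization_apply, MultilinearMap.alternatization_apply, map_sum]
  refine Fintype.sum_equiv (Equiv.permCongr finSumFinEquiv) _ _ fun σ => ?_
  rw [Equiv.Perm.sign_permCongr, LinearMap.map_smul_of_tower]
  congr 1
  simp [MultilinearMap.domDomCongr_apply, Function.comp_def]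

theorem tot_insertion {k l m : ℕ} (h : k + l = m + 1) (B : AltOp W l) (A : AltOp W k) :
    tot (insertion m B A) = ins (tot B) (tot A) := by
  have hA := tot_isAlt A
  have hB := tot_isAlt B
  rcases k with _ | a
  · rw [insertion, tot_zero]
    refine ListFun.ext fun xs => ?_
    rw [ins]
    have : (fun (u w : List W) => tot A (tot B u :: w)) = fun _ _ => 0 := by
      funext u w
      exact tot_isHom A _ (by simp)
    rw [this, shuf_zero]
    rfl
  have h' : l + a = m := by omega
  have hins : IsHom m (ins (tot B) (tot A)) := by
    intro xs hx
    refine shuf_eq_zero xs _ fun u w huw => ?_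
    by_cases hu : u.length = l
    · exact tot_isHom A _ (by simp only [List.length_cons]; omega)
    · rw [tot_isHom B u hu]
      have := hA.smul [] 0 0 w
      simpa using this
  refine eq_of_isHom (k := m) (tot_isHom _) hins fun v => ?_
  have key := alternatization_eq_shuf h' (insertFirst B A)
    (fun u w => tot A (tot B u :: w)) (fun u w => by
      have h1 := congrFun (cur_tot A (tot B (List.ofFn u))) (List.ofFn w)
      rw [tot_ofFn, cur_apply, tot_ofFn] at h1
      rw [tot_ofFn, h1]
      rfl)
    (fun u w h => by
      rcases h with h | h
      · rw [tot_isHom B u h]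
        have := hA.smul [] 0 0 w
        simpa using this
      · exact tot_isHom A _ (by simpa using h))
    (fun us x y vs w => by
      rw [hB.swap us x y]
      have := hA.smul [] (-1) (tot B (us ++ y :: x :: vs)) w
      simpa using this)
    (fun u us x y vs => hA.swap (tot B u :: us) x y vs) v
  rw [tot_ofFn, insertion, dif_pos h', AlternatingMap.smul_apply, key]
  have hfac : ((l.factorial * a.factorial : ℕ) : ℝ) ≠ 0 := by positivity
  have hcast : ∀ w : W, ((l.factorial * a.factorial : ℕ) : W) * w =
      ((l.factorial * a.factorial : ℕ) : ℝ) • w := fun w => by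
    rw [Algebra.smul_def, map_natCast]
  rw [hcast, inv_smul_smul₀ hfac]
  rfl

theorem ins_tot_zero (B : ListFun W W) (A : AltOp W 0) : ins B (tot A) = 0 := by
  refine ListFun.ext fun xs => ?_
  rw [ins]
  have : (fun (u w : List W) => tot A (B u :: w)) = fun _ _ => 0 := by
    funext u w
    exact tot_isHom A _ (by simp)
  rw [this, shuf_zero]
  rfl

theorem tot_nrBracket {k l : ℕ} (A : AltOp W k) (B : AltOp W l) :
    tot (nrBracket A B) = nr k l (tot A) (tot B) := by
  rw [nrBracket, tot_add, tot_neg, tot_smul_real, nr]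
  -- For `k = l = 0` truncated subtraction violates the arity relation of `tot_insertion`, but
  -- insertions into operators without arguments vanish anyway.
  by_cases h : k + l = 0
  · obtain ⟨rfl, rfl⟩ : k = 0 ∧ l = 0 := by omega
    rw [ins_tot_zero, ins_tot_zero]
    simp [insertion, tot_zero]
  · rw [tot_insertion (by omega), tot_insertion (by omega)]

end Tot

/-! ### Hadamard's lemma and point derivations -/

section Hadamard

variable {V : Type*} [NormedAddCommGroup V] [NormedSpace ℝ V]

open MeasureTheory in
-- The integral is a convolution at 0, with parameter `z`, of the indicator of (0, 1] with a smooth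
-- family. The cutoff `ρ`, equal to 1 where it matters, provides the compact support that the
-- differentiability theorem for convolutions requires.
theorem contDiff_integral_segment {h : V → ℝ} (hh : ContDiff ℝ ∞ h) (c : V) :
    ContDiff ℝ ∞ (fun z => ∫ t in (0 : ℝ)..1, h (c + t • (z - c))) := by
  let ρ : ContDiffBump (0 : ℝ) := ⟨2, 3, by norm_num, by norm_num⟩
  let g : V → ℝ → ℝ := fun p x => ρ x * h (c + (-x) • (p - c))
  let f : ℝ → ℝ := Set.indicator (Set.Ioc 0 1) 1
  have hf : LocallyIntegrable f volume :=
    ((integrable_indicator_iff measurableSet_Ioc).2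
      (by simp [IntegrableOn, Pi.one_def] : IntegrableOn (1 : ℝ → ℝ) (Set.Ioc 0 1) volume)).locallyIntegrable
  have hg : ContDiffOn ℝ ((⊤ : ℕ∞) : WithTop ℕ∞) (Function.uncurry g)
      (Set.univ ×ˢ Set.univ) := by
    refine ContDiff.contDiffOn ?_
    refine (ρ.contDiff.comp contDiff_snd).mul (hh.comp ?_)
    fun_prop
  have key := contDiffOn_convolution_right_with_param_comp (μ := volume) (n := (⊤ : ℕ∞))
    (ContinuousLinearMap.mul ℝ ℝ) (v := fun _ : V => (0 : ℝ)) contDiffOn_const (f := f) (g := g)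
    (s := Set.univ) (k := Metric.closedBall 0 3) isOpen_univ (isCompact_closedBall _ _)
    (fun p x _ hx => by
      have : ρ x = 0 := ρ.zero_of_le_dist (by
        rw [Metric.mem_closedBall, not_le] at hx
        exact hx.le)
      simp [g, this]) hf hg
  rw [contDiffOn_univ] at key
  convert key using 1
  funext z
  rw [intervalIntegral.integral_of_le zero_le_one, MeasureTheory.convolution_def,
    ← integral_indicator measurableSet_Ioc]
  refine integral_congr_ae (Filter.Eventually.of_forall fun t => ?_)
  by_cases ht : t ∈ Set.Ioc (0 : ℝ) 1
  · have hρ : ρ (-t) = 1 := ρ.one_of_mem_closedBall (by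
      rw [Metric.mem_closedBall, dist_zero_right, norm_neg, Real.norm_eq_abs, abs_of_pos ht.1]
      change t ≤ 2
      linarith [ht.2])
    simp [f, g, ht, hρ]
  · simp [f, ht]

theorem hadamard {H : V → ℝ} (hH : ContDiff ℝ ∞ H) (c z : V) :
    H z = H c + ∫ t in (0 : ℝ)..1, fderiv ℝ H (c + t • (z - c)) (z - c) := by
  have hd : ∀ t ∈ Set.uIcc (0 : ℝ) 1, HasDerivAt (fun t : ℝ => H (c + t • (z - c)))
      (fderiv ℝ H (c + t • (z - c)) (z - c)) t := by
    intro t _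
    have h1 : HasDerivAt (fun t : ℝ => c + t • (z - c)) (z - c) t := by
      simpa using ((hasDerivAt_id t).smul_const (z - c)).const_add c
    exact ((hH.differentiable (by simp)).differentiableAt.hasFDerivAt).comp_hasDerivAt t h1
  have hc : Continuous (fun t : ℝ => fderiv ℝ H (c + t • (z - c)) (z - c)) := by
    have := hH.continuous_fderiv (by simp)
    fun_prop
  rw [intervalIntegral.integral_eq_sub_of_hasDerivAt hd (hc.intervalIntegrable _ _)]
  simp

end Hadamard

/-! ### Derivations at a point of a manifold and their coordinate expansion. -/

section PointDerivation

variable {V : Type*} [NormedAddCommGroup V] [NormedSpace ℝ V] [FiniteDimensional ℝ V]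
  {H : Type*} [TopologicalSpace H] {I : ModelWithCorners ℝ V H}
  {N : Type*} [TopologicalSpace N] [ChartedSpace H N] [IsManifold I ∞ N] [T2Space N]

/-- Derivations of the algebra of smooth functions at the point `x`. -/
structure IsPointDer (I : ModelWithCorners ℝ V H) (x : N) (δ : C^∞⟮I, N; 𝓘(ℝ), ℝ⟯ → ℝ) : Prop where
  add : ∀ f g, δ (f + g) = δ f + δ g
  mul : ∀ f g, δ (f * g) = f x * δ g + g x * δ f
  smul : ∀ (r : ℝ) f, δ (r • f) = r * δ f

theorem exists_bump {x : N} {U : Set N} (hU : U ∈ 𝓝 x) :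
    ∃ χ : C^∞⟮I, N; 𝓘(ℝ), ℝ⟯, (∀ᶠ y in 𝓝 x, χ y = 1) ∧ tsupport χ ⊆ U := by
  obtain ⟨ψ, -, hψ⟩ := (SmoothBumpFunction.nhds_basis_tsupport (I := I) x).mem_iff.1 hU
  exact ⟨⟨ψ, ψ.contMDiff⟩, ψ.eventuallyEq_one, hψ⟩

theorem exists_smooth_extension {x : N} {U : Set N} (hU : U ∈ 𝓝 x) {g : N → ℝ}
    (hg : ContMDiffOn I 𝓘(ℝ) ∞ g U) : ∃ G : C^∞⟮I, N; 𝓘(ℝ), ℝ⟯, ∀ᶠ y in 𝓝 x, G y = g y := by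
  obtain ⟨χ, h1, h2⟩ := exists_bump (I := I) (interior_mem_nhds.2 hU)
  refine ⟨⟨fun y => χ y * g y, contMDiff_of_tsupport fun y hy => ?_⟩, ?_⟩
  · have hy' : y ∈ interior U := h2 (closure_mono (Function.support_mul_subset_left _ _) hy)
    exact (χ.contMDiff y).mul (hg.contMDiffAt (mem_interior_iff_mem_nhds.1 hy'))
  · filter_upwards [h1] with y hy
    change χ y * g y = g y
    rw [hy, one_mul]

namespace IsPointDer

variable {x : N} {δ : C^∞⟮I, N; 𝓘(ℝ), ℝ⟯ → ℝ}

theorem zero (h : IsPointDer I x δ) : δ 0 = 0 := by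
  simpa using h.smul 0 0

theorem sub (h : IsPointDer I x δ) (f g : C^∞⟮I, N; 𝓘(ℝ), ℝ⟯) : δ (f - g) = δ f - δ g := by
  have := h.add f ((-1 : ℝ) • g)
  rw [h.smul] at this
  have h2 : f - g = f + (-1 : ℝ) • g := by rw [neg_smul, one_smul, sub_eq_add_neg]
  rw [h2, this]
  ring

theorem one (h : IsPointDer I x δ) : δ 1 = 0 := by
  have := h.mul 1 1
  rw [mul_one, ContMDiffMap.coe_one, Pi.one_apply] at this
  linarith

theorem const (h : IsPointDer I x δ) (r : ℝ) : δ (r • 1) = 0 := by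
  rw [h.smul, h.one, mul_zero]

theorem sum (h : IsPointDer I x δ) {ι : Type*} (s : Finset ι) (f : ι → C^∞⟮I, N; 𝓘(ℝ), ℝ⟯) :
    δ (∑ i ∈ s, f i) = ∑ i ∈ s, δ (f i) := by
  classical
  induction s using Finset.induction_on with
  | empty => simpa using h.zero
  | insert i s hi ih => rw [Finset.sum_insert hi, Finset.sum_insert hi, h.add, ih]

/-- Locality: a bump function `χ` supported where `f = g` satisfies `χ * (f - g) = 0`, and the
product rule turns this into `δ (f - g) = 0`. -/
theorem congr (h : IsPointDer I x δ) {f g : C^∞⟮I, N; 𝓘(ℝ), ℝ⟯} (hfg : ∀ᶠ y in 𝓝 x, f y = g y) :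
    δ f = δ g := by
  obtain ⟨χ, h1, h2⟩ := exists_bump (I := I) hfg
  have h0 : χ * (f - g) = 0 := by
    ext y
    by_cases hy : f y = g y
    · simp [hy]
    · have : y ∉ tsupport χ := fun h => hy (h2 h)
      simp [image_eq_zero_of_notMem_tsupport this]
  have h3 := h.mul χ (f - g)
  rw [h0, h.zero, h1.self_of_nhds, h.sub] at h3
  have h4 : (f - g) x = 0 := by
    change f x - g x = 0
    rw [hfg.self_of_nhds, sub_self]
  rw [h4] at h3
  linarith

end IsPointDer

theorem smoothFn_sum_apply {ι : Type*} (s : Finset ι) (f : ι → C^∞⟮I, N; 𝓘(ℝ), ℝ⟯) (x : N) :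
    (∑ i ∈ s, f i) x = ∑ i ∈ s, f i x := by
  have := congrFun (map_sum (ContMDiffMap.coeFnAddMonoidHom (I := I) (N := N) (I' := 𝓘(ℝ)) (G := ℝ)
    (n := ∞)) f s) x
  simpa using this

/-- Near a point, derivations are determined by the values on coordinate functions. -/
theorem exists_coord_expansion [I.Boundaryless] (x₀ : N) {ι : Type*} [Fintype ι] (b : Basis ι ℝ V)
    (y : ι → C^∞⟮I, N; 𝓘(ℝ), ℝ⟯)
    (hy : ∀ i, ∀ᶠ z in 𝓝 x₀, y i z = b.repr (extChartAt I x₀ z) i)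
    (G : C^∞⟮I, N; 𝓘(ℝ), ℝ⟯) :
    ∃ g : ι → C^∞⟮I, N; 𝓘(ℝ), ℝ⟯, ∀ᶠ x in 𝓝 x₀, ∀ δ, IsPointDer I x δ →
      δ G = ∑ i, δ (y i) * g i x := by
  set φ := extChartAt I x₀ with hφ
  have hφs : ContMDiffOn I 𝓘(ℝ, V) ∞ φ φ.source := by
    rw [hφ, extChartAt_source]
    exact contMDiffOn_extChartAt
  have hsrc : φ.source ∈ 𝓝 x₀ := extChartAt_source_mem_nhds x₀
  have htgt : φ.target ∈ 𝓝 (φ x₀) := extChartAt_target_mem_nhds x₀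
  -- The local expression of `G` is replaced by a function smooth on all of `V`, so that Hadamard's
  -- lemma applies along every segment and the chart image need not be convex.
  obtain ⟨F₀, hF₀⟩ := exists_smooth_extension (I := 𝓘(ℝ, V)) htgt
    (g := fun z => G (φ.symm z)) (G.contMDiff.comp_contMDiffOn (contMDiffOn_extChartAt_symm x₀))
  have hF : ContDiff ℝ ∞ F₀ := F₀.contMDiff.contDiff
  have hG : ∀ᶠ z in 𝓝 x₀, G z = F₀ (φ z) := by
    filter_upwards [(continuousAt_extChartAt x₀).eventually hF₀, hsrc] with z hz hz'
    rw [hz, φ.left_inv hz']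
  have hD : ∀ i, ContDiff ℝ ∞ (fun z => fderiv ℝ F₀ z (b i)) := fun i =>
    (hF.fderiv_right (by simp)).clm_apply contDiff_const
  have hgi : ∀ i, ∃ g : C^∞⟮I, N; 𝓘(ℝ), ℝ⟯, ∀ᶠ z in 𝓝 x₀, g z = fderiv ℝ F₀ (φ z) (b i) :=
    fun i => exists_smooth_extension hsrc ((hD i).contMDiff.comp_contMDiffOn hφs)
  choose g hg using hgi
  refine ⟨g, ?_⟩
  have hall := ((Filter.eventually_all.2 hy).and (Filter.eventually_all.2 hg)).and
    (hG.and hsrc)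
  filter_upwards [hall.eventually_nhds] with x hx δ hδ
  have hx0 := hx.self_of_nhds
  have hsrcx : φ.source ∈ 𝓝 x := hx.mono fun z hz => hz.2.2
  have hκ : ∀ i, ∃ κ : C^∞⟮I, N; 𝓘(ℝ), ℝ⟯, ∀ᶠ z in 𝓝 x,
      κ z = ∫ t in (0 : ℝ)..1, fderiv ℝ F₀ (φ x + t • (φ z - φ x)) (b i) := fun i =>
    exists_smooth_extension hsrcx
      ((contDiff_integral_segment (hD i) (φ x)).contMDiff.comp_contMDiffOn hφs)
  choose κ hκ using hκ
  -- Hadamard expansion centred at the varying point `x`. The coefficients `κ i` depend on `x`, but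
  -- `δ` only sees their value at `x`, the partial derivative represented by the fixed smooth
  -- function `g i`.
  have hexp : ∀ᶠ z in 𝓝 x, G z = (G x • (1 : C^∞⟮I, N; 𝓘(ℝ), ℝ⟯) +
      ∑ i, (y i - y i x • (1 : C^∞⟮I, N; 𝓘(ℝ), ℝ⟯)) * κ i) z := by
    filter_upwards [hx, Filter.eventually_all.2 hκ] with z hz hzκ
    rw [ContMDiffMap.coe_add, Pi.add_apply, smoothFn_sum_apply]
    have h1 : ∀ i, ((y i - y i x • (1 : C^∞⟮I, N; 𝓘(ℝ), ℝ⟯)) * κ i) z =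
        b.repr (φ z - φ x) i * ∫ t in (0 : ℝ)..1, fderiv ℝ F₀ (φ x + t • (φ z - φ x)) (b i) := by
      intro i
      change (y i z - y i x * 1) * κ i z = _
      rw [hzκ, hz.1.1, hx0.1.1, map_sub, Finsupp.sub_apply, mul_one]
    have h2 : (G x • (1 : C^∞⟮I, N; 𝓘(ℝ), ℝ⟯)) z = F₀ (φ x) := by
      change G x * 1 = _
      rw [mul_one, hx0.2.1]
    rw [h2, Finset.sum_congr rfl fun i _ => h1 i, hz.2.1, hadamard hF (φ x) (φ z)]
    congr 1
    have hc : ∀ i, Continuous (fun t : ℝ => fderiv ℝ F₀ (φ x + t • (φ z - φ x)) (b i)) := by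
      intro i
      have := (hD i).continuous
      fun_prop
    simp_rw [← intervalIntegral.integral_const_mul]
    rw [← intervalIntegral.integral_finsetSum fun i _ =>
      ((hc i).const_mul _).intervalIntegrable _ _]
    refine intervalIntegral.integral_congr fun t _ => ?_
    conv_lhs => rw [← b.sum_repr (φ z - φ x)]
    rw [map_sum]
    refine Finset.sum_congr rfl fun i _ => ?_
    rw [map_smul, smul_eq_mul, b.sum_repr]
  rw [hδ.congr hexp, hδ.add, hδ.const, zero_add, hδ.sum]
  refine Finset.sum_congr rfl fun i _ => ?_
  have h3 : (y i - y i x • (1 : C^∞⟮I, N; 𝓘(ℝ), ℝ⟯)) x = 0 := by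
    change y i x - y i x * 1 = 0
    ring
  have h4 : κ i x = g i x := by
    rw [(hκ i).self_of_nhds, hx0.1.2]
    simp
  rw [hδ.mul, h3, hδ.sub, hδ.const, h4]
  ring

end PointDerivation

/-! ### Point derivations of the functions on the total space -/

section TotalSpaceDerivations

variable {n : ℕ} {M : Type*} [TopologicalSpace M] [ChartedSpace (EuclideanSpace ℝ (Fin n)) M]
  {F : Type*} [NormedAddCommGroup F] [NormedSpace ℝ F]
  {E : M → Type*} [TopologicalSpace (TotalSpace F E)] [∀ x, AddCommGroup (E x)]
  [∀ x, Module ℝ (E x)] [∀ x, TopologicalSpace (E x)] [FiberBundle F E] [VectorBundle ℝ F E]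
  [IsManifold (𝓡 n) ∞ M] [T2Space M] [FiniteDimensional ℝ F] [ContMDiffVectorBundle ∞ F E (𝓡 n)]

/-- Bump functions on the total space require it to be Hausdorff: points of different fibres are
separated in the base, points of one fibre in a trivialization. -/
theorem t2Space_totalSpace (F : Type*) [NormedAddCommGroup F] [NormedSpace ℝ F]
    (E : M → Type*) [TopologicalSpace (TotalSpace F E)]
    [∀ x, TopologicalSpace (E x)] [FiberBundle F E] : T2Space (TotalSpace F E) := by
  refine ⟨fun x y hxy => ?_⟩
  have hc : Continuous (TotalSpace.proj : TotalSpace F E → M) := FiberBundle.continuous_proj F E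
  by_cases hp : x.proj = y.proj
  · set e := trivializationAt F E x.proj
    have hx : x ∈ e.source := e.mem_source.2 (FiberBundle.mem_baseSet_trivializationAt F E x.proj)
    have hy : y ∈ e.source := e.mem_source.2 (by
      rw [← hp]; exact FiberBundle.mem_baseSet_trivializationAt F E x.proj)
    have hne : e x ≠ e y := fun h => hxy (e.injOn hx hy h)
    obtain ⟨u, v, hu, hv, hxu, hyv, huv⟩ := t2_separation hne
    refine ⟨e.source ∩ e ⁻¹' u, e.source ∩ e ⁻¹' v,
      e.continuousOn.isOpen_inter_preimage e.open_source hu,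
      e.continuousOn.isOpen_inter_preimage e.open_source hv, ⟨hx, hxu⟩, ⟨hy, hyv⟩, ?_⟩
    exact (huv.preimage e).mono Set.inter_subset_right Set.inter_subset_right
  · obtain ⟨u, v, hu, hv, hxu, hyv, huv⟩ := t2_separation hp
    exact ⟨_, _, hu.preimage hc, hv.preimage hc, hxu, hyv, huv.preimage _⟩

/-- Near every point there are a global frame and dual global one-forms which give the coordinates
of the preferred trivialization. -/
theorem exists_coframe (p₀ : M) (b : Basis (Fin (finrank ℝ F)) ℝ F) :
    ∃ (s : Fin (finrank ℝ F) → Sec n F E) (ε : Fin (finrank ℝ F) → OneForm n F E),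
      (∀ᶠ p in 𝓝 p₀, ∀ (v : E p) i,
        iota (ε i) ⟨p, v⟩ = b.repr (trivializationAt F E p₀ ⟨p, v⟩).2 i) ∧
      (∀ᶠ p in 𝓝 p₀, ∀ v : E p, v = ∑ i, formAt (ε i) p v • s i p) := by
  set e := trivializationAt F E p₀ with he
  have hp₀ : p₀ ∈ e.baseSet := FiberBundle.mem_baseSet_trivializationAt F E p₀
  have hnhd : e.baseSet ∈ 𝓝 p₀ := e.open_baseSet.mem_nhds hp₀
  obtain ⟨ψ, hψ1, hψ⟩ := exists_bump (I := 𝓡 n) hnhd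
  have hrepr : ∀ i, ContDiff ℝ ∞ (fun w : F => b.repr w i) := fun i =>
    ((b.coord i).toContinuousLinearMap).contDiff
  have hε : ∀ i (t : Sec n F E),
      ContMDiff (𝓡 n) 𝓘(ℝ) ∞ (fun p => ψ p * b.repr (e ⟨p, t p⟩).2 i) := by
    intro i t
    apply contMDiff_of_tsupport
    intro p hp
    have hp' : p ∈ e.baseSet := hψ (closure_mono (Function.support_mul_subset_left _ _) hp)
    have h1 : ContMDiffAt ((𝓡 n).prod 𝓘(ℝ, F)) ((𝓡 n).prod 𝓘(ℝ, F)) ∞ e ⟨p, t p⟩ :=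
      (e.contMDiffOn (IB := 𝓡 n) (n := ∞)).contMDiffAt
        (e.open_source.mem_nhds (e.mem_source.2 hp'))
    have h2 : ContMDiffAt ((𝓡 n).prod 𝓘(ℝ, F)) 𝓘(ℝ) ∞
        (fun x : TotalSpace F E => b.repr (e x).2 i) ⟨p, t p⟩ :=
      ((hrepr i).contMDiff.contMDiffAt).comp _ (contMDiffAt_snd.comp _ h1)
    exact (ψ.contMDiff p).mul (h2.comp p (t.contMDiff p))
  have hlin : ∀ p ∈ e.baseSet, ∀ v : E p, (e ⟨p, v⟩).2 = e.linearMapAt ℝ p v := by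
    intro p hp v
    rw [e.coe_linearMapAt_of_mem hp]
  have h0 : ∀ p, p ∉ e.baseSet → ψ p = 0 := fun p hp => by
    by_contra h
    exact hp (hψ (subset_tsupport _ h))
  -- The i-th fibre coordinate cut off by `ψ`. Extension by zero outside the trivializing set makes
  -- it a global one-form, unchanged near `p₀`.
  let ε : Fin (finrank ℝ F) → OneForm n F E := fun i =>
    { toFun := fun t => ⟨_, hε i t⟩
      map_add' := fun t t' => by
        ext p
        change ψ p * b.repr (e ⟨p, t p + t' p⟩).2 i =
          ψ p * b.repr (e ⟨p, t p⟩).2 i + ψ p * b.repr (e ⟨p, t' p⟩).2 i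
        by_cases hp : p ∈ e.baseSet
        · rw [hlin p hp, hlin p hp, hlin p hp, map_add, map_add, Finsupp.add_apply, mul_add]
        · simp [h0 p hp]
      map_smul' := fun f t => by
        ext p
        change ψ p * b.repr (e ⟨p, f p • t p⟩).2 i = f p * (ψ p * b.repr (e ⟨p, t p⟩).2 i)
        by_cases hp : p ∈ e.baseSet
        · rw [hlin p hp, hlin p hp, map_smul, map_smul, Finsupp.smul_apply, smul_eq_mul]
          ring
        · simp [h0 p hp] }
  let s : Fin (finrank ℝ F) → Sec n F E := fun i =>
    ⟨_, ContMDiffOn.smul_section_of_tsupport (u := e.baseSet)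
      (ψ.contMDiff.contMDiffOn) e.open_baseSet hψ (e.contMDiffOn_localFrame_baseSet ∞ b i)⟩
  have hι : ∀ i p (v : E p), iota (ε i) ⟨p, v⟩ = ψ p * b.repr (e ⟨p, v⟩).2 i := by
    intro i p v
    obtain ⟨t, ht⟩ := exists_section (n := n) (⟨p, v⟩ : TotalSpace F E)
    have ht' : t p = v := ht
    rw [← ht', iota_apply]
    rfl
  refine ⟨s, ε, ?_, ?_⟩
  · filter_upwards [hψ1] with p hp v i
    rw [hι, hp, one_mul]
  · filter_upwards [hψ1, hnhd] with p hp hpe v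
    have hv : v = ∑ i, b.repr (e ⟨p, v⟩).2 i • e.localFrame b i p := by
      conv_lhs => rw [← (e.basisAt b hpe).sum_repr v]
      refine Finset.sum_congr rfl fun i _ => ?_
      simp [hpe, Trivialization.basisAt]
    conv_lhs => rw [hv]
    refine Finset.sum_congr rfl fun i _ => ?_
    change _ = iota (ε i) ⟨p, v⟩ • (ψ p • e.localFrame b i p)
    rw [hι, hp, one_mul, one_smul]

instance instT2TotalSpace : T2Space (TotalSpace F E) := t2Space_totalSpace F E

/-- A derivation of the functions on the total space at a point. -/
abbrev IsTotDer (x : TotalSpace F E) (δ : TotFn n F E → ℝ) : Prop :=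
  IsPointDer ((𝓡 n).prod 𝓘(ℝ, F)) x δ

/-- The chart of the total space at `x₀` is a base chart combined with a linear trivialization, so
its coordinates are locally pullbacks and fibrewise linear functions. The same `u` and `ε` serve all
`G`. -/
theorem exists_fibre_expansion (x₀ : TotalSpace F E) :
    ∃ (u : Fin n → Fn n M) (ε : Fin (finrank ℝ F) → OneForm n F E), ∀ G : TotFn n F E,
      ∃ (g : Fin n → TotFn n F E) (h : Fin (finrank ℝ F) → TotFn n F E),
        ∀ᶠ x in 𝓝 x₀, ∀ δ, IsTotDer x δ →
          δ G = ∑ i, δ (pullback n F E (u i)) * g i x + ∑ j, δ (iota (ε j)) * h j x := by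
  let b := finBasis ℝ F
  let b' := (EuclideanSpace.basisFun (Fin n) ℝ).toBasis
  have hu : ∀ i, ∃ u : Fn n M, ∀ᶠ p in 𝓝 x₀.proj,
      u p = b'.repr (extChartAt (𝓡 n) x₀.proj p) i := by
    intro i
    have hc : ContDiff ℝ ∞ (fun w : EuclideanSpace ℝ (Fin n) => b'.repr w i) :=
      ((b'.coord i).toContinuousLinearMap).contDiff
    refine exists_smooth_extension (extChartAt_source_mem_nhds (I := 𝓡 n) x₀.proj)
      (hc.contMDiff.comp_contMDiffOn ?_)
    rw [extChartAt_source]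
    exact contMDiffOn_extChartAt
  choose u hu using hu
  obtain ⟨s, ε, hε, -⟩ := exists_coframe (n := n) (E := E) x₀.proj b
  refine ⟨u, ε, fun G => ?_⟩
  have hproj : Filter.Tendsto (TotalSpace.proj : TotalSpace F E → M) (𝓝 x₀) (𝓝 x₀.proj) :=
    (FiberBundle.continuous_proj F E).continuousAt
  obtain ⟨g, hg⟩ := exists_coord_expansion (I := (𝓡 n).prod 𝓘(ℝ, F)) x₀ (b'.prod b)
    (Sum.elim (fun i => pullback n F E (u i)) (fun j => iota (ε j))) (fun i => by
      rcases i with i | j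
      · filter_upwards [hproj.eventually (hu i), hproj.eventually
          ((trivializationAt F E x₀.proj).open_baseSet.mem_nhds
            (FiberBundle.mem_baseSet_trivializationAt F E x₀.proj))] with z hz hzb
        rw [FiberBundle.extChartAt]
        simp only [Sum.elim_inl, Basis.prod_repr_inl]
        refine hz.trans ?_
        change _ = b'.repr (extChartAt (𝓡 n) x₀.proj (trivializationAt F E x₀.proj z).1) i
        rw [Trivialization.coe_fst' _ hzb]
      · filter_upwards [hproj.eventually hε] with z hz
        rw [FiberBundle.extChartAt]
        simp only [Sum.elim_inr, Basis.prod_repr_inr]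
        exact hz z.2 j) G
  refine ⟨fun i => g (Sum.inl i), fun j => g (Sum.inr j), ?_⟩
  filter_upwards [hg] with x hx δ hδ
  rw [hx δ hδ, Fintype.sum_sum_type]
  rfl

theorem IsPointDer.ext_tot {x : TotalSpace F E} {δ δ' : TotFn n F E → ℝ} (hδ : IsTotDer x δ)
    (hδ' : IsTotDer x δ') (h1 : ∀ f, δ (pullback n F E f) = δ' (pullback n F E f))
    (h2 : ∀ μ, δ (iota μ) = δ' (iota μ)) (G : TotFn n F E) : δ G = δ' G := by
  obtain ⟨u, ε, h⟩ := exists_fibre_expansion (n := n) x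
  obtain ⟨g, k, hG⟩ := h G
  rw [hG.self_of_nhds δ hδ, hG.self_of_nhds δ' hδ']
  simp only [h1, h2]

theorem totFn_sum_apply {ι : Type*} (s : Finset ι) (f : ι → TotFn n F E) (x : TotalSpace F E) :
    (∑ i ∈ s, f i) x = ∑ i ∈ s, f i x := smoothFn_sum_apply s f x

/-- A family of point derivations which is smooth on pullbacks and fibrewise linear functions comes
from a derivation. -/
theorem exists_derivation (δ : TotalSpace F E → TotFn n F E → ℝ) (hδ : ∀ x, IsTotDer x (δ x))
    (h1 : ∀ f : Fn n M, ∃ w : TotFn n F E, ∀ x, δ x (pullback n F E f) = w x)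
    (h2 : ∀ μ : OneForm n F E, ∃ w : TotFn n F E, ∀ x, δ x (iota μ) = w x) :
    ∃ D : Derivation ℝ (TotFn n F E) (TotFn n F E), ∀ G x, D G x = δ x G := by
  choose w1 hw1 using h1
  choose w2 hw2 using h2
  -- Near `x₀` the expansion expresses `δ x G` through the values on finitely many pullbacks and
  -- linear functions, smooth by assumption, with smooth coefficients.
  have hsm : ∀ G, ContMDiff ((𝓡 n).prod 𝓘(ℝ, F)) 𝓘(ℝ) ∞ (fun x => δ x G) := by
    intro G x₀
    obtain ⟨u, ε, h⟩ := exists_fibre_expansion (n := n) x₀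
    obtain ⟨g, k, hG⟩ := h G
    have hs := (∑ i, w1 (u i) * g i + ∑ j, w2 (ε j) * k j).contMDiff x₀
    refine hs.congr_of_eventuallyEq ?_
    filter_upwards [hG] with x hx
    rw [hx _ (hδ x), ContMDiffMap.coe_add, Pi.add_apply, totFn_sum_apply, totFn_sum_apply]
    simp only [hw1, hw2]
    rfl
  refine ⟨Derivation.mk' { toFun := fun G => ⟨fun x => δ x G, hsm G⟩,
                           map_add' := fun f g => ?_, map_smul' := fun r f => ?_ } fun f g => ?_,
    fun G x => rfl⟩
  · ext x
    exact (hδ x).add f g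
  · ext x
    exact (hδ x).smul r f
  · ext x
    exact (hδ x).mul f g

/-- A derivation followed by the evaluation at a point is a derivation at that point. -/
theorem isTotDer_derivation (D : Derivation ℝ (TotFn n F E) (TotFn n F E)) (x : TotalSpace F E) :
    IsTotDer x (fun G => D G x) := by
  refine ⟨fun f g => ?_, fun f g => ?_, fun r f => ?_⟩
  · rw [map_add]; rfl
  · rw [D.leibniz]; rfl
  · rw [D.map_smul]; rfl

theorem derivation_ext {D D' : Derivation ℝ (TotFn n F E) (TotFn n F E)}
    (h1 : ∀ f, D (pullback n F E f) = D' (pullback n F E f))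
    (h2 : ∀ μ, D (iota μ) = D' (iota μ)) : D = D' := by
  refine Derivation.ext fun G => ?_
  ext x
  exact (isTotDer_derivation D x).ext_tot (isTotDer_derivation D' x) (fun f => by rw [h1])
    (fun μ => by rw [h2]) G

/-! #### Algebra of pullbacks and fibrewise linear functions -/

theorem pullback_add (f g : Fn n M) :
    pullback n F E (f + g) = pullback n F E f + pullback n F E g := rfl
theorem pullback_mul (f g : Fn n M) :
    pullback n F E (f * g) = pullback n F E f * pullback n F E g := rfl
theorem pullback_sub (f g : Fn n M) :
    pullback n F E (f - g) = pullback n F E f - pullback n F E g := rfl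

theorem totFn_ext_sec {f g : TotFn n F E} (h : ∀ (σ : Sec n F E) p, f ⟨p, σ p⟩ = g ⟨p, σ p⟩) :
    f = g := by
  ext x
  obtain ⟨σ, hσ⟩ := exists_section (n := n) x
  have := h σ x.proj
  rwa [hσ] at this

theorem iota_add (μ ν : OneForm n F E) : iota (μ + ν) = iota μ + iota ν :=
  totFn_ext_sec fun σ p => by
    rw [iota_apply, ContMDiffMap.coe_add, Pi.add_apply, iota_apply, iota_apply]; rfl

theorem iota_smul (f : Fn n M) (μ : OneForm n F E) : iota (f • μ) = pullback n F E f * iota μ :=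
  totFn_ext_sec fun σ p => by
    rw [iota_apply, ContMDiffMap.coe_mul, Pi.mul_apply, iota_apply]; rfl

theorem iota_sub (μ ν : OneForm n F E) : iota (μ - ν) = iota μ - iota ν := by
  have := iota_add (μ - ν) ν
  rw [sub_add_cancel] at this
  rw [this, add_sub_cancel_right]

/-! #### Derivatives along the fibres -/

/-- The derivative of `G` at `x` in the direction of the fibre vector `w`. -/
def vder (x : TotalSpace F E) (w : E x.proj) (G : TotFn n F E) : ℝ :=
  deriv (fun t : ℝ => G ⟨x.proj, x.2 + t • w⟩) 0

theorem contMDiff_line (x : TotalSpace F E) (w : E x.proj) :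
    ContMDiff 𝓘(ℝ) ((𝓡 n).prod 𝓘(ℝ, F)) ∞
      (fun t : ℝ => (⟨x.proj, x.2 + t • w⟩ : TotalSpace F E)) := by
  intro t
  rw [contMDiffAt_totalSpace]
  refine ⟨contMDiffAt_const, ?_⟩
  set e := trivializationAt F E x.proj
  have hp : x.proj ∈ e.baseSet := FiberBundle.mem_baseSet_trivializationAt F E x.proj
  have h : (fun t : ℝ => (e ⟨x.proj, x.2 + t • w⟩).2) = fun t : ℝ =>
      e.linearMapAt ℝ x.proj x.2 + t • e.linearMapAt ℝ x.proj w := by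
    funext t
    rw [← map_smul, ← map_add, e.coe_linearMapAt_of_mem hp]
  change ContMDiffAt _ _ _ (fun t : ℝ => (e ⟨x.proj, x.2 + t • w⟩).2) t
  rw [h]
  exact ContDiff.contMDiff (by fun_prop) t

theorem differentiable_line (x : TotalSpace F E) (w : E x.proj) (G : TotFn n F E) :
    Differentiable ℝ (fun t : ℝ => G ⟨x.proj, x.2 + t • w⟩) :=
  (G.contMDiff.comp (contMDiff_line x w)).contDiff.differentiable (by simp)

theorem isTotDer_vder (x : TotalSpace F E) (w : E x.proj) :
    IsTotDer (n := n) x (vder x w) := by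
  have h0 : (⟨x.proj, x.2 + (0 : ℝ) • w⟩ : TotalSpace F E) = x := by simp
  refine ⟨fun f g => ?_, fun f g => ?_, fun r f => ?_⟩
  · exact deriv_fun_add (differentiable_line x w f 0) (differentiable_line x w g 0)
  · refine (deriv_fun_mul (differentiable_line x w f 0) (differentiable_line x w g 0)).trans ?_
    rw [h0]
    simp only [vder]
    ring
  · exact deriv_const_mul _ (differentiable_line x w f 0)

theorem vder_pullback (x : TotalSpace F E) (w : E x.proj) (f : Fn n M) :
    vder x w (pullback n F E f) = 0 := by
  change deriv (fun _ : ℝ => f x.proj) 0 = 0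
  simp

theorem vder_iota (x : TotalSpace F E) (w : E x.proj) (μ : OneForm n F E) :
    vder x w (iota μ) = formAt μ x.proj w := by
  have h : (fun t : ℝ => iota μ ⟨x.proj, x.2 + t • w⟩) =
      fun t : ℝ => formAt μ x.proj x.2 + t * formAt μ x.proj w := by
    funext t
    change formAt μ x.proj (x.2 + t • w) = _
    rw [map_add, map_smul, smul_eq_mul]
  rw [vder, h]
  simp

/-- No chain rule is needed: both sides are derivations at `x`, zero on pullbacks and equal on
fibrewise linear functions. -/
theorem vder_add (x : TotalSpace F E) (w w' : E x.proj) (G : TotFn n F E) :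
    vder x (w + w') G = vder x w G + vder x w' G := by
  have h1 := isTotDer_vder (n := n) x w
  have h2 := isTotDer_vder (n := n) x w'
  refine (isTotDer_vder x (w + w')).ext_tot (δ' := fun G => vder x w G + vder x w' G)
    ⟨fun f g => ?_, fun f g => ?_, fun r f => ?_⟩ (fun f => ?_) (fun μ => ?_) G
  · rw [h1.add, h2.add]; ring
  · rw [h1.mul, h2.mul]; ring
  · rw [h1.smul, h2.smul]; ring
  · simp [vder_pullback]
  · simp [vder_iota]

theorem vder_smul (x : TotalSpace F E) (r : ℝ) (w : E x.proj) (G : TotFn n F E) :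
    vder x (r • w) G = r * vder x w G := by
  have h1 := isTotDer_vder (n := n) x w
  refine (isTotDer_vder x (r • w)).ext_tot (δ' := fun G => r * vder x w G)
    ⟨fun f g => ?_, fun f g => ?_, fun r f => ?_⟩ (fun f => ?_) (fun μ => ?_) G
  · rw [h1.add]; ring
  · rw [h1.mul]; ring
  · rw [h1.smul]; ring
  · simp [vder_pullback]
  · simp [vder_iota]

/-- The differential of `G` along the fibre at `x`. -/
def dv (x : TotalSpace F E) (G : TotFn n F E) : E x.proj →ₗ[ℝ] ℝ where
  toFun w := vder x w G
  map_add' w w' := vder_add x w w' G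
  map_smul' r w := vder_smul x r w G

theorem dv_iota (x : TotalSpace F E) (μ : OneForm n F E) : dv x (iota μ) = formAt μ x.proj :=
  LinearMap.ext fun w => vder_iota x w μ

theorem exists_secV (s : Sec n F E) :
    ∃ D : Derivation ℝ (TotFn n F E) (TotFn n F E), ∀ G x, D G x = vder x (s x.proj) G := by
  refine exists_derivation (fun x G => vder x (s x.proj) G) (fun x => isTotDer_vder x _)
    (fun f => ⟨0, fun x => vder_pullback x _ f⟩) (fun μ => ⟨pullback n F E (μ s), fun x => ?_⟩)
  rw [vder_iota, formAt_apply]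
  rfl

/-- The vertical lift of a section, as a derivation. -/
def secV (s : Sec n F E) : Derivation ℝ (TotFn n F E) (TotFn n F E) := (exists_secV s).choose

theorem secV_apply (s : Sec n F E) (G : TotFn n F E) (x : TotalSpace F E) :
    secV s G x = vder x (s x.proj) G := (exists_secV s).choose_spec G x

theorem secV_pullback (s : Sec n F E) (f : Fn n M) : secV s (pullback n F E f) = 0 := by
  ext x
  rw [secV_apply, vder_pullback]
  rfl

theorem secV_iota (s : Sec n F E) (μ : OneForm n F E) :
    secV s (iota μ) = pullback n F E (μ s) := by
  ext x
  rw [secV_apply, vder_iota, formAt_apply]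
  rfl

/-- The restriction of a function on the total space to a section. -/
def alongSec (σ : Sec n F E) (G : TotFn n F E) : Fn n M :=
  ⟨fun p => G ⟨p, σ p⟩, G.contMDiff.comp σ.contMDiff⟩

theorem alongSec_apply (σ : Sec n F E) (G : TotFn n F E) (p : M) :
    alongSec σ G p = G ⟨p, σ p⟩ := rfl

theorem alongSec_iota (σ : Sec n F E) (μ : OneForm n F E) : alongSec σ (iota μ) = μ σ := by
  ext p
  exact iota_apply μ σ p

namespace LieAlgebroid

variable (A : LieAlgebroid n F E)

theorem lieDer_zero_apply (s σ : Sec n F E) (μ : OneForm n F E) :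
    A.lieDer 0 s μ σ = A.anchor s (μ σ) - μ (A.bracket s σ) := by
  simp only [lieDer, dForm, dFun, act, LinearMap.coe_mk, AddHom.coe_mk, LinearMap.zero_apply]
  ring

theorem bracket_skew (X Y : Sec n F E) : A.bracket X Y = -A.bracket Y X := by
  have h := A.bracket_self (X + Y)
  simp only [map_add, LinearMap.add_apply, A.bracket_self, zero_add, add_zero] at h
  exact eq_neg_of_add_eq_zero_right h

/-- Along `σ` the complete lift differentiates σ*G by the anchor and subtracts the fibre derivative
in direction `[s, σ]`. On pullbacks this is a(s)f and on linear functions £_s μ evaluated at σ(p);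
both depend only on the vector σ(p), so different sections through it define the same point
derivation. -/
theorem exists_secC (s : Sec n F E) :
    ∃ D : Derivation ℝ (TotFn n F E) (TotFn n F E), ∀ G (σ : Sec n F E) p,
      D G ⟨p, σ p⟩ = A.anchor s (alongSec σ G) p - vder ⟨p, σ p⟩ (A.bracket s σ p) G := by
  let δ : Sec n F E → M → TotFn n F E → ℝ := fun σ p G =>
    A.anchor s (alongSec σ G) p - vder ⟨p, σ p⟩ (A.bracket s σ p) G
  have hδ : ∀ σ p, IsTotDer (n := n) (⟨p, σ p⟩ : TotalSpace F E) (δ σ p) := by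
    intro σ p
    have h1 := isTotDer_vder (n := n) (⟨p, σ p⟩ : TotalSpace F E) (A.bracket s σ p)
    refine ⟨fun f g => ?_, fun f g => ?_, fun r f => ?_⟩
    · have : alongSec σ (f + g) = alongSec σ f + alongSec σ g := rfl
      simp only [δ, this, map_add, h1.add, ContMDiffMap.coe_add, Pi.add_apply]
      ring
    · have : alongSec σ (f * g) = alongSec σ f * alongSec σ g := rfl
      simp only [δ, this, Derivation.leibniz, h1.mul, ContMDiffMap.coe_add, Pi.add_apply,
        smul_eq_mul, ContMDiffMap.coe_mul, Pi.mul_apply, alongSec_apply]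
      ring
    · have : alongSec σ (r • f) = r • alongSec σ f := rfl
      simp only [δ, this, Derivation.map_smul, h1.smul, ContMDiffMap.coe_smul, Pi.smul_apply,
        smul_eq_mul]
      ring
  have hp : ∀ σ p f, δ σ p (pullback n F E f) = A.anchor s f p := by
    intro σ p f
    have : alongSec σ (pullback n F E f) = f := rfl
    simp only [δ, this, vder_pullback, sub_zero]
  have hi : ∀ σ p μ, δ σ p (iota μ) = A.lieDer 0 s μ σ p := by
    intro σ p μ
    simp only [δ, alongSec_iota, vder_iota, formAt_apply, lieDer_zero_apply]
    rfl
  choose τ hτ using exists_section (n := n) (F := F) (E := E)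
  have hx : ∀ x, (⟨x.proj, τ x x.proj⟩ : TotalSpace F E) = x := fun x => by rw [hτ]
  have hδ' : ∀ x, IsTotDer x (δ (τ x) x.proj) := fun x => by
    have := hδ (τ x) x.proj
    rwa [hx] at this
  obtain ⟨D, hD⟩ := exists_derivation (fun x G => δ (τ x) x.proj G) hδ'
    (fun f => ⟨pullback n F E (A.anchor s f), fun x => hp _ _ _⟩)
    (fun μ => ⟨iota (A.lieDer 0 s μ), fun x => by
      rw [hi, ← iota_apply, hx]⟩)
  refine ⟨D, fun G σ p => ?_⟩
  rw [hD]
  refine (hδ' ⟨p, σ p⟩).ext_tot (hδ σ p) (fun f => ?_) (fun μ => ?_) G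
  · rw [hp, hp]
  · rw [hi, hi, ← iota_apply, hx, ← iota_apply]

/-- The complete lift of a section, as a derivation. -/
def secC (s : Sec n F E) : Derivation ℝ (TotFn n F E) (TotFn n F E) := (A.exists_secC s).choose

theorem secC_apply (s : Sec n F E) (G : TotFn n F E) (σ : Sec n F E) (p : M) :
    A.secC s G ⟨p, σ p⟩ = A.anchor s (alongSec σ G) p - vder ⟨p, σ p⟩ (A.bracket s σ p) G :=
  (A.exists_secC s).choose_spec G σ p

theorem secC_pullback (s : Sec n F E) (f : Fn n M) :
    A.secC s (pullback n F E f) = pullback n F E (A.anchor s f) :=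
  totFn_ext_sec fun σ p => by
    rw [secC_apply, vder_pullback, sub_zero]
    rfl

theorem secC_iota (s : Sec n F E) (μ : OneForm n F E) :
    A.secC s (iota μ) = iota (A.lieDer 0 s μ) :=
  totFn_ext_sec fun σ p => by
    rw [secC_apply, alongSec_iota, vder_iota, formAt_apply, iota_apply, lieDer_zero_apply]
    rfl

end LieAlgebroid

end TotalSpaceDerivations

/-! ### Change of arguments and values of functions of lists; polarization. -/

section ListMaps

namespace ListFun

variable {S S' K K' : Type*} [CommRing K] [CommRing K']

/-- Change of the arguments of a function of lists. -/
def pull (θ : S' → S) (f : ListFun S K) : ListFun S' K := fun xs => f (xs.map θ)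

/-- Change of the values of a function of lists. -/
def push (φ : K →+* K') (f : ListFun S K) : ListFun S K' := fun xs => φ (f xs)

theorem push_apply (φ : K →+* K') (f : ListFun S K) (xs : List S) : push φ f xs = φ (f xs) := rfl
theorem pull_apply (θ : S' → S) (f : ListFun S K) (xs : List S') : pull θ f xs = f (xs.map θ) := rfl

theorem pull_add (θ : S' → S) (f g : ListFun S K) : pull θ (f + g) = pull θ f + pull θ g := rfl
theorem pull_smul {R : Type*} [CommRing R] [Algebra R K] (θ : S' → S) (r : R) (f : ListFun S K) :
    pull θ (r • f) = r • pull θ f := rfl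
theorem pull_zero (θ : S' → S) : pull θ (0 : ListFun S K) = 0 := rfl
theorem cur_pull (θ : S' → S) (f : ListFun S K) (x : S') :
    cur x (pull θ f) = pull θ (cur (θ x) f) := rfl
theorem inv_pull (θ : S' → S) (f : ListFun S K) : inv (pull θ f) = pull θ (inv f) :=
  ext fun xs => by simp [inv_apply, pull_apply]

theorem pull_one (θ : S' → S) : pull θ (1 : ListFun S K) = 1 := by
  refine ext fun xs => ?_
  rcases xs with _ | ⟨x, xs⟩ <;> rfl

theorem pull_mul (θ : S' → S) (f g : ListFun S K) : pull θ (f * g) = pull θ f * pull θ g := by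
  refine ext fun xs => ?_
  induction xs generalizing f g with
  | nil => rfl
  | cons x xs ih =>
    rw [mul_cons, cur_pull, cur_pull, inv_pull, ← ih, ← ih]
    exact mul_cons f g (θ x) (xs.map θ)

theorem push_add (φ : K →+* K') (f g : ListFun S K) : push φ (f + g) = push φ f + push φ g :=
  ext fun _ => map_add φ _ _
theorem push_zero (φ : K →+* K') : push φ (0 : ListFun S K) = 0 :=
  ext fun _ => map_zero φ
theorem push_smul (φ : K →+* K') (r : K) (f : ListFun S K) : push φ (r • f) = φ r • push φ f :=
  ext fun _ => map_mul φ _ _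
theorem push_one (φ : K →+* K') : push φ (1 : ListFun S K) = 1 := by
  refine ext fun xs => ?_
  rcases xs with _ | ⟨x, xs⟩
  · exact map_one φ
  · exact map_zero φ
theorem cur_push (φ : K →+* K') (f : ListFun S K) (x : S) : cur x (push φ f) = push φ (cur x f) :=
  rfl
theorem inv_push (φ : K →+* K') (f : ListFun S K) : inv (push φ f) = push φ (inv f) :=
  ext fun xs => by simp [inv_apply, push_apply]

theorem push_mul (φ : K →+* K') (f g : ListFun S K) : push φ (f * g) = push φ f * push φ g := by
  refine ext fun xs => ?_
  induction xs generalizing f g with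
  | nil => exact map_mul φ _ _
  | cons x xs ih =>
    rw [mul_cons, cur_push, cur_push, inv_push, ← ih, ← ih, push_apply, mul_cons, map_add]
    rfl

theorem push_pull (φ : K →+* K') (θ : S' → S) (f : ListFun S K) :
    push φ (pull θ f) = pull θ (push φ f) := rfl

/-- The derivation of functions of lists over the change of arguments `μ` which replaces one
argument `μ x` by `ν x` or differentiates the value. -/
def polar (d : K → K) (μ ν : S' → S) (f : ListFun S K) : ListFun S' K
  | [] => d (f [])
  | x :: xs => polar d μ ν (cur (μ x) f) xs + f (ν x :: xs.map μ)

variable {d : K → K} {μ ν : S' → S}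

theorem cur_polar (f : ListFun S K) (x : S') :
    cur x (polar d μ ν f) = polar d μ ν (cur (μ x) f) + pull μ (cur (ν x) f) := rfl

theorem polar_nil (f : ListFun S K) : polar d μ ν f [] = d (f []) := rfl

theorem polar_cons (f : ListFun S K) (x : S') (xs : List S') :
    polar d μ ν f (x :: xs) = polar d μ ν (cur (μ x) f) xs + f (ν x :: xs.map μ) := rfl

theorem polar_add (hd : ∀ a b, d (a + b) = d a + d b) (f g : ListFun S K) :
    polar d μ ν (f + g) = polar d μ ν f + polar d μ ν g := by
  refine ext fun xs => ?_
  induction xs generalizing f g with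
  | nil => exact hd _ _
  | cons x xs ih =>
    have h := ih (cur (μ x) f) (cur (μ x) g)
    rw [add_apply] at h
    rw [polar_cons, cur_add, h, add_apply, add_apply, polar_cons, polar_cons]
    ring

theorem polar_smul {R : Type*} [CommRing R] [Algebra R K] (r : R)
    (hd : ∀ a, d (r • a) = r • d a) (f : ListFun S K) :
    polar d μ ν (r • f) = r • polar d μ ν f := by
  refine ext fun xs => ?_
  induction xs generalizing f with
  | nil => exact hd _
  | cons x xs ih =>
    have h := ih (cur (μ x) f)
    rw [smul_apply] at h
    rw [polar_cons, cur_smul, h, smul_apply, smul_apply, polar_cons, smul_add]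

theorem polar_neg (hd : ∀ a, d (-a) = - d a) (f : ListFun S K) :
    polar d μ ν (-f) = -polar d μ ν f := by
  have := polar_smul (μ := μ) (ν := ν) (-1 : K) (fun a => by simpa using hd a) f
  simpa only [neg_smul, one_smul] using this

theorem polar_inv (hd : ∀ a, d (-a) = - d a) (f : ListFun S K) :
    polar d μ ν (inv f) = inv (polar d μ ν f) := by
  refine ext fun xs => ?_
  induction xs generalizing f with
  | nil => simp [polar_nil, inv_apply]
  | cons x xs ih =>
    have h := ih (cur (μ x) f)
    rw [polar_cons, cur_inv, polar_neg hd, neg_apply, h]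
    simp only [inv_apply, List.length_cons, List.length_map, polar_cons, pow_succ]
    ring

/-- Replacing one argument and differentiating the value are both derivations for the shuffle
product. This is the source of the mixed product rule of the complete lift. -/
theorem polar_mul (hd : ∀ a b, d (a + b) = d a + d b) (hm : ∀ a b, d (a * b) = a * d b + b * d a)
    (f g : ListFun S K) :
    polar d μ ν (f * g) = polar d μ ν f * pull μ g + pull μ f * polar d μ ν g := by
  have h0 : d 0 = 0 := by simpa using hm 0 0
  have hn : ∀ a, d (-a) = - d a := fun a =>
    eq_neg_of_add_eq_zero_left (by rw [← hd, neg_add_cancel, h0])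
  refine ext fun xs => ?_
  induction xs generalizing f g with
  | nil =>
    simp only [polar_nil, mul_nil, add_apply, hm, pull_apply, List.map_nil]
    ring
  | cons x xs ih =>
    have e1 : polar d μ ν (f * g) (x :: xs) =
        polar d μ ν (cur (μ x) (f * g)) xs + pull μ (cur (ν x) (f * g)) xs := rfl
    have e2 : ∀ u v : ListFun S K, polar d μ ν (u * v) xs =
        (polar d μ ν u * pull μ v) xs + (pull μ u * polar d μ ν v) xs := fun u v => ih u v
    have e3 : (polar d μ ν f * pull μ g + pull μ f * polar d μ ν g) (x :: xs) =
      (polar d μ ν f * pull μ g) (x :: xs) + (pull μ f * polar d μ ν g) (x :: xs) := rfl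
    rw [e1, e3, cur_mul, cur_mul, polar_add hd, pull_add, pull_mul, pull_mul, add_apply, add_apply,
      e2, e2, mul_cons, mul_cons, cur_polar, cur_polar, cur_pull, cur_pull, inv_pull,
      polar_inv hn, add_mul, mul_add]
    simp only [add_apply]
    ring

theorem polar_zero (h0 : d 0 = 0) : polar d μ ν (0 : ListFun S K) = 0 := by
  refine ext fun xs => ?_
  induction xs with
  | nil => exact h0
  | cons x xs ih => rw [polar_cons, cur_zero, ih]; simp

end ListFun

end ListMaps

/-! ### Evaluation of multivectors -/

section Evaluation

open ListFun CliffordAlgebra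

variable {V : Type*} [AddCommGroup V] [Module ℝ V]

/-- The same recursion as `cur_mul`, with `involute` in the role of `inv`; hence evaluation `ev`
turns exterior products into shuffle products. -/
theorem contractLeft_mul (α : Dual ℝ V) (X Y : ExteriorAlgebra ℝ V) :
    contractLeft α (X * Y) = contractLeft α X * Y + involute X * contractLeft α Y := by
  induction X using CliffordAlgebra.left_induction with
  | algebraMap r =>
    rw [contractLeft_algebraMap_mul, contractLeft_algebraMap, zero_mul, zero_add]
    congr 1
    exact (AlgHom.commutes _ _).symm
  | add X X' h h' => rw [add_mul, map_add, h, h', map_add, map_add, add_mul, add_mul]; abel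
  | ι_mul X v h =>
    rw [mul_assoc, contractLeft_ι_mul, h, contractLeft_ι_mul, map_mul, involute_ι, sub_mul, mul_add,
      smul_mul_assoc, neg_mul, neg_mul, mul_assoc, mul_assoc]
    abel

theorem contractLeft_involute (α : Dual ℝ V) (X : ExteriorAlgebra ℝ V) :
    contractLeft α (involute X) = -involute (contractLeft α X) := by
  induction X using CliffordAlgebra.left_induction with
  | algebraMap r =>
    have h : involute (algebraMap ℝ (ExteriorAlgebra ℝ V) r) = algebraMap ℝ _ r :=
      AlgHom.commutes _ _
    rw [h, contractLeft_algebraMap]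
    simp
  | add X X' h h' => simp only [map_add, h, h', neg_add]
  | ι_mul X v h =>
    rw [map_mul, involute_ι, neg_mul, map_neg, contractLeft_ι_mul, h, contractLeft_ι_mul, map_sub,
      map_mul, involute_ι, map_smul, mul_neg, neg_mul]

theorem algebraMapInv_involute (X : ExteriorAlgebra ℝ V) :
    ExteriorAlgebra.algebraMapInv (involute X) = ExteriorAlgebra.algebraMapInv X := by
  have : (ExteriorAlgebra.algebraMapInv (R := ℝ) (M := V)).comp involute =
      ExteriorAlgebra.algebraMapInv := by
    apply ExteriorAlgebra.hom_ext
    refine LinearMap.ext fun v => ?_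
    change ExteriorAlgebra.algebraMapInv (involute (CliffordAlgebra.ι 0 v)) =
      ExteriorAlgebra.algebraMapInv (ExteriorAlgebra.ι ℝ v)
    have h : ExteriorAlgebra.algebraMapInv (ExteriorAlgebra.ι ℝ v) = 0 := by
      simp [ExteriorAlgebra.algebraMapInv]
    rw [involute_ι, map_neg, h]
    exact neg_zero
  exact DFunLike.congr_fun this X

/-- The evaluation of a multivector on covectors. -/
def ev : ExteriorAlgebra ℝ V → ListFun (Dual ℝ V) ℝ
  | X, [] => ExteriorAlgebra.algebraMapInv X
  | X, α :: αs => ev (contractLeft α X) αs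

theorem ev_nil (X : ExteriorAlgebra ℝ V) : ev X [] = ExteriorAlgebra.algebraMapInv X := rfl

theorem cur_ev (α : Dual ℝ V) (X : ExteriorAlgebra ℝ V) : cur α (ev X) = ev (contractLeft α X) := rfl

theorem ev_add (X Y : ExteriorAlgebra ℝ V) : ev (X + Y) = ev X + ev Y := by
  refine ListFun.ext fun αs => ?_
  induction αs generalizing X Y with
  | nil => exact map_add _ _ _
  | cons α αs ih =>
    change ev (contractLeft α (X + Y)) αs = ev (contractLeft α X) αs + ev (contractLeft α Y) αs
    rw [map_add, ih]
    rfl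

theorem ev_smul (r : ℝ) (X : ExteriorAlgebra ℝ V) : ev (r • X) = r • ev X := by
  refine ListFun.ext fun αs => ?_
  induction αs generalizing X with
  | nil => exact map_smul _ _ _
  | cons α αs ih =>
    change ev (contractLeft α (r • X)) αs = r • ev (contractLeft α X) αs
    rw [map_smul, ih]
    rfl

theorem ev_zero : ev (0 : ExteriorAlgebra ℝ V) = 0 := by
  simpa using ev_smul 0 (0 : ExteriorAlgebra ℝ V)

theorem ev_neg (X : ExteriorAlgebra ℝ V) : ev (-X) = -ev X := by
  simpa using ev_smul (-1) X

theorem ev_one : ev (1 : ExteriorAlgebra ℝ V) = 1 := by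
  refine ListFun.ext fun αs => ?_
  rcases αs with _ | ⟨α, αs⟩
  · exact map_one _
  · change ev (contractLeft α (1 : ExteriorAlgebra ℝ V)) αs = 0
    rw [contractLeft_one, ev_zero]
    rfl

theorem ev_involute (X : ExteriorAlgebra ℝ V) : ev (involute X) = inv (ev X) := by
  refine ListFun.ext fun αs => ?_
  induction αs generalizing X with
  | nil =>
    rw [ev_nil, algebraMapInv_involute]
    simp [inv_apply, ev_nil]
  | cons α αs ih =>
    change ev (contractLeft α (involute X)) αs = _
    rw [contractLeft_involute, ev_neg, ListFun.neg_apply, ih, inv_apply, inv_apply, List.length_cons]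
    change _ = (-1) ^ (αs.length + 1) * ev (contractLeft α X) αs
    ring

theorem ev_mul (X Y : ExteriorAlgebra ℝ V) : ev (X * Y) = ev X * ev Y := by
  refine ListFun.ext fun αs => ?_
  induction αs generalizing X Y with
  | nil => exact map_mul _ _ _
  | cons α αs ih =>
    rw [mul_cons, cur_ev, cur_ev, ← ev_involute, ← ih, ← ih]
    change ev (contractLeft α (X * Y)) αs = _
    rw [contractLeft_mul, ev_add]
    rfl

theorem ev_algebraMap (r : ℝ) : ev (algebraMap ℝ (ExteriorAlgebra ℝ V) r) = r • 1 := by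
  rw [Algebra.algebraMap_eq_smul_one, ev_smul, ev_one]

theorem ev_ι_nil (v : V) : ev (ExteriorAlgebra.ι ℝ v) [] = 0 := by
  rw [ev_nil]
  simp [ExteriorAlgebra.algebraMapInv]

theorem cur_ev_ι (α : Dual ℝ V) (v : V) : cur α (ev (ExteriorAlgebra.ι ℝ v)) = α v • 1 := by
  rw [cur_ev]
  exact (congrArg ev (contractLeft_ι (Q := (0 : QuadraticForm ℝ V)) α v)).trans (ev_algebraMap _)

/-- A multivector of positive degree is recovered from its contractions. -/
theorem sum_ι_mul_contractLeft {ι : Type*} [Fintype ι] (e : ι → V) (ε : ι → Dual ℝ V)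
    (h : ∀ v, v = ∑ i, ε i v • e i) (k : ℕ) (s : Fin k → V) :
    ∑ i, ExteriorAlgebra.ι ℝ (e i) * contractLeft (ε i) (ExteriorAlgebra.ιMulti ℝ k s) =
      (k : ℝ) • ExteriorAlgebra.ιMulti ℝ k s := by
  induction k with
  | zero =>
    simp only [ExteriorAlgebra.ιMulti_zero_apply]
    simp [contractLeft_one]
  | succ k ih =>
    rw [ExteriorAlgebra.ιMulti_succ_apply]
    set Z := ExteriorAlgebra.ιMulti ℝ k (Matrix.vecTail s)
    have e1 : ∀ i, ExteriorAlgebra.ι ℝ (e i) *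
        contractLeft (ε i) (ExteriorAlgebra.ι ℝ (s 0) * Z) =
        ExteriorAlgebra.ι ℝ (ε i (s 0) • e i) * Z +
          ExteriorAlgebra.ι ℝ (s 0) * (ExteriorAlgebra.ι ℝ (e i) * contractLeft (ε i) Z) := by
      intro i
      have h1 : contractLeft (ε i) (ExteriorAlgebra.ι ℝ (s 0) * Z) =
          ε i (s 0) • Z - ExteriorAlgebra.ι ℝ (s 0) * contractLeft (ε i) Z :=
        contractLeft_ι_mul _ _ _
      have h2 : ExteriorAlgebra.ι ℝ (e i) * ExteriorAlgebra.ι ℝ (s 0) =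
          -(ExteriorAlgebra.ι ℝ (s 0) * ExteriorAlgebra.ι ℝ (e i)) :=
        eq_neg_of_add_eq_zero_left (ExteriorAlgebra.ι_add_mul_swap _ _)
      rw [h1, mul_sub, ← mul_assoc, h2, map_smul, smul_mul_assoc, mul_smul_comm, neg_mul,
        sub_neg_eq_add, mul_assoc]
    rw [Finset.sum_congr rfl fun i _ => e1 i, Finset.sum_add_distrib, ← Finset.sum_mul,
      ← map_sum, ← h, ← Finset.mul_sum]
    have h3 := ih (Matrix.vecTail s)
    rw [h3, mul_smul_comm]
    push_cast
    rw [add_smul, one_smul, add_comm]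

end Evaluation

/-! ### Existence of the lifts -/

section LiftExistence

open ListFun

namespace ListFun

theorem polar_smul_one {S S' K : Type*} [CommRing K] {d : K → K} {μ ν : S' → S} (h0 : d 0 = 0)
    (w : K) : polar d μ ν (w • (1 : ListFun S K)) = d w • 1 := by
  refine ListFun.ext fun xs => ?_
  rcases xs with _ | ⟨x, xs⟩
  · simp [polar_nil, one_nil, ListFun.smul_apply]
  · rw [polar_cons, cur_smul, cur_one, smul_zero, polar_zero h0]
    change 0 + w * 0 = d w * 0
    simp

theorem push_smul_one {S K K' : Type*} [CommRing K] [CommRing K'] (φ : K →+* K') (w : K) :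
    push φ (w • (1 : ListFun S K)) = φ w • 1 := by rw [push_smul, push_one]

theorem pull_pull {S S' S'' K : Type*} [CommRing K] (θ : S' → S) (θ' : S'' → S') (f : ListFun S K) :
    pull θ' (pull θ f) = pull (θ ∘ θ') f :=
  ext fun xs => by simp [pull_apply]

theorem ext_cur {S K : Type*} [CommRing K] {f g : ListFun S K} (h0 : f [] = g [])
    (h : ∀ x, cur x f = cur x g) : f = g := by
  refine ext fun xs => ?_
  rcases xs with _ | ⟨x, xs⟩
  · exact h0
  · exact congrFun (h x) xs

variable {W : Type*} [CommRing W] [Algebra ℝ W]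

theorem IsDer.mul {A B : ListFun W W} (hA : IsAlt A) (hB : IsAlt B) (hA' : IsDer A)
    (hB' : IsDer B) : IsDer (A * B) := by
  refine isDer_of_cur (hA.mul hB) fun f g => ?_
  rw [ListFun.cur_mul, ListFun.cur_mul, ListFun.cur_mul, hA'.cur_mul, hB'.cur_mul, add_mul,
    mul_add, smul_mul_assoc, smul_mul_assoc, mul_smul_comm, mul_smul_comm, smul_add, smul_add]
  abel

theorem IsDer.add {A B : ListFun W W} (hA : IsDer A) (hB : IsDer B) : IsDer (A + B) :=
  fun us f g vs => by
    rw [ListFun.add_apply, ListFun.add_apply, ListFun.add_apply, hA us f g vs, hB us f g vs]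
    ring

end ListFun

variable {n : ℕ} {M : Type*} [TopologicalSpace M] [ChartedSpace (EuclideanSpace ℝ (Fin n)) M]
  {F : Type*} [NormedAddCommGroup F] [NormedSpace ℝ F]
  {E : M → Type*} [TopologicalSpace (TotalSpace F E)] [∀ x, AddCommGroup (E x)]
  [∀ x, Module ℝ (E x)] [∀ x, TopologicalSpace (E x)] [FiberBundle F E] [VectorBundle ℝ F E]
  [IsManifold (𝓡 n) ∞ M] [T2Space M] [FiniteDimensional ℝ F] [ContMDiffVectorBundle ∞ F E (𝓡 n)]

/-- Evaluation at a point. -/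
def evalPt {V H N : Type*} [NormedAddCommGroup V] [NormedSpace ℝ V] [TopologicalSpace H]
    {I : ModelWithCorners ℝ V H} [TopologicalSpace N] [ChartedSpace H N] (x : N) :
    C^∞⟮I, N; 𝓘(ℝ), ℝ⟯ →+* ℝ where
  toFun f := f x
  map_one' := rfl
  map_mul' _ _ := rfl
  map_zero' := rfl
  map_add' _ _ := rfl

/-- The fibre differential of `G` along the section `σ`. -/
def dvAlong (σ : Sec n F E) (G : TotFn n F E) : OneForm n F E where
  toFun Y := alongSec σ (secV Y G)
  map_add' Y Z := by
    ext p
    change secV (Y + Z) G _ = secV Y G _ + secV Z G _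
    rw [secV_apply, secV_apply, secV_apply, ← vder_add]
    rfl
  map_smul' f Y := by
    ext p
    change secV (f • Y) G _ = f p * secV Y G _
    rw [secV_apply, secV_apply, ← vder_smul]
    rfl

theorem dvAlong_apply (σ : Sec n F E) (G : TotFn n F E) (Y : Sec n F E) :
    dvAlong σ G Y = alongSec σ (secV Y G) := rfl

theorem formAt_dvAlong (σ : Sec n F E) (G : TotFn n F E) (p : M) :
    formAt (dvAlong σ G) p = dv ⟨p, σ p⟩ G := by
  refine LinearMap.ext fun v => ?_
  obtain ⟨Y, hY⟩ := exists_section (n := n) (⟨p, v⟩ : TotalSpace F E)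
  have hY' : Y p = v := hY
  rw [← hY', formAt_apply, dvAlong_apply, alongSec_apply, secV_apply]
  rfl

theorem eq_of_evalPt {k : ℕ} {A B : AltOp (TotFn n F E) k}
    (h : ∀ p (v : E p), push (evalPt (⟨p, v⟩ : TotalSpace F E)) (tot A) =
      push (evalPt (⟨p, v⟩ : TotalSpace F E)) (tot B)) : A = B := by
  refine tot_injective (ListFun.ext fun xs => ?_)
  ext ⟨p, v⟩
  exact congrFun (h p v) xs

/-- Operators given near every point glue to a global operator. -/
theorem exists_glue {k : ℕ} (P : M → AltOp (TotFn n F E) k → Prop)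
    (hloc : ∀ p₀, ∃ A, IsMultiDerivation A ∧ ∀ᶠ p in 𝓝 p₀, P p A)
    (huniq : ∀ p A B, P p A → P p B → ∀ v : E p,
      push (evalPt (⟨p, v⟩ : TotalSpace F E)) (tot A) =
      push (evalPt (⟨p, v⟩ : TotalSpace F E)) (tot B))
    (hcongr : ∀ p A B, P p A → (∀ v : E p,
      push (evalPt (⟨p, v⟩ : TotalSpace F E)) (tot A) =
      push (evalPt (⟨p, v⟩ : TotalSpace F E)) (tot B)) → P p B) :
    ∃ A, IsMultiDerivation A ∧ ∀ p, P p A := by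
  choose B hB hP using hloc
  -- At each vector the glued operator uses the local one chosen for its own base point. By
  -- uniqueness over each point, these choices agree near `p₀` with the single operator `B p₀`, so
  -- smoothness is inherited.
  have hval : ∀ p₀, ∀ᶠ p in 𝓝 p₀, ∀ (v : E p) G, B p G ⟨p, v⟩ = B p₀ G ⟨p, v⟩ := by
    intro p₀
    filter_upwards [hP p₀] with p hp v G
    have := congrFun (huniq p _ _ (hP p).self_of_nhds hp v) (List.ofFn G)
    rw [push_apply, push_apply, tot_ofFn, tot_ofFn] at this
    exact this
  have hsm : ∀ G, ContMDiff ((𝓡 n).prod 𝓘(ℝ, F)) 𝓘(ℝ) ∞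
      (fun x : TotalSpace F E => B x.proj G x) := by
    intro G x₀
    refine ((B x₀.proj G).contMDiff x₀).congr_of_eventuallyEq ?_
    have hproj : Filter.Tendsto (TotalSpace.proj : TotalSpace F E → M) (𝓝 x₀) (𝓝 x₀.proj) :=
      (FiberBundle.continuous_proj F E).continuousAt
    filter_upwards [hproj.eventually (hval x₀.proj)] with x hx
    exact hx x.2 G
  let A : AltOp (TotFn n F E) k :=
    { toFun := fun G => ⟨fun x => B x.proj G x, hsm G⟩
      map_update_add' := fun G i f g => by
        ext x
        have h' := congrArg (fun w : TotFn n F E => w x) ((B x.proj).map_update_add G i f g)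
        exact h'
      map_update_smul' := fun G i r f => by
        ext x
        have h' := congrArg (fun w : TotFn n F E => w x) ((B x.proj).map_update_smul G i r f)
        exact h'
      map_eq_zero_of_eq' := fun G i j h hij => by
        ext x
        have h' := congrArg (fun w : TotFn n F E => w x) ((B x.proj).map_eq_zero_of_eq G h hij)
        exact h' }
  have hA : ∀ G x, A G x = B x.proj G x := fun G x => rfl
  refine ⟨A, fun i G f g => ?_, fun p => hcongr p _ _ (hP p).self_of_nhds fun v => ?_⟩
  · ext x
    have h' := congrArg (fun w : TotFn n F E => w x) (hB x.proj i G f g)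
    exact h'
  · refine ListFun.ext fun xs => ?_
    by_cases hx : xs.length = k
    · obtain ⟨G, rfl⟩ := exists_ofFn xs hx
      rw [push_apply, push_apply, tot_ofFn, tot_ofFn]
      rfl
    · rw [push_apply, push_apply, tot_isHom _ _ hx, tot_isHom _ _ hx]

/-- The operator `A` is the vertical lift of `X` over the point `p`. -/
def VertAt {k : ℕ} (X : ∀ p, ExteriorAlgebra ℝ (E p)) (A : AltOp (TotFn n F E) k) (p : M) : Prop :=
  ∀ v : E p, push (evalPt (⟨p, v⟩ : TotalSpace F E)) (tot A) =
    pull (dv (⟨p, v⟩ : TotalSpace F E)) (ev (X p))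

/-- The function `f` of one-forms is given near `p` by evaluation of `X`. -/
def IsGerm (f : ListFun (OneForm n F E) (Fn n M)) (X : ∀ p, ExteriorAlgebra ℝ (E p)) (p : M) :
    Prop :=
  ∀ᶠ q in 𝓝 p, push (evalPt q) f = pull (fun α => formAt α q) (ev (X q))

/-- The derivation attached to a section. -/
def derOp {W : Type*} [CommRing W] [Algebra ℝ W] (D : Derivation ℝ W W) : AltOp W 1 :=
  AlternatingMap.ofSubsingleton ℝ W W (0 : Fin 1) D.toLinearMap

theorem derOp_apply {W : Type*} [CommRing W] [Algebra ℝ W] (D : Derivation ℝ W W) (x : W) :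
    derOp D ![x] = D x := rfl

theorem cur_tot_derOp {W : Type*} [CommRing W] [Algebra ℝ W] (D : Derivation ℝ W W) (x : W) :
    cur x (tot (derOp D)) = D x • 1 := by
  refine ListFun.ext fun xs => ?_
  rcases xs with _ | ⟨y, xs⟩
  · rw [cur_apply]
    have := tot_ofFn (derOp D) ![x]
    rw [derOp_apply] at this
    simpa [one_nil, ListFun.smul_apply] using this
  · rw [cur_apply, tot_isHom _ _ (by simp), ListFun.smul_apply]
    change 0 = D x • (0 : W)
    simp

theorem isMultiDerivation_derOp {W : Type*} [CommRing W] [Algebra ℝ W] (D : Derivation ℝ W W) :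
    IsMultiDerivation (derOp D) := by
  rw [isMultiDerivation_iff]
  refine isDer_of_cur (tot_isAlt _) fun f g => ?_
  rw [cur_tot_derOp, cur_tot_derOp, cur_tot_derOp, D.leibniz, add_smul, smul_smul, smul_smul]
  rfl

theorem isMultiDerivation_constOp {W : Type*} [CommRing W] [Algebra ℝ W] (w : W) :
    IsMultiDerivation (constOp w) := fun i => i.elim0

theorem isMultiDerivation_wedge {W : Type*} [CommRing W] [Algebra ℝ W] {k l : ℕ} {A : AltOp W k}
    {B : AltOp W l} (hA : IsMultiDerivation A) (hB : IsMultiDerivation B) :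
    IsMultiDerivation (wedge (k + l) A B) := by
  rw [isMultiDerivation_iff] at *
  rw [tot_wedge rfl]
  exact hA.mul (tot_isAlt A) (tot_isAlt B) hB

theorem isMultiDerivation_add {W : Type*} [CommRing W] [Algebra ℝ W] {k : ℕ} {A B : AltOp W k}
    (hA : IsMultiDerivation A) (hB : IsMultiDerivation B) : IsMultiDerivation (A + B) := by
  rw [isMultiDerivation_iff] at *
  rw [tot_add]
  exact hA.add hB

namespace LieAlgebroid

variable (A : LieAlgebroid n F E)

/-- The derivative along `σ` of the fibre differentials of `G`. -/
def derivDvAlong (σ : Sec n F E) (G : TotFn n F E) : OneForm n F E :=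
  A.dFun 0 (alongSec σ G) - A.lieDer 0 σ (dvAlong σ G)

theorem derivDvAlong_apply (σ : Sec n F E) (G : TotFn n F E) (s : Sec n F E) :
    A.derivDvAlong σ G s = A.anchor s (alongSec σ G) - A.anchor σ (dvAlong σ G s)
      + dvAlong σ G (A.bracket σ s) := by
  rw [derivDvAlong, LinearMap.sub_apply, lieDer_zero_apply]
  simp only [dFun, act, LinearMap.coe_mk, AddHom.coe_mk, LinearMap.zero_apply]
  ring

/-- The values along `σ` of the complete lift of the multisection with evaluation `f`. -/
def polarAlong (σ : Sec n F E) (f : ListFun (OneForm n F E) (Fn n M)) :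
    ListFun (TotFn n F E) (Fn n M) :=
  polar (A.anchor σ) (dvAlong σ) (A.derivDvAlong σ) f

/-- The operator `C` is the complete lift of `X` over the point `p`. -/
def ComplAt {k : ℕ} (X : ∀ p, ExteriorAlgebra ℝ (E p)) (C : AltOp (TotFn n F E) k) (p : M) :
    Prop :=
  ∃ f, IsGerm f X p ∧ ∀ σ : Sec n F E,
    push (evalPt (⟨p, σ p⟩ : TotalSpace F E)) (tot C) = push (evalPt p) (A.polarAlong σ f)

theorem isPointDer_anchor (σ : Sec n F E) (p : M) :
    IsPointDer (𝓡 n) p (fun f => A.anchor σ f p) :=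
  ⟨fun f g => by rw [map_add]; rfl, fun f g => by rw [Derivation.leibniz]; rfl,
    fun r f => by rw [Derivation.map_smul]; rfl⟩

/-- Polarization differentiates the value once along the anchor of `σ`. It therefore depends on the
germ at `p` and not just on the value there, which is why `IsGerm` is imposed on a neighbourhood. -/
theorem polarAlong_congr {σ : Sec n F E} {f g : ListFun (OneForm n F E) (Fn n M)} {p : M}
    (h : ∀ᶠ q in 𝓝 p, push (evalPt q) f = push (evalPt q) g) :
    push (evalPt p) (A.polarAlong σ f) = push (evalPt p) (A.polarAlong σ g) := by
  refine ListFun.ext fun xs => ?_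
  induction xs generalizing f g with
  | nil =>
    refine (A.isPointDer_anchor σ p).congr ?_
    filter_upwards [h] with q hq using congrFun hq []
  | cons x xs ih =>
    have h1 := ih (f := cur (dvAlong σ x) f) (g := cur (dvAlong σ x) g) (by
      filter_upwards [h] with q hq
      rw [← cur_push, hq, cur_push])
    have h2 := congrFun h.self_of_nhds (A.derivDvAlong σ x :: xs.map (dvAlong σ))
    exact congrArg₂ (· + ·) h1 h2

variable {A}

theorem _root_.JacobiAlgebroid.IsGerm.congr {f : ListFun (OneForm n F E) (Fn n M)}
    {X Y : ∀ p, ExteriorAlgebra ℝ (E p)} {p : M} (hf : IsGerm f X p)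
    (h : ∀ᶠ q in 𝓝 p, X q = Y q) : IsGerm f Y p := by
  filter_upwards [h, hf] with q h1 h2
  rw [h2, h1]

theorem _root_.JacobiAlgebroid.VertAt.congr {k : ℕ} {B : AltOp (TotFn n F E) k}
    {X Y : ∀ p, ExteriorAlgebra ℝ (E p)} {p : M} (hB : VertAt X B p)
    (h : X p = Y p) : VertAt Y B p := fun v => by rw [hB v, h]

theorem ComplAt.congr {k : ℕ} {C : AltOp (TotFn n F E) k}
    {X Y : ∀ p, ExteriorAlgebra ℝ (E p)} {p : M} (hC : A.ComplAt X C p)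
    (h : ∀ᶠ q in 𝓝 p, X q = Y q) : A.ComplAt Y C p := by
  obtain ⟨f, hf, hC⟩ := hC
  exact ⟨f, hf.congr h, hC⟩

theorem ComplAt.unique {k : ℕ} {C C' : AltOp (TotFn n F E) k}
    {X : ∀ p, ExteriorAlgebra ℝ (E p)} {p : M} (hC : A.ComplAt X C p) (hC' : A.ComplAt X C' p)
    (v : E p) : push (evalPt (⟨p, v⟩ : TotalSpace F E)) (tot C) =
      push (evalPt (⟨p, v⟩ : TotalSpace F E)) (tot C') := by
  obtain ⟨f, hf, hC⟩ := hC
  obtain ⟨g, hg, hC'⟩ := hC'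
  obtain ⟨σ, hσ⟩ := exists_section (n := n) (⟨p, v⟩ : TotalSpace F E)
  have hσ' : σ p = v := hσ
  rw [← hσ', hC, hC']
  refine A.polarAlong_congr ?_
  filter_upwards [hf, hg] with q h1 h2
  rw [h1, h2]

theorem _root_.JacobiAlgebroid.VertAt.add {k : ℕ} {B B' : AltOp (TotFn n F E) k}
    {X Y : ∀ p, ExteriorAlgebra ℝ (E p)} {p : M} (hB : VertAt X B p) (hB' : VertAt Y B' p) :
    VertAt (X + Y) (B + B') p := fun v => by
  rw [tot_add, push_add, hB v, hB' v, Pi.add_apply, ev_add, pull_add]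

theorem push_real_smul {S V H N : Type*} [NormedAddCommGroup V] [NormedSpace ℝ V] [TopologicalSpace H]
    {I : ModelWithCorners ℝ V H} [TopologicalSpace N] [ChartedSpace H N] (x : N) (r : ℝ)
    (f : ListFun S C^∞⟮I, N; 𝓘(ℝ), ℝ⟯) : push (evalPt x) (r • f) = r • push (evalPt x) f := rfl

theorem _root_.JacobiAlgebroid.VertAt.smul {k : ℕ} {B : AltOp (TotFn n F E) k}
    {X : ∀ p, ExteriorAlgebra ℝ (E p)} {p : M} (r : ℝ) (hB : VertAt X B p) :
    VertAt (r • X) (r • B) p := fun v => by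
  rw [tot_smul_real, push_real_smul, hB v, Pi.smul_apply, ev_smul, pull_smul]

theorem _root_.JacobiAlgebroid.VertAt.wedge {k l : ℕ} {B : AltOp (TotFn n F E) k}
    {B' : AltOp (TotFn n F E) l}
    {X Y : ∀ p, ExteriorAlgebra ℝ (E p)} {p : M} (hB : VertAt X B p) (hB' : VertAt Y B' p) :
    VertAt (fun q => X q * Y q) (JacobiAlgebroid.wedge (k + l) B B') p := fun v => by
  rw [tot_wedge rfl, push_mul, hB v, hB' v, ev_mul, pull_mul]

theorem _root_.JacobiAlgebroid.IsGerm.mul {f g : ListFun (OneForm n F E) (Fn n M)}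
    {X Y : ∀ p, ExteriorAlgebra ℝ (E p)} {p : M} (hf : IsGerm f X p) (hg : IsGerm g Y p) :
    IsGerm (f * g) (fun q => X q * Y q) p := by
  filter_upwards [hf, hg] with q h1 h2
  rw [push_mul, h1, h2, ev_mul, pull_mul]

theorem ComplAt.add {k : ℕ} {C C' : AltOp (TotFn n F E) k}
    {X Y : ∀ p, ExteriorAlgebra ℝ (E p)} {p : M} (hC : A.ComplAt X C p) (hC' : A.ComplAt Y C' p) :
    A.ComplAt (X + Y) (C + C') p := by
  obtain ⟨f, hf, hC⟩ := hC
  obtain ⟨g, hg, hC'⟩ := hC'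
  refine ⟨f + g, ?_, fun σ => ?_⟩
  · filter_upwards [hf, hg] with q h1 h2
    rw [push_add, h1, h2, Pi.add_apply, ev_add, pull_add]
  · rw [tot_add, push_add, hC, hC', polarAlong, polarAlong, polarAlong, polar_add (map_add _),
      push_add]

theorem ComplAt.smul {k : ℕ} {C : AltOp (TotFn n F E) k}
    {X : ∀ p, ExteriorAlgebra ℝ (E p)} {p : M} (r : ℝ) (hC : A.ComplAt X C p) :
    A.ComplAt (r • X) (r • C) p := by
  obtain ⟨f, hf, hC⟩ := hC
  refine ⟨r • f, ?_, fun σ => ?_⟩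
  · filter_upwards [hf] with q h1
    rw [push_real_smul, h1, Pi.smul_apply, ev_smul, pull_smul]
  · rw [tot_smul_real, push_real_smul, hC, polarAlong, polarAlong,
      polar_smul r (Derivation.map_smul _ r), push_real_smul]

/-- This is `polar_mul`: the factor that is not polarized is evaluated on the fibre differentials
along `σ`, hence is a vertical lift. -/
theorem ComplAt.wedge {k l : ℕ} {B C : AltOp (TotFn n F E) k} {B' C' : AltOp (TotFn n F E) l}
    {X Y : ∀ p, ExteriorAlgebra ℝ (E p)} {p : M} (hB : VertAt X B p) (hB' : VertAt Y B' p)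
    (hC : A.ComplAt X C p) (hC' : A.ComplAt Y C' p) :
    A.ComplAt (fun q => X q * Y q)
      (JacobiAlgebroid.wedge (k + l) C B' + JacobiAlgebroid.wedge (k + l) B C') p := by
  obtain ⟨f, hf, hC⟩ := hC
  obtain ⟨g, hg, hC'⟩ := hC'
  refine ⟨f * g, hf.mul hg, fun σ => ?_⟩
  have h1 : ∀ (f : ListFun (OneForm n F E) (Fn n M)) (X : ∀ p, ExteriorAlgebra ℝ (E p)),
      IsGerm f X p → push (evalPt p) (pull (dvAlong σ) f) =
        pull (dv (⟨p, σ p⟩ : TotalSpace F E)) (ev (X p)) := by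
    intro f X hf
    rw [push_pull, hf.self_of_nhds, pull_pull]
    congr 1
    funext G
    exact formAt_dvAlong σ G p
  rw [tot_add, tot_wedge rfl, tot_wedge rfl, push_add, push_mul, push_mul, hC, hC', hB, hB',
    polarAlong, polarAlong, polarAlong,
    polar_mul (map_add _) (fun a b => by rw [Derivation.leibniz]; rfl), push_add, push_mul,
    push_mul, h1 f X hf, h1 g Y hg]

theorem _root_.JacobiAlgebroid.vertAt_fn (f : Fn n M) (p : M) :
    VertAt (ofFn f : MultiSec n F E 0).1 (constOp (pullback n F E f)) p := fun v => by
  rw [tot_constOp, push_smul_one]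
  change _ = pull _ (ev (algebraMap ℝ (ExteriorAlgebra ℝ (E p)) (f p)))
  rw [ev_algebraMap, pull_smul, pull_one]
  rfl

theorem complAt_fn (f : Fn n M) (p : M) :
    A.ComplAt (ofFn f : MultiSec n F E 0).1 (constOp (iota (A.dFun 0 f))) p := by
  refine ⟨f • 1, Filter.Eventually.of_forall fun q => ?_, fun σ => ?_⟩
  · rw [push_smul_one]
    change _ = pull _ (ev (algebraMap ℝ (ExteriorAlgebra ℝ (E q)) (f q)))
    rw [ev_algebraMap, pull_smul, pull_one]
    rfl
  · rw [tot_constOp, push_smul_one, polarAlong, polar_smul_one (map_zero _), push_smul_one]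
    congr 1
    change iota (A.dFun 0 f) ⟨p, σ p⟩ = A.anchor σ f p
    rw [iota_apply]
    simp [dFun, act]

theorem _root_.JacobiAlgebroid.vertAt_sec (s : Sec n F E) (p : M) :
    VertAt (ofSec s : MultiSec n F E 1).1 (derOp (secV s)) p := fun v => by
  refine ext_cur ?_ fun G => ?_
  · rw [push_apply, tot_isHom _ _ (by simp), pull_apply]
    exact (ev_ι_nil _).symm
  · rw [cur_push, cur_tot_derOp, push_smul_one, cur_pull]
    change _ = pull _ (cur _ (ev (ExteriorAlgebra.ι ℝ (s p))))
    rw [cur_ev_ι, pull_smul, pull_one]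
    congr 1
    exact secV_apply s G _

theorem complAt_sec (s : Sec n F E) (p : M) :
    A.ComplAt (ofSec s : MultiSec n F E 1).1 (derOp (A.secC s)) p := by
  let f : ListFun (OneForm n F E) (Fn n M) := fun xs => match xs with
    | [α] => α s
    | _ => 0
  have hf : ∀ α, cur α f = α s • 1 := fun α => by
    refine ListFun.ext fun xs => ?_
    rcases xs with _ | ⟨β, xs⟩
    · exact (mul_one _).symm
    · exact (mul_zero _).symm
  refine ⟨f, Filter.Eventually.of_forall fun q => ?_, fun σ => ?_⟩
  · refine ext_cur ?_ fun α => ?_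
    · exact (ev_ι_nil _).symm
    · rw [cur_push, hf, push_smul_one, cur_pull]
      change _ = pull _ (cur _ (ev (ExteriorAlgebra.ι ℝ (s q))))
      rw [cur_ev_ι, pull_smul, pull_one, formAt_apply]
      rfl
  · refine ext_cur ?_ fun G => ?_
    · rw [push_apply, tot_isHom _ _ (by simp), push_apply, polarAlong, polar_nil]
      change _ = evalPt p (A.anchor σ 0)
      rw [map_zero, map_zero, map_zero]
    · rw [cur_push, cur_push, polarAlong, cur_polar, hf, hf, cur_tot_derOp,
        polar_smul_one (map_zero _), pull_smul, pull_one, ← add_smul, push_smul_one, push_smul_one]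
      congr 1
      -- The derivatives along the anchor of `σ` cancel on the right. What is left is the formula
      -- `secC_apply`, up to the skew-symmetry of the bracket.
      change A.secC s G ⟨p, σ p⟩ = (A.anchor σ (dvAlong σ G s) + A.derivDvAlong σ G s) p
      rw [secC_apply, derivDvAlong_apply, bracket_skew A σ s, map_neg]
      have h : vder ⟨p, σ p⟩ (A.bracket s σ p) G = dvAlong σ G (A.bracket s σ) p := by
        rw [dvAlong_apply, alongSec_apply, secV_apply]
      rw [h]
      simp only [ContMDiffMap.coe_add, ContMDiffMap.coe_sub, ContMDiffMap.coe_neg, Pi.add_apply,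
        Pi.sub_apply, Pi.neg_apply]
      ring

/-- Near every point, a multisection has lifts. -/
theorem exists_lifts_dec {k : ℕ} {X : ∀ p, ExteriorAlgebra ℝ (E p)} (hX : X ∈ decSpan n F E k) :
    ∃ B C : AltOp (TotFn n F E) k, IsMultiDerivation B ∧ IsMultiDerivation C ∧
      ∀ p, VertAt X B p ∧ A.ComplAt X C p := by
  induction hX using Submodule.span_induction with
  | mem X hX =>
    obtain ⟨f, s, rfl⟩ := hX
    have key : ∀ (k : ℕ) (s : Fin k → Sec n F E), ∃ B C : AltOp (TotFn n F E) k,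
        IsMultiDerivation B ∧ IsMultiDerivation C ∧
        ∀ p, VertAt (fun q => f q • ExteriorAlgebra.ιMulti ℝ k (fun i => s i q)) B p ∧
          A.ComplAt (fun q => f q • ExteriorAlgebra.ιMulti ℝ k (fun i => s i q)) C p := by
      intro k
      induction k with
      | zero =>
        intro s
        have h : (fun q => f q • ExteriorAlgebra.ιMulti ℝ 0 (fun i => s i q)) =
            (ofFn f : MultiSec n F E 0).1 := by
          funext q
          rw [ExteriorAlgebra.ιMulti_zero_apply]
          exact (Algebra.algebraMap_eq_smul_one _).symm
        rw [h]
        exact ⟨_, _, isMultiDerivation_constOp _, isMultiDerivation_constOp _,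
          fun p => ⟨vertAt_fn f p, complAt_fn f p⟩⟩
      | succ k ih =>
        intro s
        obtain ⟨B, C, hB, hC, h⟩ := ih (Fin.init s)
        -- The last section is split off, so that the function coefficient stays with the first
        -- factors down to degree 0.
        have h' : (fun q => f q • ExteriorAlgebra.ιMulti ℝ (k + 1) (fun i => s i q)) =
            fun q => (f q • ExteriorAlgebra.ιMulti ℝ k (fun i => Fin.init s i q)) *
              (ofSec (s (Fin.last k)) : MultiSec n F E 1).1 q := by
          funext q
          have e1 : (ofSec (s (Fin.last k)) : MultiSec n F E 1).1 q =
              ExteriorAlgebra.ιMulti ℝ 1 (fun _ => s (Fin.last k) q) := by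
            simp [ofSec, ExteriorAlgebra.ιMulti_apply]
          rw [e1, smul_mul_assoc, ExteriorAlgebra.ιMulti_mul_ιMulti]
          congr 2
          funext i
          refine Fin.lastCases ?_ (fun i => ?_) i
          · rw [show Fin.last k = Fin.natAdd k (0 : Fin 1) from rfl, Fin.append_right]
          · rw [show i.castSucc = Fin.castAdd 1 i from rfl, Fin.append_left]
            rfl
        rw [h']
        exact ⟨_, _, isMultiDerivation_wedge hB (isMultiDerivation_derOp _),
          isMultiDerivation_add (isMultiDerivation_wedge hC (isMultiDerivation_derOp _))
            (isMultiDerivation_wedge hB (isMultiDerivation_derOp _)),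
          fun p => ⟨(h p).1.wedge (vertAt_sec _ p),
            ComplAt.wedge (h p).1 (vertAt_sec _ p) (h p).2 (complAt_sec _ p)⟩⟩
    exact key k s
  | zero =>
    obtain ⟨B, C, hB, hC, h⟩ : ∃ B C : AltOp (TotFn n F E) k,
      IsMultiDerivation B ∧ IsMultiDerivation C ∧ B = 0 ∧ C = 0 :=
      ⟨0, 0, fun i G f g => by simp, fun i G f g => by simp, rfl, rfl⟩
    rw [h.1] at hB
    rw [h.2] at hC
    refine ⟨0, 0, hB, hC, fun p => ⟨fun v => ?_, 0, ?_, fun σ => ?_⟩⟩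
    · rw [tot_zero, push_zero, Pi.zero_apply, ev_zero, pull_zero]
    · refine Filter.Eventually.of_forall fun q => ?_
      rw [push_zero, Pi.zero_apply, ev_zero, pull_zero]
    · rw [tot_zero, push_zero, polarAlong, polar_zero (map_zero _), push_zero]
  | add X Y _ _ hX hY =>
    obtain ⟨B, C, hB, hC, h⟩ := hX
    obtain ⟨B', C', hB', hC', h'⟩ := hY
    exact ⟨_, _, isMultiDerivation_add hB hB', isMultiDerivation_add hC hC',
      fun p => ⟨(h p).1.add (h' p).1, (h p).2.add (h' p).2⟩⟩
  | smul r X _ hX =>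
    obtain ⟨B, C, hB, hC, h⟩ := hX
    refine ⟨r • B, r • C, fun i G f g => ?_, fun i G f g => ?_,
      fun p => ⟨(h p).1.smul r, (h p).2.smul r⟩⟩
    · simp only [AlternatingMap.smul_apply, hB i G f g, smul_add, mul_smul_comm]
    · simp only [AlternatingMap.smul_apply, hC i G f g, smul_add, mul_smul_comm]

variable (A)

theorem exists_vert (A : LieAlgebroid n F E) {k : ℕ} (X : MultiSec n F E k) :
    ∃ B : AltOp (TotFn n F E) k, IsMultiDerivation B ∧ ∀ p, VertAt X.1 B p := by
  refine exists_glue (fun p B => VertAt X.1 B p) (fun p₀ => ?_)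
    (fun p B B' h h' v => by rw [h v, h' v]) (fun p B B' h h' v => by rw [← h' v, h v])
  obtain ⟨Y, hY, hXY⟩ := X.2 p₀
  obtain ⟨B, C, hB, -, h⟩ := exists_lifts_dec (A := A) hY
  refine ⟨B, hB, ?_⟩
  filter_upwards [hXY] with p hp using (h p).1.congr hp.symm

theorem exists_compl {k : ℕ} (X : MultiSec n F E k) :
    ∃ C : AltOp (TotFn n F E) k, IsMultiDerivation C ∧ ∀ p, A.ComplAt X.1 C p := by
  refine exists_glue (fun p C => A.ComplAt X.1 C p) (fun p₀ => ?_)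
    (fun p B B' h h' v => h.unique h' v) (fun p B B' h h' => ?_)
  · obtain ⟨Y, hY, hXY⟩ := X.2 p₀
    obtain ⟨B, C, -, hC, h⟩ := exists_lifts_dec (A := A) hY
    refine ⟨C, hC, ?_⟩
    -- Unlike the vertical lift, the complete lift needs equality of the multisections on a
    -- neighbourhood of each nearby point.
    filter_upwards [hXY.eventually_nhds] with p hp
    refine (h p).2.congr ?_
    filter_upwards [hp] with q hq using hq.symm
  · obtain ⟨f, hf, h⟩ := h
    exact ⟨f, hf, fun σ => by rw [← h' (σ p), h]⟩

/-- There are a vertical lift and a complete lift. -/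
theorem exists_lifts : ∃ v c : Lift n F E, IsVerticalLift n F E v ∧
    (∀ k (X : MultiSec n F E k) p, VertAt X.1 (v k X) p) ∧
    (∀ k X, IsMultiDerivation (c k X)) ∧
    (∀ f : Fn n M, c 0 (ofFn f) = constOp (iota (A.dFun 0 f))) ∧
    (∀ s : Sec n F E, c 1 (ofSec s) = derOp (A.secC s)) ∧
    ∀ k l (X : MultiSec n F E k) (Y : MultiSec n F E l), c (k + l) (mulSec X Y) =
      wedge (k + l) (c k X) (v l Y) + wedge (k + l) (v k X) (c l Y) := by
  choose v hv1 hv2 using fun k (X : MultiSec n F E k) => A.exists_vert X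
  choose c hc1 hc2 using fun k (X : MultiSec n F E k) => A.exists_compl X
  have hv : ∀ {k} (X : MultiSec n F E k) B, (∀ p, VertAt X.1 B p) → v k X = B :=
    fun X B h => eq_of_evalPt fun p w => by rw [hv2 _ X p w, h p w]
  have hc : ∀ {k} (X : MultiSec n F E k) C, (∀ p, A.ComplAt X.1 C p) → c k X = C :=
    fun X C h => eq_of_evalPt fun p w => (hc2 _ X p).unique (h p) w
  refine ⟨fun k => ⟨⟨v k, fun X Y => hv _ _ fun p => (hv2 k X p).add (hv2 k Y p)⟩,
    fun r X => hv _ _ fun p => (hv2 k X p).smul r⟩,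
    fun k => ⟨⟨c k, fun X Y => hc _ _ fun p => (hc2 k X p).add (hc2 k Y p)⟩,
    fun r X => hc _ _ fun p => (hc2 k X p).smul r⟩, ⟨hv1, fun f => ?_, fun s G x => ?_,
    fun k l X Y => ?_⟩, hv2, hc1, fun f => ?_, fun s => ?_, fun k l X Y => ?_⟩
  · exact hv _ _ fun p => vertAt_fn f p
  · have : v 1 (ofSec s) = derOp (secV s) := hv _ _ fun p => vertAt_sec s p
    change v 1 (ofSec s) ![G] x = _
    rw [this, derOp_apply, secV_apply]
    rfl
  · exact hv _ _ fun p => (hv2 k X p).wedge (hv2 l Y p)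
  · exact hc _ _ fun p => complAt_fn f p
  · exact hc _ _ fun p => complAt_sec s p
  · exact hc _ _ fun p => ComplAt.wedge (hv2 k X p) (hv2 l Y p) (hc2 k X p) (hc2 l Y p)

end LieAlgebroid

end LiftExistence

/-! ### Induction on multisections and uniqueness of the lifts -/

section Uniqueness

open ListFun

variable {n : ℕ} {M : Type*} [TopologicalSpace M] [ChartedSpace (EuclideanSpace ℝ (Fin n)) M]
  {F : Type*} [NormedAddCommGroup F] [NormedSpace ℝ F]
  {E : M → Type*} [TopologicalSpace (TotalSpace F E)] [∀ x, AddCommGroup (E x)]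
  [∀ x, Module ℝ (E x)] [∀ x, TopologicalSpace (E x)] [FiberBundle F E] [VectorBundle ℝ F E]

/-- Products naturally have degrees such as `0 + k` or `1 + k`; properties are transported along
equality of the underlying families. -/
theorem MultiSec.congr_pred {P : ∀ k, MultiSec n F E k → Prop} {k l : ℕ} {X : MultiSec n F E k}
    {Y : MultiSec n F E l} (hkl : k = l) (h : X.1 = Y.1) (hX : P k X) : P l Y := by
  subst hkl
  rwa [← Subtype.ext h]

/-- A local property of multisections which is preserved by sums and by products with functions and
sections holds for all multisections. -/
theorem multiSec_induction (P : ∀ k, MultiSec n F E k → Prop)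
    (hadd : ∀ k X Y, P k X → P k Y → P k (X + Y)) (hfn : ∀ f, P 0 (ofFn f))
    (hmulFn : ∀ k f Z, P k Z → P (0 + k) (mulSec (ofFn f) Z))
    (hmulSec : ∀ k s Z, P k Z → P (1 + k) (mulSec (ofSec s) Z))
    (hloc : ∀ k (X : MultiSec n F E k),
      (∀ p₀, ∃ Y, (∀ᶠ p in 𝓝 p₀, X.1 p = Y.1 p) ∧ P k Y) → P k X) :
    ∀ k X, P k X := by
  have key : ∀ (k : ℕ) (s : Fin k → Sec n F E), P k ⟨fun p => (1 : Fn n M) p •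
      ExteriorAlgebra.ιMulti ℝ k (fun i => s i p), decSpan_le_multiSec _ (dec_mem _ _)⟩ := by
    intro k
    induction k with
    | zero =>
      intro s
      refine MultiSec.congr_pred (P := P) rfl ?_ (hfn 1)
      funext p
      change algebraMap ℝ (ExteriorAlgebra ℝ (E p)) 1 = (1 : ℝ) • _
      rw [ExteriorAlgebra.ιMulti_zero_apply, one_smul, map_one]
    | succ k ih =>
      intro s
      refine MultiSec.congr_pred (P := P) (add_comm 1 k) ?_
        (hmulSec k (s 0) _ (ih fun i => s i.succ))
      funext p
      change ExteriorAlgebra.ι ℝ (s 0 p) * ((1 : ℝ) • _) = (1 : ℝ) • _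
      rw [one_smul, one_smul, ExteriorAlgebra.ιMulti_succ_apply]
      rfl
  have hfs : ∀ (k : ℕ) (f : Fn n M) (X : MultiSec n F E k)
      (h : (fun p => f p • X.1 p) ∈ MultiSec n F E k), P k X → P k ⟨fun p => f p • X.1 p, h⟩ := by
    intro k f X h hX
    refine MultiSec.congr_pred (P := P) (zero_add k) ?_ (hmulFn k f X hX)
    funext p
    exact (Algebra.smul_def _ _).symm
  have hdec : ∀ k X (hX : X ∈ decSpan n F E k), P k ⟨X, decSpan_le_multiSec k hX⟩ := by
    intro k X hX
    have hgen : ∀ (f : Fn n M) (s : Fin k → Sec n F E),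
        P k ⟨fun p => f p • ExteriorAlgebra.ιMulti ℝ k (fun i => s i p),
          decSpan_le_multiSec _ (dec_mem _ _)⟩ := by
      intro f s
      refine MultiSec.congr_pred (P := P) rfl ?_ (hfs k f _ ?_ (key k s))
      · funext p
        change f p • (1 : ℝ) • _ = _
        rw [one_smul]
      · convert decSpan_le_multiSec _ (dec_mem f s) using 1
        funext p
        change f p • (1 : ℝ) • _ = _
        rw [one_smul]
    induction hX using Submodule.span_induction with
    | mem X hX =>
      obtain ⟨f, s, rfl⟩ := hX
      exact hgen f s
    | zero =>
      refine MultiSec.congr_pred (P := P) rfl ?_ (hgen 0 0)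
      funext p
      exact zero_smul ℝ _
    | add X Y hX hY h h' => exact hadd k _ _ h h'
    | smul r X hX h =>
      exact hfs k (algebraMap ℝ _ r) ⟨X, decSpan_le_multiSec k hX⟩
        (Submodule.smul_mem _ r (decSpan_le_multiSec k hX)) h
  intro k X
  refine hloc k X fun p₀ => ?_
  obtain ⟨Y, hY, h⟩ := X.2 p₀
  exact ⟨⟨Y, decSpan_le_multiSec k hY⟩, h, hdec k Y hY⟩

/-- A symmetric property of pairs of multisections which holds for generators and passes, in the
second variable, from generators to all multisections holds for all pairs. -/
theorem multiSec_induction₂ (P : ∀ k l, MultiSec n F E k → MultiSec n F E l → Prop)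
    (hsymm : ∀ k l X Y, P k l X Y → P l k Y X) (hff : ∀ f g, P 0 0 (ofFn f) (ofFn g))
    (hsf : ∀ s f, P 1 0 (ofSec s) (ofFn f)) (hss : ∀ s t, P 1 1 (ofSec s) (ofSec t))
    (hstep : ∀ k X, (∀ f, P k 0 X (ofFn f)) → (∀ s, P k 1 X (ofSec s)) → ∀ l Y, P k l X Y) :
    ∀ k l X Y, P k l X Y := fun k l X Y =>
  -- Applied to a generator, `hstep` reaches pairs of a generator and an arbitrary multisection;
  -- symmetry exchanges the two, and a last application reaches all pairs.
  hstep k X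
    (fun f => hsymm _ _ _ _ (hstep 0 (ofFn f) (hff f) (fun s => hsymm _ _ _ _ (hsf s f)) k X))
    (fun s => hsymm _ _ _ _ (hstep 1 (ofSec s) (hsf s) (hss s) k X)) l Y

variable [IsManifold (𝓡 n) ∞ M] [T2Space M] [FiniteDimensional ℝ F]
  [ContMDiffVectorBundle ∞ F E (𝓡 n)]

theorem exists_bump_mulSec_eq {k : ℕ} {X Y : MultiSec n F E k} {p₀ : M}
    (h : ∀ᶠ p in 𝓝 p₀, X.1 p = Y.1 p) :
    ∃ ψ : Fn n M, ψ p₀ = 1 ∧ mulSec (ofFn ψ) X = mulSec (ofFn ψ) Y := by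
  obtain ⟨ψ, hψ1, hψ⟩ := exists_bump (I := 𝓡 n) h
  refine ⟨ψ, hψ1.self_of_nhds, Subtype.ext (funext fun p => ?_)⟩
  change algebraMap ℝ (ExteriorAlgebra ℝ (E p)) (ψ p) * X.1 p = algebraMap ℝ _ (ψ p) * Y.1 p
  by_cases hp : p ∈ tsupport ψ
  · rw [show X.1 p = Y.1 p from hψ hp]
  · rw [image_eq_zero_of_notMem_tsupport hp, map_zero, zero_mul, zero_mul]

/-- Linearity over the functions implies locality: if `ψ X = ψ Y` with ψ equal to 1 at the point,
then `T X = ψ T X = T' (ψ X) = T' (ψ Y) = ψ T Y = 0` over that point. -/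
theorem eq_zero_of_local {k : ℕ}
    (T : MultiSec n F E k → ListFun (TotFn n F E) (TotFn n F E))
    (T' : MultiSec n F E (0 + k) → ListFun (TotFn n F E) (TotFn n F E))
    (hT : ∀ f Z, T' (mulSec (ofFn f) Z) = pullback n F E f • T Z) (X : MultiSec n F E k)
    (h : ∀ p₀, ∃ Y, (∀ᶠ p in 𝓝 p₀, X.1 p = Y.1 p) ∧ T Y = 0) : T X = 0 := by
  refine ListFun.ext fun xs => ?_
  ext x
  obtain ⟨Y, hXY, hY⟩ := h x.proj
  obtain ⟨ψ, hψ1, hψ⟩ := exists_bump_mulSec_eq hXY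
  have h2 : pullback n F E ψ • T X = 0 := by rw [← hT, hψ, hT, hY, smul_zero]
  have h3 := congrArg (fun w : TotFn n F E => w x) (congrFun h2 xs)
  have h4 : ψ x.proj * T X xs x = 0 := h3
  rw [hψ1, one_mul] at h4
  exact h4

/-- An additive map on multisections, linear over the functions, vanishes if it vanishes on
functions and if its kernel is stable under products with sections. -/
theorem eq_zero_of_generators
    (T : ∀ k, MultiSec n F E k → ListFun (TotFn n F E) (TotFn n F E))
    (hadd : ∀ k X Y, T k (X + Y) = T k X + T k Y) (hfn : ∀ f, T 0 (ofFn f) = 0)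
    (hmulFn : ∀ k f Z, T (0 + k) (mulSec (ofFn f) Z) = pullback n F E f • T k Z)
    (hmulSec : ∀ k s Z, T k Z = 0 → T (1 + k) (mulSec (ofSec s) Z) = 0) :
    ∀ k X, T k X = 0 :=
  multiSec_induction (fun k X => T k X = 0) (fun k X Y h h' => by rw [hadd, h, h', add_zero]) hfn
    (fun k f Z h => by rw [hmulFn, h, smul_zero]) hmulSec
    (fun k X h => eq_zero_of_local (T k) (T (0 + k)) (hmulFn k) X h)

theorem eq_derOp_of_forall {D : Derivation ℝ (TotFn n F E) (TotFn n F E)}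
    {B : AltOp (TotFn n F E) 1} (h : ∀ G, B ![G] = D G) : B = derOp D := by
  refine AlternatingMap.ext fun G => ?_
  have h1 : G = ![G 0] := by
    funext i
    rw [Subsingleton.elim i 0]
    rfl
  rw [h1, h, derOp_apply]

theorem IsVerticalLift.sec_eq {v : Lift n F E} (hv : IsVerticalLift n F E v) (s : Sec n F E) :
    v 1 (ofSec s) = derOp (secV s) :=
  eq_derOp_of_forall fun G => by
    ext x
    rw [secV_apply]
    exact hv.sec s G x

theorem tot_mulFn {v : Lift n F E} (hv : IsVerticalLift n F E v) {k : ℕ} (f : Fn n M)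
    (X : MultiSec n F E k) :
    tot (v (0 + k) (mulSec (ofFn f) X)) = pullback n F E f • tot (v k X) := by
  rw [hv.wedge, tot_wedge rfl, hv.function, tot_constOp, smul_mul_assoc, one_mul]

theorem IsVerticalLift.unique {v w : Lift n F E} (hv : IsVerticalLift n F E v)
    (hw : IsVerticalLift n F E w) : v = w := by
  have h := eq_zero_of_generators (fun k X => tot (v k X) - tot (w k X))
    (fun k X Y => by simp only [map_add, tot_add]; abel)
    (fun f => by simp only [hv.function, hw.function, sub_self])
    (fun k f Z => by simp only [tot_mulFn hv, tot_mulFn hw, smul_sub])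
    (fun k s Z h => by
      simp only [hv.wedge, hw.wedge, tot_wedge rfl, hv.sec_eq, hw.sec_eq] at h ⊢
      rw [← mul_sub, h, mul_zero])
  funext k
  exact LinearMap.ext fun X => tot_injective (sub_eq_zero.1 (h k X))

/-- The Lie algebroid with zero bracket and zero anchor. -/
def LieAlgebroid.trivial : LieAlgebroid n F E where
  bracket := 0
  anchor := 0
  bracket_self _ := rfl
  jacobi _ _ _ := by simp
  leibniz _ _ _ := by simp

/-- Both lifts are constructed together from a Lie algebroid, on which the vertical one does not
depend; the zero structure is available on every bundle. -/
theorem existsUnique_verticalLift :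
    (∃! v, IsVerticalLift n F E v) ∧ IsVerticalLift n F E (verticalLift n F E) := by
  obtain ⟨v, c, hv, -⟩ := (LieAlgebroid.trivial (n := n) (F := F) (E := E)).exists_lifts
  exact ⟨⟨v, hv, fun w hw => hw.unique hv⟩, Classical.epsilon_spec (p := IsVerticalLift n F E) ⟨v, hv⟩⟩

theorem verticalLift_spec : IsVerticalLift n F E (verticalLift n F E) :=
  existsUnique_verticalLift.2

theorem vertAt_verticalLift {k : ℕ} (X : MultiSec n F E k) (p : M) :
    VertAt X.1 (verticalLift n F E k X) p := by
  obtain ⟨v, c, hv, h, -⟩ := (LieAlgebroid.trivial (n := n) (F := F) (E := E)).exists_lifts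
  rw [verticalLift_spec.unique hv]
  exact h k X p

/-- In positive rank, at every point some section and some one-form have nonzero pairing. -/
theorem exists_pairing_ne_zero (hF : finrank ℝ F ≠ 0) (p : M) :
    ∃ (s : Sec n F E) (μ : OneForm n F E), μ s p ≠ 0 := by
  have hnt : Nontrivial F := Module.nontrivial_of_finrank_pos (Nat.pos_of_ne_zero hF)
  let e := trivializationAt F E p
  have hp := FiberBundle.mem_baseSet_trivializationAt F E p
  have hnt' : Nontrivial (E p) :=
    (e.continuousLinearEquivAt ℝ p hp).toLinearEquiv.toEquiv.nontrivial
  obtain ⟨v, hv⟩ := exists_ne (0 : E p)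
  obtain ⟨s, ε, -, h⟩ := exists_coframe (n := n) (E := E) p (finBasis ℝ F)
  obtain ⟨t, ht⟩ := exists_section (n := n) (⟨p, v⟩ : TotalSpace F E)
  have ht' : t p = v := ht
  by_contra hc
  push Not at hc
  apply hv
  rw [h.self_of_nhds v]
  refine Finset.sum_eq_zero fun i _ => ?_
  rw [← ht', formAt_apply, hc, zero_smul]

theorem sec_eq_zero_of_finrank (hF : finrank ℝ F = 0) (s : Sec n F E) : s = 0 := by
  ext p
  obtain ⟨t, ε, -, h⟩ := exists_coframe (n := n) (E := E) p (finBasis ℝ F)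
  rw [h.self_of_nhds (s p)]
  have : IsEmpty (Fin (finrank ℝ F)) := by rw [hF]; infer_instance
  rw [Finset.univ_eq_empty, Finset.sum_empty]
  rfl

/-- In positive rank, a derivation which vanishes on the fibrewise linear functions vanishes. -/
theorem derivation_eq_of_iota (hF : finrank ℝ F ≠ 0) {D D' : Derivation ℝ (TotFn n F E) (TotFn n F E)}
    (h : ∀ μ, D (iota μ) = D' (iota μ)) : D = D' := by
  refine derivation_ext (fun f => ?_) h
  set g := D (pullback n F E f) - D' (pullback n F E f) with hg
  -- Comparison on the fibrewise linear function of `f • μ`, which is the pullback of `f` times that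
  -- of `μ`.
  have h1 : ∀ μ, g * iota μ = 0 := by
    intro μ
    have h2 := h (f • μ)
    rw [iota_smul, Derivation.leibniz, Derivation.leibniz, h μ] at h2
    have h3 := add_left_cancel h2
    simp only [smul_eq_mul] at h3
    rw [hg, sub_mul, mul_comm, h3, mul_comm, sub_self]
  -- By `h1`, g vanishes wherever some fibrewise linear function does not, but all of these vanish
  -- on the zero section. A vertical derivative of `h1`, multiplied by `g`, gives a relation usable
  -- there too.
  have h2 : ∀ (s : Sec n F E) (μ : OneForm n F E), g * g * pullback n F E (μ s) = 0 := by
    intro s μ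
    have h3 := congrArg (secV s) (h1 μ)
    rw [Derivation.leibniz, secV_iota, map_zero] at h3
    have h4 := congrArg (fun w => g * w) h3
    simp only [smul_eq_mul, mul_add, mul_zero] at h4
    rw [← mul_assoc, ← mul_assoc, h1, zero_mul, add_zero] at h4
    exact h4
  have h5 : g = 0 := by
    ext x
    obtain ⟨s, μ, hs⟩ := exists_pairing_ne_zero (n := n) (F := F) (E := E) hF x.proj
    have h6 : g x * g x * μ s x.proj = 0 :=
      congrArg (fun w : TotFn n F E => w x) (h2 s μ)
    change g x = 0
    simpa [hs] using h6
  exact sub_eq_zero.1 h5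

namespace LieAlgebroid

variable {A : LieAlgebroid n F E}

/-- The axioms prescribe the lift of a section only on fibrewise linear functions. In positive rank
these determine a derivation. In rank zero they carry no information, but then the section itself is
zero and linearity of the lift suffices. -/
theorem IsCompleteLift.sec_eq {c : Lift n F E} (hc : A.IsCompleteLift c) (s : Sec n F E) :
    c 1 (ofSec s) = derOp (A.secC s) := by
  have hder := hc.multiDerivation 1 (ofSec s)
  have hu : ∀ (G H : TotFn n F E), Function.update ![G] 0 H = ![H] := fun G H => by
    funext i
    rw [Subsingleton.elim i 0]
    simp
  have hadd : ∀ G H : TotFn n F E, c 1 (ofSec s) ![G + H] = c 1 (ofSec s) ![G] + c 1 (ofSec s) ![H] :=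
    fun G H => by
      have := (c 1 (ofSec s)).map_update_add ![0] 0 G H
      simpa only [hu] using this
  have hsmul : ∀ (r : ℝ) (G : TotFn n F E), c 1 (ofSec s) ![r • G] = r • c 1 (ofSec s) ![G] :=
    fun r G => by
      have := (c 1 (ofSec s)).map_update_smul ![0] 0 r G
      simpa only [hu] using this
  let D : Derivation ℝ (TotFn n F E) (TotFn n F E) :=
    Derivation.mk' { toFun := fun G => c 1 (ofSec s) ![G], map_add' := hadd, map_smul' := hsmul }
      fun G H => by
        have := hder 0 ![0] G H
        simp only [hu] at this
        exact this
  have hD : c 1 (ofSec s) = derOp D := eq_derOp_of_forall fun G => rfl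
  rw [hD]
  by_cases hF : finrank ℝ F = 0
  · have h0 : s = 0 := sec_eq_zero_of_finrank hF s
    have h1 : (ofSec s : MultiSec n F E 1) = 0 := by
      refine Subtype.ext (funext fun p => ?_)
      change ExteriorAlgebra.ι ℝ (s p) = 0
      rw [h0]
      exact map_zero _
    rw [← hD, h1, map_zero]
    refine (eq_derOp_of_forall (D := A.secC s) fun G => ?_)
    refine totFn_ext_sec fun σ p => ?_
    rw [secC_apply, h0, map_zero, map_zero, LinearMap.zero_apply]
    have h2 := (vder_smul (⟨p, σ p⟩ : TotalSpace F E) 0 0 G)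
    rw [zero_smul, zero_mul] at h2
    change 0 = (0 : Fn n M) p - vder ⟨p, σ p⟩ (0 : E p) G
    rw [h2]
    simp
  · rw [derivation_eq_of_iota (D := D) (D' := A.secC s) hF
      fun μ => (hc.sec s μ).trans (secC_iota A s μ).symm]

theorem IsCompleteLift.unique {c d : Lift n F E} (hv : IsVerticalLift n F E (verticalLift n F E))
    (hc : A.IsCompleteLift c) (hd : A.IsCompleteLift d) : c = d := by
  have h := eq_zero_of_generators (fun k X => tot (c k X) - tot (d k X))
    (fun k X Y => by simp only [map_add, tot_add]; abel)
    (fun f => by simp only [hc.function, hd.function, sub_self])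
    (fun k f Z => by
      simp only [hc.wedge, hd.wedge, tot_add, tot_wedge rfl, hc.function, hd.function, hv.function,
        tot_constOp, smul_mul_assoc, one_mul, smul_sub]
      abel)
    (fun k s Z h => by
      simp only [hc.wedge, hd.wedge, tot_add, tot_wedge rfl, hc.sec_eq, hd.sec_eq]
      rw [sub_eq_zero.1 h, sub_self])
  funext k
  exact LinearMap.ext fun X => tot_injective (sub_eq_zero.1 (h k X))

variable (A)

theorem existsUnique_completeLift :
    (∃! c, A.IsCompleteLift c) ∧ A.IsCompleteLift A.completeLift := by
  obtain ⟨v, c, hv, -, h1, h2, h3, h4⟩ := A.exists_lifts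
  have hv' := verticalLift_spec (n := n) (F := F) (E := E)
  have hc : A.IsCompleteLift c := ⟨h1, h2, fun s μ => by
    rw [h3, derOp_apply, secC_iota], fun k l X Y => by rw [h4, hv'.unique hv]⟩
  exact ⟨⟨c, hc, fun d hd => hd.unique hv' hc⟩, Classical.epsilon_spec (p := A.IsCompleteLift) ⟨c, hc⟩⟩

end LieAlgebroid

end Uniqueness

/-! ### The Nijenhuis–Richardson bracket in low degrees, and its linearity. -/

section BracketAlgebra

namespace ListFun

variable {W : Type*} [CommRing W] [Algebra ℝ W] {A B B' : ListFun W W}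

theorem isAlt_smul_one (w : W) : IsAlt (w • (1 : ListFun W W)) := by
  rw [← tot_constOp]
  exact tot_isAlt _

theorem isHom_smul_one (w : W) : IsHom 0 (w • (1 : ListFun W W)) := by
  rw [← tot_constOp]
  exact tot_isHom _

theorem ins_smul_one_right (w : W) : ins B (w • (1 : ListFun W W)) = 0 := by
  rw [← tot_constOp, ins_tot_zero]

theorem ins_smul_one_left (w : W) (hA : IsAlt A) : ins (w • (1 : ListFun W W)) A = cur w A := by
  refine ext fun xs => ?_
  induction xs generalizing A with
  | nil =>
    rw [ins_nil, smul_apply, one_nil, smul_eq_mul, mul_one]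
    rfl
  | cons x xs ih =>
    rw [ins_cons _ hA, cur_smul, cur_one, smul_zero, ins_zero_left hA, inv_smul, inv_one,
      ih (hA.cur x), hA.cur_cur, neg_apply, zero_apply, zero_sub, neg_neg]
    rfl

theorem nr_smul_one (k : ℕ) (w : W) (hA : IsAlt A) :
    nr k 0 A (w • (1 : ListFun W W)) = -((-1 : ℝ) ^ k) • cur w A := by
  rw [nr, ins_smul_one_right, ins_smul_one_left w hA, neg_zero, zero_add, neg_one_zpow_sub,
    if_neg (by decide)]

theorem nr_add_right (k l : ℕ) (hA : IsAlt A) (B B' : ListFun W W) :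
    nr k l A (B + B') = nr k l A B + nr k l A B' := by
  simp only [nr, ins_add_right, ins_add_left _ _ hA, smul_add]
  abel

theorem nr_smul_right (k l : ℕ) (hA : IsAlt A) (r : ℝ) (B : ListFun W W) :
    nr k l A (r • B) = r • nr k l A B := by
  simp only [nr, ins_smul_right, ins_smul_left _ _ hA]
  module

theorem nr_sub_right (k l : ℕ) (hA : IsAlt A) (B B' : ListFun W W) :
    nr k l A (B - B') = nr k l A B - nr k l A B' := by
  have := nr_smul_right k l hA (-1) B'
  rw [sub_eq_add_neg, nr_add_right k l hA, sub_eq_add_neg]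
  simpa using this

theorem nr_zero_right (k l : ℕ) (hA : IsAlt A) : nr k l A 0 = 0 := by
  simpa using nr_smul_right k l hA 0 0

theorem nr_add_left (k l : ℕ) (hB : IsAlt B) (A A' : ListFun W W) :
    nr k l (A + A') B = nr k l A B + nr k l A' B := by
  simp only [nr, ins_add_right, ins_add_left _ _ hB, smul_add]
  abel

theorem nr_smul_left (k l : ℕ) (hB : IsAlt B) (r : ℝ) (A : ListFun W W) :
    nr k l (r • A) B = r • nr k l A B := by
  simp only [nr, ins_smul_right, ins_smul_left _ _ hB]
  module

theorem nr_sub_left (k l : ℕ) (hB : IsAlt B) (A A' : ListFun W W) :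
    nr k l (A - A') B = nr k l A B - nr k l A' B := by
  have := nr_smul_left k l hB (-1) A'
  rw [sub_eq_add_neg, nr_add_left k l hB, sub_eq_add_neg]
  simpa using this

theorem cur_ins_linear (hA : IsAlt A) {a b : W → W} (ha : ∀ x, cur x A = a x • 1)
    (hb : ∀ x, cur x B = b x • 1) (x : W) : cur x (ins B A) = a (b x) • 1 := by
  rw [cur_ins _ hA, hb, ins_smul_one_left _ hA, ha, ha, ins_smul_one_right, sub_zero]

/-- The bracket of two linear operators is their commutator. -/
theorem nr_linear (hA : IsAlt A) (hB : IsAlt B) (hA1 : IsHom 1 A) (hB1 : IsHom 1 B) {a b : W → W}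
    (ha : ∀ x, cur x A = a x • 1) (hb : ∀ x, cur x B = b x • 1) {C : ListFun W W} (hC : IsHom 1 C)
    (h : ∀ x, cur x C = (a (b x) - b (a x)) • 1) : nr 1 1 A B = C := by
  have hn : ∀ {A B : ListFun W W}, IsAlt A → IsHom 1 B → ins B A [] = 0 := by
    intro A B hA hB
    rw [ins_nil, hB [] (by simp)]
    exact congrFun hA.cur_zero []
  refine ext_cur ?_ fun x => ?_
  · rw [nr, add_apply, neg_apply, smul_apply, hn hA hB1, hn hB hA1, hC [] (by simp)]
    simp
  · rw [nr, cur_add, cur_neg, cur_smul, cur_ins_linear hA ha hb, cur_ins_linear hB hb ha, h, sub_smul]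
    simp [neg_add_eq_sub]

theorem nr_derOp (D D' : Derivation ℝ W W) :
    nr 1 1 (tot (derOp D)) (tot (derOp D')) = tot (derOp ⁅D, D'⁆) :=
  nr_linear (tot_isAlt _) (tot_isAlt _) (tot_isHom _) (tot_isHom _) (cur_tot_derOp D)
    (cur_tot_derOp D') (tot_isHom _) fun x => by
      rw [cur_tot_derOp, Derivation.commutator_apply]

theorem nr_derOp_smul_one (D : Derivation ℝ W W) (w : W) :
    nr 1 0 (tot (derOp D)) (w • (1 : ListFun W W)) = D w • 1 := by
  rw [nr_smul_one _ _ (tot_isAlt _), cur_tot_derOp]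
  simp

/-- Combines the even and odd commutation rules; parity is given by the arity, since homogeneous
elements are eigenvectors of `inv`. -/
theorem comm_graded {S K : Type*} [CommRing K] [Algebra ℝ K] {k l : ℕ} {f g : ListFun S K}
    (hf : IsHom k f) (hg : IsHom l g) : f * g = ((-1 : ℝ) ^ (k * l)) • (g * f) := by
  have h1 := hf.inv_eq
  have h2 := hg.inv_eq
  rcases Nat.even_or_odd k with hk | hk
  · rw [comm_of_even (by simpa [hk.neg_one_pow] using h1), (hk.mul_right l).neg_one_pow, one_smul]
  · rw [comm_of_odd (by simpa [hk.neg_one_pow] using h1), h2, pow_mul, hk.neg_one_pow]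
    rcases Nat.even_or_odd l with hl | hl <;> simp [hl.neg_one_pow]

end ListFun

end BracketAlgebra

/-! ### Multivectors are determined by their evaluations -/

section Injectivity

open ListFun CliffordAlgebra

variable {V : Type*} [AddCommGroup V] [Module ℝ V]

/-- The multivectors of degree `k`. -/
def multiVec (V : Type*) [AddCommGroup V] [Module ℝ V] (k : ℕ) : Submodule ℝ (ExteriorAlgebra ℝ V) :=
  Submodule.span ℝ (Set.range (ExteriorAlgebra.ιMulti ℝ k))

theorem ι_mul_mem {k : ℕ} (v : V) {Z : ExteriorAlgebra ℝ V} (hZ : Z ∈ multiVec V k) :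
    ExteriorAlgebra.ι ℝ v * Z ∈ multiVec V (k + 1) := by
  induction hZ using Submodule.span_induction with
  | mem Z hZ =>
    obtain ⟨s, rfl⟩ := hZ
    refine Submodule.subset_span ⟨Matrix.vecCons v s, ?_⟩
    rw [ExteriorAlgebra.ιMulti_succ_apply]
    simp
  | zero => simp
  | add Z Z' _ _ h h' => rw [mul_add]; exact add_mem h h'
  | smul r Z _ h => rw [mul_smul_comm]; exact Submodule.smul_mem _ r h

theorem contractLeft_mem {k : ℕ} (α : Dual ℝ V) {Z : ExteriorAlgebra ℝ V}
    (hZ : Z ∈ multiVec V (k + 1)) : contractLeft α Z ∈ multiVec V k := by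
  induction hZ using Submodule.span_induction with
  | mem Z hZ =>
    obtain ⟨s, rfl⟩ := hZ
    induction k with
    | zero =>
      rw [ExteriorAlgebra.ιMulti_succ_apply, ExteriorAlgebra.ιMulti_zero_apply, mul_one]
      have h := contractLeft_ι (Q := (0 : QuadraticForm ℝ V)) α (s 0)
      refine (congrArg (· ∈ multiVec V 0) h).mpr ?_
      rw [Algebra.algebraMap_eq_smul_one]
      refine Submodule.smul_mem _ _ (Submodule.subset_span ⟨fun i => i.elim0, ?_⟩)
      rw [ExteriorAlgebra.ιMulti_zero_apply]
    | succ k ih =>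
      rw [ExteriorAlgebra.ιMulti_succ_apply]
      refine (congrArg (· ∈ multiVec V (k + 1)) (contractLeft_ι_mul α (s 0) _)).mpr ?_
      exact sub_mem (Submodule.smul_mem _ _ (Submodule.subset_span ⟨_, rfl⟩)) (ι_mul_mem _ (ih _))
  | zero => simp
  | add Z Z' _ _ h h' => rw [map_add]; exact add_mem h h'
  | smul r Z _ h => rw [map_smul]; exact Submodule.smul_mem _ r h

/-- Induction on the degree: the contractions of `Z` with the `ε i` vanish by the induction
hypothesis, and the Euler identity `sum_ι_mul_contractLeft` recovers `(k + 1) • Z` from them. No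
basis of the exterior power is needed. -/
theorem eq_zero_of_ev {ι : Type*} [Fintype ι] (e : ι → V) (ε : ι → Dual ℝ V)
    (h : ∀ v, v = ∑ i, ε i v • e i) {k : ℕ} {Z : ExteriorAlgebra ℝ V} (hZ : Z ∈ multiVec V k)
    (hev : ∀ is : List ι, ev Z (is.map ε) = 0) : Z = 0 := by
  induction k generalizing Z with
  | zero =>
    have h1 : ∃ r : ℝ, Z = algebraMap ℝ _ r := by
      clear hev
      induction hZ using Submodule.span_induction with
      | mem Z hZ =>
        obtain ⟨s, rfl⟩ := hZ
        exact ⟨1, by simp [ExteriorAlgebra.ιMulti_zero_apply]⟩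
      | zero => exact ⟨0, by simp⟩
      | add Z Z' _ _ h h' =>
        obtain ⟨r, rfl⟩ := h
        obtain ⟨r', rfl⟩ := h'
        exact ⟨r + r', by rw [map_add]⟩
      | smul c Z _ h =>
        obtain ⟨r, rfl⟩ := h
        exact ⟨c * r, by rw [map_mul, Algebra.smul_def]⟩
    obtain ⟨r, rfl⟩ := h1
    have h2 := hev []
    rw [List.map_nil, ev_algebraMap, ListFun.smul_apply, one_nil, smul_eq_mul, mul_one] at h2
    rw [h2, map_zero]
  | succ k ih =>
    have h1 : ∑ i, ExteriorAlgebra.ι ℝ (e i) * contractLeft (ε i) Z = ((k + 1 : ℕ) : ℝ) • Z := by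
      clear hev
      induction hZ using Submodule.span_induction with
      | mem Z hZ =>
        obtain ⟨s, rfl⟩ := hZ
        exact sum_ι_mul_contractLeft e ε h (k + 1) s
      | zero => simp
      | add Z Z' _ _ h h' => simp only [map_add, mul_add, Finset.sum_add_distrib, h, h', smul_add]
      | smul c Z _ h =>
        simp only [map_smul, mul_smul_comm, ← Finset.smul_sum, h]
        rw [smul_comm]
    have h2 : ∀ i, contractLeft (ε i) Z = 0 := fun i =>
      ih (contractLeft_mem _ hZ) fun is => hev (i :: is)
    simp only [h2, mul_zero, Finset.sum_const_zero] at h1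
    exact (smul_eq_zero.1 h1.symm).resolve_left (by exact_mod_cast Nat.succ_ne_zero k)

end Injectivity

/-! ### Calculus of vertical and complete lifts as functions of lists. -/

section LiftCalculus

open ListFun

variable {n : ℕ} {M : Type*} [TopologicalSpace M] [ChartedSpace (EuclideanSpace ℝ (Fin n)) M]
  {F : Type*} [NormedAddCommGroup F] [NormedSpace ℝ F]
  {E : M → Type*} [TopologicalSpace (TotalSpace F E)] [∀ x, AddCommGroup (E x)]
  [∀ x, Module ℝ (E x)] [∀ x, TopologicalSpace (E x)] [FiberBundle F E] [VectorBundle ℝ F E]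

theorem multiSec_apply_mem {k : ℕ} (X : MultiSec n F E k) (p : M) : X.1 p ∈ multiVec (E p) k := by
  obtain ⟨Y, hY, h⟩ := X.2 p
  rw [h.self_of_nhds]
  clear h
  induction hY using Submodule.span_induction with
  | mem Z hZ =>
    obtain ⟨f, s, rfl⟩ := hZ
    exact Submodule.smul_mem _ _ (Submodule.subset_span ⟨_, rfl⟩)
  | zero => exact zero_mem _
  | add Z Z' _ _ h h' => exact add_mem h h'
  | smul r Z _ h => exact Submodule.smul_mem _ r h

variable [IsManifold (𝓡 n) ∞ M] [T2Space M] [FiniteDimensional ℝ F]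
  [ContMDiffVectorBundle ∞ F E (𝓡 n)]

theorem multiSec_apply_eq {k : ℕ} {X Y : MultiSec n F E k} {p : M}
    (h : ∀ v : E p, pull (dv (n := n) (⟨p, v⟩ : TotalSpace F E)) (ev (X.1 p)) =
      pull (dv (n := n) (⟨p, v⟩ : TotalSpace F E)) (ev (Y.1 p))) : X.1 p = Y.1 p := by
  obtain ⟨s, ε, -, hs⟩ := exists_coframe (n := n) (E := E) p (finBasis ℝ F)
  refine sub_eq_zero.1 (eq_zero_of_ev (fun i => s i p) (fun i => formAt (ε i) p) hs.self_of_nhds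
    (multiSec_apply_mem (X - Y) p) fun is => ?_)
  -- Fibrewise linear functions have constant fibre differentials, so testing at the zero vector is
  -- enough.
  have h1 := congrFun (h 0) (is.map fun i => iota (ε i))
  rw [pull_apply, pull_apply, List.map_map] at h1
  have h2 : (dv (⟨p, 0⟩ : TotalSpace F E)) ∘ (fun i => iota (ε i)) = fun i => formAt (ε i) p := by
    funext i
    exact dv_iota _ _
  rw [h2] at h1
  have h3 : ev (X.1 p - Y.1 p) = ev (X.1 p) + -ev (Y.1 p) := by
    rw [← ev_neg, ← ev_add, ← sub_eq_add_neg]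
  refine (congrFun h3 _).trans ?_
  rw [ListFun.add_apply, ListFun.neg_apply, h1, add_neg_cancel]

/-- The function of lists `o` is the vertical lift of the family `X` of multivectors. -/
def IsVert (X : ∀ p, ExteriorAlgebra ℝ (E p)) (o : ListFun (TotFn n F E) (TotFn n F E)) : Prop :=
  ∀ p (v : E p), push (evalPt (⟨p, v⟩ : TotalSpace F E)) o =
    pull (dv (⟨p, v⟩ : TotalSpace F E)) (ev (X p))

theorem listFun_ext_push {o o' : ListFun (TotFn n F E) (TotFn n F E)}
    (h : ∀ p (v : E p), push (evalPt (⟨p, v⟩ : TotalSpace F E)) o =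
      push (evalPt (⟨p, v⟩ : TotalSpace F E)) o') : o = o' := by
  refine ListFun.ext fun xs => ?_
  ext ⟨p, v⟩
  exact congrFun (h p v) xs

namespace IsVert

variable {X Y : ∀ p, ExteriorAlgebra ℝ (E p)} {o o' : ListFun (TotFn n F E) (TotFn n F E)}

theorem unique (h : IsVert X o) (h' : IsVert X o') : o = o' :=
  listFun_ext_push fun p v => by rw [h p v, h' p v]

theorem add (h : IsVert X o) (h' : IsVert Y o') : IsVert (X + Y) (o + o') := fun p v => by
  rw [push_add, h p v, h' p v, Pi.add_apply, ev_add, pull_add]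

theorem smul (r : ℝ) (h : IsVert X o) : IsVert (r • X) (r • o) := fun p v => by
  rw [LieAlgebroid.push_real_smul, h p v, Pi.smul_apply, ev_smul, pull_smul]

theorem neg (h : IsVert X o) : IsVert (-X) (-o) := by
  simpa using h.smul (-1)

theorem sub (h : IsVert X o) (h' : IsVert Y o') : IsVert (X - Y) (o - o') := by
  simpa only [sub_eq_add_neg] using h.add h'.neg

theorem mul (h : IsVert X o) (h' : IsVert Y o') : IsVert (fun p => X p * Y p) (o * o') :=
  fun p v => by rw [push_mul, h p v, h' p v, ev_mul, pull_mul]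

theorem contract (h : IsVert X o) (Φ : OneForm n F E) :
    IsVert (contractRaw Φ X) (cur (iota Φ) o) := fun p v => by
  rw [← cur_push, h p v, cur_pull, cur_ev, dv_iota]
  rfl

theorem inj {k : ℕ} {X Y : MultiSec n F E k} (h : IsVert X.1 o) (h' : IsVert Y.1 o) : X = Y :=
  Subtype.ext (funext fun p => multiSec_apply_eq fun v => by rw [← h p v, ← h' p v])

end IsVert

/-- The vertical lift as a function of lists. -/
def vl {k : ℕ} (X : MultiSec n F E k) : ListFun (TotFn n F E) (TotFn n F E) :=
  tot (verticalLift n F E k X)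

variable {k l : ℕ} (X Y : MultiSec n F E k) (Z : MultiSec n F E l)

theorem isVert_vl : IsVert X.1 (vl X) := fun p v => vertAt_verticalLift X p v

variable {X} in
theorem _root_.JacobiAlgebroid.IsVert.eq_vl {o : ListFun (TotFn n F E) (TotFn n F E)}
    (h : IsVert X.1 o) : vl X = o := (isVert_vl X).unique h

variable {X Y} in
theorem vl_injective (h : vl X = vl Y) : X = Y := (isVert_vl X).inj (h ▸ isVert_vl Y)

theorem vl_isAlt : IsAlt (vl X) := tot_isAlt _
theorem vl_isHom : IsHom k (vl X) := tot_isHom _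
theorem vl_isDer : IsDer (vl X) := (isMultiDerivation_iff _).1 (verticalLift_spec.multiDerivation k X)
theorem vl_add : vl (X + Y) = vl X + vl Y := by rw [vl, map_add, tot_add]; rfl
theorem vl_smul (r : ℝ) : vl (r • X) = r • vl X := by rw [vl, map_smul, tot_smul_real]; rfl
theorem vl_zero : vl (0 : MultiSec n F E k) = 0 := by rw [vl, map_zero, tot_zero]
theorem vl_fn (f : Fn n M) : vl (ofFn f : MultiSec n F E 0) = pullback n F E f • 1 := by
  rw [vl, verticalLift_spec.function, tot_constOp]
theorem vl_sec (s : Sec n F E) : vl (ofSec s) = tot (derOp (secV s)) := by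
  rw [vl, verticalLift_spec.sec_eq]
theorem vl_mul : vl (mulSec X Z) = vl X * vl Z := by
  rw [vl, verticalLift_spec.wedge, tot_wedge rfl]; rfl
-- The fibre differential of `iota Φ` is `Φ` itself.
theorem vl_contract (Φ : OneForm n F E) : vl (contract Φ X) = cur (iota Φ) (vl X) :=
  ((isVert_vl X).contract Φ).eq_vl

namespace LieAlgebroid

variable (A : LieAlgebroid n F E)

/-- The complete lift as a function of lists. -/
def cl {k : ℕ} (X : MultiSec n F E k) : ListFun (TotFn n F E) (TotFn n F E) :=
  tot (A.completeLift k X)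

theorem completeLift_spec : A.IsCompleteLift A.completeLift := A.existsUnique_completeLift.2

theorem cl_isAlt : IsAlt (A.cl X) := tot_isAlt _
theorem cl_isHom : IsHom k (A.cl X) := tot_isHom _
theorem cl_isDer : IsDer (A.cl X) :=
  (isMultiDerivation_iff _).1 (A.completeLift_spec.multiDerivation k X)
theorem cl_add : A.cl (X + Y) = A.cl X + A.cl Y := by rw [cl, map_add, tot_add]; rfl
theorem cl_smul (r : ℝ) : A.cl (r • X) = r • A.cl X := by rw [cl, map_smul, tot_smul_real]; rfl
theorem cl_zero : A.cl (0 : MultiSec n F E k) = 0 := by rw [cl, map_zero, tot_zero]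
theorem cl_fn (f : Fn n M) : A.cl (ofFn f : MultiSec n F E 0) = iota (A.dFun 0 f) • 1 := by
  rw [cl, A.completeLift_spec.function, tot_constOp]
theorem cl_sec (s : Sec n F E) : A.cl (ofSec s) = tot (derOp (A.secC s)) := by
  rw [cl, A.completeLift_spec.sec_eq]
theorem cl_mul : A.cl (mulSec X Z) = A.cl X * vl Z + vl X * A.cl Z := by
  rw [cl, A.completeLift_spec.wedge, tot_add, tot_wedge rfl, tot_wedge rfl]; rfl

variable {X} in
theorem cl_congr {X : MultiSec n F E k} {Z : MultiSec n F E l} (h : k = l) (h' : X.1 = Z.1) :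
    A.cl X = A.cl Z := by
  subst h
  rw [Subtype.ext h']

end LieAlgebroid

end LiftCalculus

/-! ### The Schouten–Nijenhuis bracket -/

section SchoutenNijenhuis

open ListFun

variable {n : ℕ} {M : Type*} [TopologicalSpace M] [ChartedSpace (EuclideanSpace ℝ (Fin n)) M]
  {F : Type*} [NormedAddCommGroup F] [NormedSpace ℝ F]
  {E : M → Type*} [TopologicalSpace (TotalSpace F E)] [∀ x, AddCommGroup (E x)]
  [∀ x, Module ℝ (E x)] [∀ x, TopologicalSpace (E x)] [FiberBundle F E] [VectorBundle ℝ F E]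
  [IsManifold (𝓡 n) ∞ M] [T2Space M] [FiniteDimensional ℝ F] [ContMDiffVectorBundle ∞ F E (𝓡 n)]

/-- The Leibniz rule for the bracket of a multiderivation with a product. -/
theorem ListFun.nr_mul_of_isDer {W : Type*} [CommRing W] [Algebra ℝ W] {k l m : ℕ}
    {A B C : ListFun W W} (hA : IsAlt A) (hF : IsDer A) (hB : IsAlt B)
    (hC : IsAlt C) (hk : IsHom k A) (hl : IsHom l B) (hm : IsHom m C) :
    nr k (l + m) A (B * C) = nr k l A B * C +
      ((-1 : ℝ) ^ (((k : ℤ) - 1) * l)) • (B * nr k m A C) := by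
  rw [nr_mul hA hF.isFirst hB hC hk hl hm, hF.cur_one, zero_mul, zero_mul, smul_zero, add_zero]

/-- A biadditive map on pairs of multisections, linear over the functions, vanishes if it vanishes
on generators and if its kernel is symmetric and stable under products with sections. -/
theorem eq_zero_of_generators₂
    (T : ∀ k l, MultiSec n F E k → MultiSec n F E l → ListFun (TotFn n F E) (TotFn n F E))
    (hadd : ∀ k l X Y Z, T k l X (Y + Z) = T k l X Y + T k l X Z)
    (hsymm : ∀ k l X Y, T k l X Y = 0 → T l k Y X = 0)
    (hff : ∀ f g, T 0 0 (ofFn f) (ofFn g) = 0) (hsf : ∀ s f, T 1 0 (ofSec s) (ofFn f) = 0)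
    (hss : ∀ s t, T 1 1 (ofSec s) (ofSec t) = 0)
    (hmulFn : ∀ k l X f Z, (∀ f, T k 0 X (ofFn f) = 0) →
      T k (0 + l) X (mulSec (ofFn f) Z) = pullback n F E f • T k l X Z)
    (hmulSec : ∀ k l X s Z, T k 1 X (ofSec s) = 0 → T k l X Z = 0 →
      T k (1 + l) X (mulSec (ofSec s) Z) = 0) :
    ∀ k l X Y, T k l X Y = 0 :=
  multiSec_induction₂ (fun k l X Y => T k l X Y = 0) hsymm hff hsf hss fun k X h0 h1 =>
    eq_zero_of_generators (fun l Y => T k l X Y) (fun l => hadd k l X) h0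
      (fun l f Z => hmulFn k l X f Z h0) (fun l s Z h => hmulSec k l X s Z (h1 s) h)

theorem zpow_mul_zero (k : ℕ) : (-1 : ℝ) ^ (((k : ℤ) - 1) * ((0 : ℕ) : ℤ)) = 1 := by simp

/-- On generators: vertical vector fields kill pullbacks and send fibrewise linear functions to
pullbacks, so they commute. The Leibniz rule spreads this to all degrees. -/
theorem nr_vl_vl : ∀ (k l : ℕ) (X : MultiSec n F E k) (Y : MultiSec n F E l),
    nr k l (vl X) (vl Y) = 0 :=
  eq_zero_of_generators₂ (fun k l X Y => nr k l (vl X) (vl Y))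
    (fun k l X Y Z => by rw [vl_add, nr_add_right _ _ (vl_isAlt X)])
    (fun k l X Y h => by simp only [nr_skew l k (vl Y), h, smul_zero])
    (fun f g => by simp only [vl_fn, nr_smul_one _ _ (isAlt_smul_one _), cur_smul, cur_one, smul_zero])
    (fun s f => by simp only [vl_sec, vl_fn, nr_derOp_smul_one, secV_pullback, zero_smul])
    (fun s t => by
      simp only [vl_sec, nr_derOp]
      have : ⁅(secV s : Derivation ℝ (TotFn n F E) (TotFn n F E)), secV t⁆ = 0 :=
        derivation_ext (fun f => by simp [Derivation.commutator_apply, secV_pullback])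
          (fun μ => by simp [Derivation.commutator_apply, secV_pullback, secV_iota])
      rw [this]
      refine ext_cur (tot_isHom _ _ (by simp)) fun x => ?_
      rw [cur_tot_derOp, Derivation.zero_apply, zero_smul, cur_zero])
    (fun k l X f Z h => by
      rw [vl_mul, nr_mul_of_isDer (vl_isAlt X) (vl_isDer X) (vl_isAlt _) (vl_isAlt Z) (vl_isHom X)
        (vl_isHom _) (vl_isHom Z), h, zero_mul, zero_add, zpow_mul_zero, one_smul, vl_fn,
        smul_mul_assoc, one_mul])
    (fun k l X s Z h h' => by
      rw [vl_mul, nr_mul_of_isDer (vl_isAlt X) (vl_isDer X) (vl_isAlt _) (vl_isAlt Z) (vl_isHom X)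
        (vl_isHom _) (vl_isHom Z), h, h', zero_mul, mul_zero, zero_add, smul_zero])

namespace LieAlgebroid

variable (A : LieAlgebroid n F E)

theorem dFun_zero_apply (f : Fn n M) (s : Sec n F E) : A.dFun 0 f s = A.anchor s f := by
  simp [dFun, act]

theorem commutator_secC_secV (s t : Sec n F E) : ⁅A.secC s, secV t⁆ = secV (A.bracket s t) := by
  refine derivation_ext (fun f => ?_) (fun μ => ?_)
  · rw [Derivation.commutator_apply, secV_pullback, secC_pullback, secV_pullback, secV_pullback,
      map_zero, sub_zero]
  · rw [Derivation.commutator_apply, secV_iota, secC_iota, secV_iota, secC_pullback, secV_iota,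
      ← pullback_sub, lieDer_zero_apply, sub_sub_cancel]

theorem secV_neg (s : Sec n F E) : (secV (-s) : Derivation ℝ (TotFn n F E) (TotFn n F E)) = -secV s :=
  derivation_ext (fun f => by simp [secV_pullback]) (fun μ => by
    rw [Derivation.neg_apply, secV_iota, secV_iota, map_neg]
    rfl)

/-- This symmetry makes the bracket defined by [X^c, Y^v] graded skew. The difference of the two
sides is a derivation in `Y` because the brackets of vertical lifts in the expansion vanish. -/
theorem nr_cl_vl : ∀ (k l : ℕ) (X : MultiSec n F E k) (Y : MultiSec n F E l),
    nr k l (A.cl X) (vl Y) = nr k l (vl X) (A.cl Y) := by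
  have key := eq_zero_of_generators₂ (fun k l (X : MultiSec n F E k) (Y : MultiSec n F E l) =>
      nr k l (A.cl X) (vl Y) - nr k l (vl X) (A.cl Y))
    (fun k l X Y Z => by
      simp only [vl_add, cl_add, nr_add_right _ _ (vl_isAlt X), nr_add_right _ _ (A.cl_isAlt X)]
      abel)
    (fun k l X Y h => by
      rw [nr_skew l k (A.cl Y), nr_skew l k (vl Y), sub_eq_zero.1 h, sub_self])
    (fun f g => by
      simp only [vl_fn, cl_fn, nr_smul_one _ _ (isAlt_smul_one _), cur_smul, cur_one, smul_zero,
        sub_zero])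
    (fun s f => by
      simp only [vl_sec, vl_fn, cl_sec, cl_fn, nr_derOp_smul_one, secV_iota, secC_pullback,
        dFun_zero_apply, sub_self])
    (fun s t => by
      simp only [vl_sec, cl_sec, nr_derOp]
      rw [commutator_secC_secV, ← lie_skew, commutator_secC_secV, A.bracket_skew s t, secV_neg,
        sub_self])
    (fun k l X f Z h => by
      have h := sub_eq_zero.1 (h f)
      rw [vl_mul, cl_mul, nr_add_right _ _ (vl_isAlt X),
        nr_mul_of_isDer (vl_isAlt X) (vl_isDer X) (A.cl_isAlt _) (vl_isAlt Z) (vl_isHom X)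
          (A.cl_isHom _) (vl_isHom Z),
        nr_mul_of_isDer (vl_isAlt X) (vl_isDer X) (vl_isAlt _) (A.cl_isAlt Z) (vl_isHom X)
          (vl_isHom _) (A.cl_isHom Z),
        nr_mul_of_isDer (A.cl_isAlt X) (A.cl_isDer X) (vl_isAlt _) (vl_isAlt Z) (A.cl_isHom X)
          (vl_isHom _) (vl_isHom Z), nr_vl_vl, nr_vl_vl, h, mul_zero, zero_mul, zpow_mul_zero,
        one_smul, one_smul, one_smul, add_zero, zero_add, vl_fn, smul_mul_assoc, smul_mul_assoc,
        one_mul, one_mul, smul_sub]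
      abel)
    (fun k l X s Z h h' => by
      rw [vl_mul, cl_mul, nr_add_right _ _ (vl_isAlt X),
        nr_mul_of_isDer (vl_isAlt X) (vl_isDer X) (A.cl_isAlt _) (vl_isAlt Z) (vl_isHom X)
          (A.cl_isHom _) (vl_isHom Z),
        nr_mul_of_isDer (vl_isAlt X) (vl_isDer X) (vl_isAlt _) (A.cl_isAlt Z) (vl_isHom X)
          (vl_isHom _) (A.cl_isHom Z),
        nr_mul_of_isDer (A.cl_isAlt X) (A.cl_isDer X) (vl_isAlt _) (vl_isAlt Z) (A.cl_isHom X)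
          (vl_isHom _) (vl_isHom Z), nr_vl_vl, nr_vl_vl, sub_eq_zero.1 h, sub_eq_zero.1 h']
      simp)
  exact fun k l X Y => sub_eq_zero.1 (key k l X Y)

theorem nr_cl_vl_skew {k l : ℕ} (X : MultiSec n F E k) (Y : MultiSec n F E l) :
    nr k l (A.cl X) (vl Y) =
      -((-1 : ℝ) ^ (((k : ℤ) - 1) * ((l : ℤ) - 1))) • nr l k (A.cl Y) (vl X) := by
  rw [nr_cl_vl, nr_skew]

theorem nr_cl_vl_mul {k l m : ℕ} (X : MultiSec n F E k) (Y : MultiSec n F E l)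
    (Z : MultiSec n F E m) :
    nr k (l + m) (A.cl X) (vl (mulSec Y Z)) = nr k l (A.cl X) (vl Y) * vl Z +
      ((-1 : ℝ) ^ (((k : ℤ) - 1) * l)) • (vl Y * nr k m (A.cl X) (vl Z)) := by
  rw [vl_mul, nr_mul_of_isDer (A.cl_isAlt X) (A.cl_isDer X) (vl_isAlt _) (vl_isAlt Z) (A.cl_isHom X)
          (vl_isHom _) (vl_isHom Z)]

/-- For a bump function ψ the Leibniz rule gives [X, ψY] = [X, ψ] ∧ Y + ψ [X, Y]. The left side and
the first term on the right coincide over `p` for `Y` and `Y'`, hence so does the last. -/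
theorem nr_cl_vl_congr {k l : ℕ} (X : MultiSec n F E k) {Y Y' : MultiSec n F E l} {p : M}
    (h : ∀ᶠ q in 𝓝 p, Y.1 q = Y'.1 q) (v : E p) :
    push (evalPt (⟨p, v⟩ : TotalSpace F E)) (nr k l (A.cl X) (vl Y)) =
      push (evalPt (⟨p, v⟩ : TotalSpace F E)) (nr k l (A.cl X) (vl Y')) := by
  obtain ⟨ψ, hψ1, hψ⟩ := exists_bump_mulSec_eq h
  have h1 : ∀ Y : MultiSec n F E l, push (evalPt (⟨p, v⟩ : TotalSpace F E))
      (nr k (0 + l) (A.cl X) (vl (mulSec (ofFn ψ) Y))) =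
      push (evalPt (⟨p, v⟩ : TotalSpace F E)) (nr k 0 (A.cl X) (vl (ofFn ψ : MultiSec n F E 0))) *
        push (evalPt (⟨p, v⟩ : TotalSpace F E)) (vl Y) +
      push (evalPt (⟨p, v⟩ : TotalSpace F E)) (nr k l (A.cl X) (vl Y)) := by
    intro Y
    rw [nr_cl_vl_mul, zpow_mul_zero, one_smul, push_add, push_mul, push_mul,
      vl_fn, push_smul_one]
    change _ + ψ p • (1 : ListFun (TotFn n F E) ℝ) * _ = _
    rw [hψ1, one_smul, one_mul]
  have h2 : push (evalPt (⟨p, v⟩ : TotalSpace F E)) (vl Y) =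
      push (evalPt (⟨p, v⟩ : TotalSpace F E)) (vl Y') := by
    rw [isVert_vl Y p v, isVert_vl Y' p v, h.self_of_nhds]
  have h3 := h1 Y
  rw [hψ, h1 Y', h2] at h3
  exact (add_left_cancel h3).symm

theorem mem_of_eq {a b : ℕ} (h : a = b) {X : ∀ p, ExteriorAlgebra ℝ (E p)}
    (hX : X ∈ MultiSec n F E a) : X ∈ MultiSec n F E b := h ▸ hX

/-- The product of multisections of degrees `a` and `b` has degree `a + b`, or any degree if one of
them is zero. -/
theorem mul_mem_of {a b c : ℕ} (X : MultiSec n F E a) (Y : MultiSec n F E b)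
    (h : a + b = c ∨ X = 0 ∨ Y = 0) : (fun p => X.1 p * Y.1 p) ∈ MultiSec n F E c := by
  rcases h with h | rfl | rfl
  · exact mem_of_eq h (mulSec X Y).2
  · convert zero_mem (MultiSec n F E c) using 1
    funext p
    exact zero_mul _
  · convert zero_mem (MultiSec n F E c) using 1
    funext p
    exact mul_zero _

/-- Every multisection has a bracket with every other one. -/
theorem exists_bracket : ∀ (k l : ℕ) (X : MultiSec n F E k) (Y : MultiSec n F E l),
    ∃ B : MultiSec n F E (k + l - 1), (k + l = 0 → B = 0) ∧ vl B = nr k l (A.cl X) (vl Y) := by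
  -- The clause for `k + l = 0` repairs truncated subtraction: a bracket of two functions has formal
  -- degree 0 instead of -2, and unless it is zero its products in the Leibniz rule would have the
  -- wrong degree.
  refine multiSec_induction₂ (fun k l X Y =>
    ∃ B : MultiSec n F E (k + l - 1), (k + l = 0 → B = 0) ∧ vl B = nr k l (A.cl X) (vl Y))
    ?_ ?_ ?_ ?_ ?_
  · rintro k l X Y ⟨B, h0, hB⟩
    have hm : (-((-1 : ℝ) ^ (((l : ℤ) - 1) * ((k : ℤ) - 1)))) • B.1 ∈ MultiSec n F E (l + k - 1) :=
      mem_of_eq (by omega) (Submodule.smul_mem _ _ B.2)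
    refine ⟨⟨_, hm⟩, fun h => Subtype.ext ?_, ?_⟩
    · change (-((-1 : ℝ) ^ (((l : ℤ) - 1) * ((k : ℤ) - 1)))) • B.1 = 0
      rw [h0 (by omega)]
      exact smul_zero _
    · rw [nr_cl_vl_skew, ← hB]
      exact IsVert.eq_vl ((isVert_vl B).smul _)
  · intro f g
    refine ⟨0, fun _ => rfl, ?_⟩
    rw [vl_zero, vl_fn, cl_fn, nr_smul_one _ _ (isAlt_smul_one _), cur_smul, cur_one, smul_zero,
      smul_zero]
  · intro s f
    refine ⟨ofFn (A.anchor s f), fun h => by omega, ?_⟩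
    rw [vl_fn (n := n), vl_fn, cl_sec, nr_derOp_smul_one, secC_pullback]
  · intro s t
    refine ⟨ofSec (A.bracket s t), fun h => by omega, ?_⟩
    rw [vl_sec, vl_sec, cl_sec, nr_derOp, commutator_secC_secV]
  intro k X hf hs
  have hmul : ∀ (l m : ℕ) (Y : MultiSec n F E l) (Z : MultiSec n F E m),
      (∃ B : MultiSec n F E (k + l - 1), (k + l = 0 → B = 0) ∧ vl B = nr k l (A.cl X) (vl Y)) →
      (∃ B : MultiSec n F E (k + m - 1), (k + m = 0 → B = 0) ∧ vl B = nr k m (A.cl X) (vl Z)) →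
      ∃ B : MultiSec n F E (k + (l + m) - 1), (k + (l + m) = 0 → B = 0) ∧
        vl B = nr k (l + m) (A.cl X) (vl (mulSec Y Z)) := by
    rintro l m Y Z ⟨B, h0, hB⟩ ⟨B', h0', hB'⟩
    have h1 : (fun p => B.1 p * Z.1 p) ∈ MultiSec n F E (k + (l + m) - 1) :=
      mul_mem_of B Z (by by_cases hkl : k + l = 0; exacts [Or.inr (Or.inl (h0 hkl)), by omega])
    have h2 : (fun p => Y.1 p * B'.1 p) ∈ MultiSec n F E (k + (l + m) - 1) :=
      mul_mem_of Y B' (by by_cases hkm : k + m = 0; exacts [Or.inr (Or.inr (h0' hkm)), by omega])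
    refine ⟨⟨_, h1⟩ + ((-1 : ℝ) ^ (((k : ℤ) - 1) * l)) • ⟨_, h2⟩, fun h => ?_, ?_⟩
    · refine Subtype.ext (funext fun p => ?_)
      change B.1 p * Z.1 p + ((-1 : ℝ) ^ (((k : ℤ) - 1) * l)) • (Y.1 p * B'.1 p) = 0
      rw [h0 (by omega), h0' (by omega)]
      change 0 * Z.1 p + ((-1 : ℝ) ^ (((k : ℤ) - 1) * l)) • (Y.1 p * 0) = (0 : ExteriorAlgebra ℝ (E p))
      rw [zero_mul, mul_zero, smul_zero, add_zero]
    · rw [nr_cl_vl_mul, ← hB, ← hB']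
      exact IsVert.eq_vl (((isVert_vl B).mul (isVert_vl Z)).add
        (((isVert_vl Y).mul (isVert_vl B')).smul _))
  refine multiSec_induction _ ?_ hf (fun l f Z h => hmul 0 l _ Z (hf f) h)
    (fun l s Z h => hmul 1 l _ Z (hs s) h) ?_
  · rintro l Y Y' ⟨B, h0, hB⟩ ⟨B', h0', hB'⟩
    refine ⟨B + B', fun h => by rw [h0 h, h0' h, add_zero], ?_⟩
    rw [vl_add, vl_add, nr_add_right _ _ (A.cl_isAlt X), hB, hB']
  · intro l Y h
    choose Y' hY B h0 hB using h
    -- The evaluations of the local brackets are prescribed by `Y` alone, so by injectivity of the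
    -- vertical lift the local brackets agree where they overlap and glue.
    have hval : ∀ p₀ p, (∀ᶠ q in 𝓝 p, Y.1 q = (Y' p₀).1 q) → ∀ v : E p,
        pull (dv (⟨p, v⟩ : TotalSpace F E)) (ev ((B p₀).1 p)) =
          push (evalPt (⟨p, v⟩ : TotalSpace F E)) (nr k l (A.cl X) (vl Y)) := by
      intro p₀ p hp v
      rw [A.nr_cl_vl_congr X hp v, ← hB p₀, isVert_vl (B p₀) p v]
    have hloc : ∀ p₀, ∀ᶠ p in 𝓝 p₀, (B p).1 p = (B p₀).1 p := by
      intro p₀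
      filter_upwards [(hY p₀).eventually_nhds] with p hp
      exact multiSec_apply_eq fun v => by rw [hval p p (hY p), hval p₀ p hp]
    have hm : (fun p => (B p).1 p) ∈ MultiSec n F E (k + l - 1) := by
      intro p₀
      obtain ⟨C, hC, h⟩ := (B p₀).2 p₀
      refine ⟨C, hC, ?_⟩
      filter_upwards [h, hloc p₀] with p h1 h2
      rw [h2, h1]
    refine ⟨⟨_, hm⟩, fun h => Subtype.ext (funext fun p => ?_), IsVert.eq_vl fun p v => ?_⟩
    · change (B p).1 p = 0
      rw [h0 p h]
      rfl
    · exact (hval p p (hY p) v).symm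

/-- The vertical lift of the Schouten–Nijenhuis bracket. -/
theorem exists_schoutenNijenhuis :
    ∃ B : ∀ k l : ℕ, MultiSec n F E k →ₗ[ℝ] MultiSec n F E l →ₗ[ℝ] MultiSec n F E (k + l - 1),
      A.IsSchoutenNijenhuis B ∧ ∀ k l X Y, vl (B k l X Y) = nr k l (A.cl X) (vl Y) := by
  choose B h0 hB using A.exists_bracket
  refine ⟨fun k l => LinearMap.mk₂ ℝ (B k l) (fun X X' Y => vl_injective ?_)
    (fun r X Y => vl_injective ?_) (fun X Y Y' => vl_injective ?_)
    (fun r X Y => vl_injective ?_), ⟨?_, ?_, ?_, ?_, ?_⟩, fun k l X Y => hB k l X Y⟩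
  · rw [vl_add, hB, hB, hB, cl_add, nr_add_left _ _ (vl_isAlt Y)]
  · rw [vl_smul, hB, hB, cl_smul, nr_smul_left _ _ (vl_isAlt Y)]
  · rw [vl_add, hB, hB, hB, vl_add, nr_add_right _ _ (A.cl_isAlt X)]
  · rw [vl_smul, hB, hB, vl_smul, nr_smul_right _ _ (A.cl_isAlt X)]
  · exact LinearMap.ext fun X => LinearMap.ext fun Y => h0 0 0 X Y rfl
  · intro s f
    refine vl_injective ((hB 1 0 (ofSec s) (ofFn f)).trans ?_)
    rw [vl_fn (n := n), vl_fn, cl_sec, nr_derOp_smul_one, secC_pullback]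
  · intro s t
    refine vl_injective ((hB 1 1 (ofSec s) (ofSec t)).trans ?_)
    rw [vl_sec, vl_sec, cl_sec, nr_derOp, commutator_secC_secV]
  · intro k l X Y
    -- The other side has degree `l + k - 1`; it is repackaged in degree `k + l - 1` so that
    -- vertical lifts can be compared.
    have h1 : (-((-1 : ℝ) ^ (((k : ℤ) - 1) * ((l : ℤ) - 1)))) • (B l k Y X).1 ∈
        MultiSec n F E (k + l - 1) := mem_of_eq (by omega) (Submodule.smul_mem _ _ (B l k Y X).2)
    refine congrArg Subtype.val (a₁ := B k l X Y) (a₂ := ⟨_, h1⟩) (vl_injective ?_)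
    rw [hB, nr_cl_vl_skew, ← hB]
    exact (IsVert.eq_vl ((isVert_vl _).smul _)).symm
  · intro k l m X Y Z
    have h1 : IsVert (fun p => (B k l X Y).1 p * Z.1 p +
        ((-1 : ℝ) ^ (((k : ℤ) - 1) * l)) • (Y.1 p * (B k m X Z).1 p))
        (nr k (l + m) (A.cl X) (vl (mulSec Y Z))) := by
      rw [nr_cl_vl_mul, ← hB, ← hB]
      exact ((isVert_vl _).mul (isVert_vl Z)).add (((isVert_vl Y).mul (isVert_vl _)).smul _)
    have h2 : (fun p => (B k l X Y).1 p * Z.1 p +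
        ((-1 : ℝ) ^ (((k : ℤ) - 1) * l)) • (Y.1 p * (B k m X Z).1 p)) ∈
        MultiSec n F E (k + (l + m) - 1) := by
      refine add_mem (S := Submodule ℝ (∀ p, ExteriorAlgebra ℝ (E p)))
        (a := fun p => (B k l X Y).1 p * Z.1 p)
        (b := fun p => ((-1 : ℝ) ^ (((k : ℤ) - 1) * l)) • (Y.1 p * (B k m X Z).1 p)) ?_
        (Submodule.smul_mem _ _ (x := fun p => Y.1 p * (B k m X Z).1 p) ?_)
      · exact mul_mem_of _ _
          (by by_cases hkl : k + l = 0; exacts [Or.inr (Or.inl (h0 k l X Y hkl)), by omega])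
      · exact mul_mem_of _ _
          (by by_cases hkm : k + m = 0; exacts [Or.inr (Or.inr (h0 k m X Z hkm)), by omega])
    refine congrArg Subtype.val (a₁ := B k (l + m) X (mulSec Y Z)) (a₂ := ⟨_, h2⟩)
      (vl_injective ?_)
    rw [hB]
    exact (IsVert.eq_vl h1).symm

variable {A} in
theorem IsSchoutenNijenhuis.vl_mul {B : ∀ k l : ℕ, MultiSec n F E k →ₗ[ℝ]
    MultiSec n F E l →ₗ[ℝ] MultiSec n F E (k + l - 1)} (hB : A.IsSchoutenNijenhuis B) {k l m : ℕ}
    (X : MultiSec n F E k) (Y : MultiSec n F E l) (Z : MultiSec n F E m) :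
    vl (B k (l + m) X (mulSec Y Z)) = vl (B k l X Y) * vl Z +
      ((-1 : ℝ) ^ (((k : ℤ) - 1) * l)) • (vl Y * vl (B k m X Z)) := by
  refine IsVert.eq_vl ?_
  rw [hB.leibniz]
  exact ((isVert_vl _).mul (isVert_vl Z)).add (((isVert_vl Y).mul (isVert_vl _)).smul _)

variable {A} in
theorem IsSchoutenNijenhuis.unique {B C : ∀ k l : ℕ, MultiSec n F E k →ₗ[ℝ]
    MultiSec n F E l →ₗ[ℝ] MultiSec n F E (k + l - 1)} (hB : A.IsSchoutenNijenhuis B)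
    (hC : A.IsSchoutenNijenhuis C) : B = C := by
  have key := eq_zero_of_generators₂ (fun k l X Y => vl (B k l X Y) - vl (C k l X Y))
    (fun k l X Y Z => by simp only [map_add, vl_add]; abel)
    (fun k l X Y h => by
      have h1 := vl_injective (sub_eq_zero.1 h)
      have h2 : (B l k Y X).1 = (C l k Y X).1 := by rw [hB.skew, hC.skew, h1]
      simp only [Subtype.ext h2, sub_self])
    (fun f g => by simp only [hB.fun_fun, hC.fun_fun, sub_self])
    (fun s f => by simp only [hB.sec_fun, hC.sec_fun, sub_self])
    (fun s t => by simp only [hB.sec_sec, hC.sec_sec, sub_self])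
    (fun k l X f Z h => by
      simp only [hB.vl_mul, hC.vl_mul, sub_eq_zero.1 (h f), zpow_mul_zero, one_smul, vl_fn,
        smul_mul_assoc, one_mul, smul_sub]
      abel)
    (fun k l X s Z h h' => by
      simp only [hB.vl_mul, hC.vl_mul, sub_eq_zero.1 h, sub_eq_zero.1 h', sub_self])
  funext k l
  exact LinearMap.ext fun X => LinearMap.ext fun Y => vl_injective (sub_eq_zero.1 (key k l X Y))

theorem existsUnique_schoutenNijenhuis :
    (∃! B, A.IsSchoutenNijenhuis B) ∧ A.IsSchoutenNijenhuis A.schoutenNijenhuis := by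
  obtain ⟨B, hB, -⟩ := A.exists_schoutenNijenhuis
  exact ⟨⟨B, hB, fun C hC => hC.unique hB⟩,
    Classical.epsilon_spec (p := A.IsSchoutenNijenhuis) ⟨B, hB⟩⟩

/-- By uniqueness the chosen bracket is the constructed one. In this form, rather than through its
axioms, the bracket enters all later computations. -/
theorem vl_schoutenNijenhuis {k l : ℕ} (X : MultiSec n F E k) (Y : MultiSec n F E l) :
    vl (A.schoutenNijenhuis k l X Y) = nr k l (A.cl X) (vl Y) := by
  obtain ⟨B, hB, h⟩ := A.exists_schoutenNijenhuis
  rw [(A.existsUnique_schoutenNijenhuis.2).unique hB]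
  exact h k l X Y

end LieAlgebroid

end SchoutenNijenhuis

/-! ### The Jacobi lift -/

section IdentityOperator

namespace ListFun

variable {W : Type*} [CommRing W] [Algebra ℝ W] {A : ListFun W W}

instance : IsScalarTower ℝ W (ListFun W W) :=
  ⟨fun r w f => ext fun xs => smul_assoc r w (f xs)⟩

theorem inv_tot_idOp : inv (tot (idOp : AltOp W 1)) = -tot idOp := by
  simpa using (tot_isHom (idOp : AltOp W 1)).inv_eq

theorem ins_idOp_right (B : ListFun W W) : ins B (tot idOp) = B := by
  refine ext fun xs => ?_
  induction xs generalizing B with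
  | nil => rw [ins_nil, tot_idOp_apply]
  | cons x xs ih =>
    rw [ins_cons _ (tot_isAlt _), cur_tot_idOp, ins_smul_one_right, ih, zero_apply, sub_zero]
    rfl

/-- Each of the `k` slots of `A` contributes one copy. Together with `ins_idOp_right` this makes the
bracket with the identity count degrees. -/
theorem ins_idOp_left {k : ℕ} (hA : IsAlt A) (hk : IsHom k A) :
    ins (tot idOp) A = (k : ℝ) • A := by
  have h : ∀ (xs : List W) (A : ListFun W W), IsAlt A →
      ins (tot idOp) A xs = (xs.length : ℝ) • A xs := by
    intro xs
    induction xs with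
    | nil =>
      intro A hA
      rw [ins_nil, tot_isHom _ _ (by simp)]
      have := congrFun hA.cur_zero []
      rw [cur_apply] at this
      rw [this]
      simp
    | cons x xs ih =>
      intro A hA
      rw [ins_cons _ hA, cur_tot_idOp, ins_smul_one_left x hA, inv_tot_idOp,
        ins_neg_left _ (hA.cur x), neg_apply, ih _ (hA.cur x), List.length_cons]
      push_cast
      rw [add_smul, one_smul, cur_apply]
      ring
  refine ext fun xs => ?_
  rw [h xs A hA, smul_apply]
  by_cases hx : xs.length = k
  · rw [hx]
  · rw [hk xs hx, smul_zero, smul_zero]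

theorem nr_idOp {k : ℕ} (hA : IsAlt A) (hk : IsHom k A) :
    nr k 1 A (tot idOp) = ((k : ℝ) - 1) • A := by
  rw [nr, ins_idOp_right, ins_idOp_left hA hk]
  simp only [Nat.cast_one, sub_self, mul_zero, zpow_zero, one_smul]
  module

theorem IsAlt.cur_self (hA : IsAlt A) (x : W) : ListFun.cur x (ListFun.cur x A) = 0 := by
  have h := hA.cur_cur x x
  have h2 : (2 : ℝ) • ListFun.cur x (ListFun.cur x A) = 0 := by
    rw [two_smul]
    exact eq_neg_iff_add_eq_zero.1 h
  exact (smul_eq_zero.1 h2).resolve_left (by norm_num)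

end ListFun

end IdentityOperator

/-! ### The Jacobi lift: contraction, products, and brackets with vertical lifts. -/

section JacobiLift

open ListFun

variable {n : ℕ} {M : Type*} [TopologicalSpace M] [ChartedSpace (EuclideanSpace ℝ (Fin n)) M]
  {F : Type*} [NormedAddCommGroup F] [NormedSpace ℝ F]
  {E : M → Type*} [TopologicalSpace (TotalSpace F E)] [∀ x, AddCommGroup (E x)]
  [∀ x, Module ℝ (E x)] [∀ x, TopologicalSpace (E x)] [FiberBundle F E] [VectorBundle ℝ F E]
  [IsManifold (𝓡 n) ∞ M] [T2Space M] [FiniteDimensional ℝ F] [ContMDiffVectorBundle ∞ F E (𝓡 n)]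

theorem contract_eq_zero (Φ : OneForm n F E) (X : MultiSec n F E 0) : contract Φ X = 0 :=
  vl_injective (by rw [vl_contract, (vl_isHom X).cur_zero, vl_zero])

namespace LieAlgebroid

variable (A : LieAlgebroid n F E)

/-- The anchor is a homomorphism. -/
theorem anchor_bracket (X Y : Sec n F E) (f : Fn n M) :
    A.anchor (A.bracket X Y) f = A.anchor X (A.anchor Y f) - A.anchor Y (A.anchor X f) := by
  by_cases hF : finrank ℝ F = 0
  · simp [sec_eq_zero_of_finrank hF X]
  · set g := A.anchor (A.bracket X Y) f - (A.anchor X (A.anchor Y f) - A.anchor Y (A.anchor X f))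
      with hg
    -- The Jacobi identity for `X`, `Y` and `f • Z`: after expansion by the Leibniz rule only the
    -- anchor defect `g` times `Z` survives. In positive rank this forces `g = 0`.
    have h : ∀ Z : Sec n F E, g • Z = 0 := by
      intro Z
      have h1 := A.jacobi X Y (f • Z)
      simp only [A.leibniz, map_add, A.jacobi X Y Z] at h1
      rw [hg, sub_smul, sub_smul, sub_eq_zero]
      refine add_left_cancel (a := f • (A.bracket X (A.bracket Y Z) - A.bracket Y (A.bracket X Z))) ?_
      rw [h1, smul_sub]
      abel
    have h0 : g = 0 := by
      ext p
      obtain ⟨Z, μ, hZ⟩ := exists_pairing_ne_zero (n := n) (F := F) (E := E) hF p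
      have h2 : g p * μ Z p = 0 := by
        have h3 := congrArg (fun s => μ s p) (h Z)
        simp only [map_smul, map_zero] at h3
        exact h3
      exact (mul_eq_zero.1 h2).resolve_right hZ
    exact sub_eq_zero.1 h0

theorem commutator_secC (s t : Sec n F E) : ⁅A.secC s, A.secC t⁆ = A.secC (A.bracket s t) := by
  refine derivation_ext (fun f => ?_) (fun μ => ?_)
  · rw [Derivation.commutator_apply, secC_pullback, secC_pullback, secC_pullback, secC_pullback,
      secC_pullback, anchor_bracket, pullback_sub]
  · rw [Derivation.commutator_apply, secC_iota, secC_iota, secC_iota, secC_iota, secC_iota,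
      ← iota_sub]
    congr 1
    refine LinearMap.ext fun σ => ?_
    simp only [LinearMap.sub_apply, lieDer_zero_apply, map_sub, anchor_bracket, A.jacobi]
    ring

variable (Φ : OneForm n F E)

/-- The cocycle condition says precisely that adding `Φ` to the anchor keeps the action on functions
a representation. -/
theorem act_bracket (hΦ : A.IsCocycle Φ) (s t : Sec n F E) (f : Fn n M) :
    A.act Φ (A.bracket s t) f = A.act Φ s (A.act Φ t f) - A.act Φ t (A.act Φ s f) := by
  have h := hΦ s t
  simp only [dForm, act, LinearMap.zero_apply, zero_mul, add_zero] at h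
  have h' : Φ (A.bracket s t) = A.anchor s (Φ t) - A.anchor t (Φ s) := (sub_eq_zero.1 h).symm
  simp only [act, map_add, anchor_bracket, Derivation.leibniz, smul_eq_mul, h']
  ring

/-- The Jacobi lift as a function of lists. -/
def jl {k : ℕ} (X : MultiSec n F E k) : ListFun (TotFn n F E) (TotFn n F E) :=
  tot (A.jacobiLift Φ X)

variable {k l m : ℕ} (X X' : MultiSec n F E k) (Y : MultiSec n F E l) (Z : MultiSec n F E m)

theorem jl_eq : A.jl Φ X = A.cl X - ((k : ℝ) - 1) • iota Φ • vl X +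
    tot idOp * cur (iota Φ) (vl X) := by
  have h : tot (wedge k idOp (verticalLift n F E (k - 1) (contract Φ X))) =
      tot idOp * cur (iota Φ) (vl X) := by
    rw [← vl_contract]
    by_cases hk : 1 + (k - 1) = k
    · rw [tot_wedge hk]
      rfl
    -- In degree 0 the arity test in `wedge` fails and gives its default value 0, which agrees with
    -- the vanishing contraction of a function.
    · obtain rfl : k = 0 := by omega
      rw [contract_eq_zero, vl_zero, mul_zero, wedge, dif_neg hk, tot_zero]
  rw [jl, jacobiLift, tot_add, tot_sub, tot_smul_real, tot_smul, h]
  rfl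

theorem jl_isAlt : IsAlt (A.jl Φ X) := tot_isAlt _
theorem jl_isHom : IsHom k (A.jl Φ X) := tot_isHom _

/-- The vertical and complete lifts are derivations in each argument; the identity is not, but it is
of first order, and it enters only through a product with a multiderivation. -/
theorem jl_isFirst : IsFirst (A.jl Φ X) := by
  refine isFirst_of_cur (A.jl_isAlt Φ X) fun f g => ?_
  have hB : IsDer (cur (iota Φ) (vl X)) := (vl_isDer X).cur _
  simp only [jl_eq, cur_add, cur_sub, cur_smul, ListFun.cur_mul, cur_tot_idOp, inv_tot_idOp,
    (A.cl_isDer X).cur_mul, (vl_isDer X).cur_mul, hB.cur_mul, (A.cl_isDer X).cur_one,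
    (vl_isDer X).cur_one, hB.cur_one, smul_mul_assoc, one_mul, mul_add, neg_mul, mul_smul_comm,
    mul_zero, smul_zero]
  module

theorem jl_add : A.jl Φ (X + X') = A.jl Φ X + A.jl Φ X' := by
  simp only [jl_eq, cl_add, vl_add, cur_add, mul_add, smul_add]
  abel

theorem jl_smul (r : ℝ) : A.jl Φ (r • X) = r • A.jl Φ X := by
  simp only [jl_eq, cl_smul, vl_smul, cur_smul, mul_smul_comm]
  module

theorem jl_zero : A.jl Φ (0 : MultiSec n F E k) = 0 := by
  simpa using A.jl_smul Φ (0 : MultiSec n F E k) 0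

theorem jl_congr {X : MultiSec n F E k} {Y : MultiSec n F E l} (h : k = l) (h' : X.1 = Y.1) :
    A.jl Φ X = A.jl Φ Y := by
  subst h
  rw [Subtype.ext h']

theorem jl_fn (f : Fn n M) : A.jl Φ (ofFn f : MultiSec n F E 0) = iota (A.dFun Φ f) • 1 := by
  have h : A.dFun Φ f = A.dFun 0 f + f • Φ := by
    refine LinearMap.ext fun s => ?_
    simp only [dFun, act, LinearMap.coe_mk, AddHom.coe_mk, LinearMap.add_apply, LinearMap.smul_apply,
      LinearMap.zero_apply, smul_eq_mul]
    ring
  rw [jl_eq, cl_fn, vl_fn, cur_smul, cur_one, smul_zero, mul_zero, h, iota_add, iota_smul]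
  simp only [Nat.cast_zero]
  module

theorem cur_jl_sec (s : Sec n F E) (x : TotFn n F E) :
    cur x (A.jl Φ (ofSec s)) = (A.secC s x + pullback n F E (Φ s) * x) • 1 := by
  rw [jl_eq, cl_sec, vl_sec, cur_tot_derOp, secV_iota, mul_smul_comm, mul_one, cur_add, cur_sub,
    cur_tot_derOp, cur_smul, cur_smul, cur_smul, cur_tot_idOp]
  simp only [Nat.cast_one, sub_self]
  module

/-- Derivations kill 1, so only the identity factor contributes. This identifies the extra term of
`nr_mul` for Jacobi lifts as the vertical lift of the contraction. -/
theorem cur_one_jl : cur 1 (A.jl Φ X) = cur (iota Φ) (vl X) := by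
  have hB : IsDer (cur (iota Φ) (vl X)) := (vl_isDer X).cur _
  rw [jl_eq, cur_add, cur_sub, (A.cl_isDer X).cur_one, cur_smul, cur_smul, (vl_isDer X).cur_one,
    ListFun.cur_mul, cur_tot_idOp, hB.cur_one]
  simp

/-- The degree of a product exceeds the sum of the degrees by one, which accounts for the last term.
The identity summands combine because contraction is an antiderivation and the odd identity operator
passes `vl X` at the cost of `inv`. -/
theorem jl_mulSec : A.jl Φ (mulSec X Y) =
    A.jl Φ X * vl Y + vl X * A.jl Φ Y - iota Φ • (vl X * vl Y) := by
  have h : vl X * tot idOp = tot idOp * inv (vl X) := by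
    rw [comm_of_odd inv_tot_idOp, ListFun.inv_inv]
  simp only [jl_eq, cl_mul, vl_mul, ListFun.cur_mul, add_mul, sub_mul, mul_add, mul_sub, smul_mul_assoc,
    mul_smul_comm, ← mul_assoc, h]
  push_cast
  module

/-- The Jacobi lift of a product, when one of the factors may vanish for degree reasons. -/
theorem jl_mul_of (h : k + l = m ∨ X = 0 ∨ Y = 0) (hZ : Z.1 = fun p => X.1 p * Y.1 p) :
    A.jl Φ Z = A.jl Φ X * vl Y + vl X * A.jl Φ Y - iota Φ • (vl X * vl Y) := by
  rcases h with h | rfl | rfl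
  · rw [← jl_mulSec]
    exact A.jl_congr Φ h.symm hZ
  · have : Z = 0 := Subtype.ext (hZ.trans (funext fun p => zero_mul _))
    rw [this, jl_zero, jl_zero, vl_zero]
    simp
  · have : Z = 0 := Subtype.ext (hZ.trans (funext fun p => mul_zero _))
    rw [this, jl_zero, jl_zero, vl_zero]
    simp

theorem cl_mul_of (h : k + l = m ∨ X = 0 ∨ Y = 0) (hZ : Z.1 = fun p => X.1 p * Y.1 p) :
    A.cl Z = A.cl X * vl Y + vl X * A.cl Y := by
  rcases h with h | rfl | rfl
  · rw [← cl_mul]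
    exact A.cl_congr h.symm hZ
  · have : Z = 0 := Subtype.ext (hZ.trans (funext fun p => zero_mul _))
    rw [this, cl_zero, cl_zero, vl_zero]
    simp
  · have : Z = 0 := Subtype.ext (hZ.trans (funext fun p => mul_zero _))
    rw [this, cl_zero, cl_zero, vl_zero]
    simp

variable {Φ}

/-- Cartan's formula with dΦ = 0: £_s Φ = d(Φ(s)). -/
theorem secC_iota_of_isCocycle (hΦ : A.IsCocycle Φ) (s : Sec n F E) :
    A.secC s (iota Φ) = iota (A.dFun 0 (Φ s)) := by
  rw [secC_iota]
  congr 1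
  refine LinearMap.ext fun t => ?_
  have h := hΦ s t
  simp only [dForm, act, LinearMap.zero_apply, zero_mul, add_zero] at h
  rw [lieDer_zero_apply, dFun_zero_apply]
  linear_combination h

/-- The contraction with a cocycle commutes with the complete lift. -/
theorem cl_contract (hΦ : A.IsCocycle Φ) : ∀ (k : ℕ) (X : MultiSec n F E k),
    A.cl (contract Φ X) = cur (iota Φ) (A.cl X) := by
  have key := eq_zero_of_generators
    (fun k (X : MultiSec n F E k) => A.cl (contract Φ X) - cur (iota Φ) (A.cl X))
    (fun k X Y => by
      have : contract Φ (X + Y) = contract Φ X + contract Φ Y :=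
        vl_injective (by simp only [vl_contract, vl_add, cur_add])
      simp only [this, cl_add, cur_add]
      abel)
    (fun f => by simp only [contract_eq_zero, cl_zero, (A.cl_isHom _).cur_zero, sub_self])
    (fun k f Z => by
      have h := A.cl_mul_of (ofFn f) (contract Φ Z) (contract Φ (mulSec (ofFn f) Z))
        (by rcases k with _ | k; exacts [Or.inr (Or.inr (contract_eq_zero Φ Z)), Or.inl (by omega)])
        (by
          have : IsVert (fun p => (ofFn f : MultiSec n F E 0).1 p * (contract Φ Z).1 p)
              (vl (contract Φ (mulSec (ofFn f) Z))) := by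
            rw [vl_contract, vl_mul, ListFun.cur_mul, vl_fn, cur_smul, cur_one, smul_zero, zero_mul,
              zero_add, inv_smul, ListFun.inv_one, ← vl_fn (F := F) (E := E), ← vl_contract]
            exact (isVert_vl _).mul (isVert_vl _)
          have hm : (fun p => (ofFn f : MultiSec n F E 0).1 p * (contract Φ Z).1 p) ∈
              MultiSec n F E (0 + k - 1) := mul_mem_of _ _
            (by rcases k with _ | k; exacts [Or.inr (Or.inr (contract_eq_zero Φ Z)), Or.inl (by omega)])
          exact congrArg Subtype.val ((isVert_vl _).inj (Y := ⟨_, hm⟩) this))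
      rw [h, cl_mul, vl_contract, cur_add, ListFun.cur_mul, ListFun.cur_mul, vl_fn, cl_fn]
      simp only [cur_smul, cur_one, smul_zero, zero_mul, zero_add, inv_smul, ListFun.inv_one, smul_mul_assoc,
        one_mul, smul_sub]
      abel)
    (fun k s Z h => by
      have h := sub_eq_zero.1 h
      have h1 : (fun p => (ofSec s : MultiSec n F E 1).1 p * (contract Φ Z).1 p) ∈
          MultiSec n F E (1 + k - 1) := mul_mem_of _ _
        (by rcases k with _ | k; exacts [Or.inr (Or.inr (contract_eq_zero Φ Z)), Or.inl (by omega)])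
      have h2 : (fun p => (ofFn (Φ s) : MultiSec n F E 0).1 p * Z.1 p) ∈
          MultiSec n F E (1 + k - 1) := mul_mem_of _ _ (Or.inl (by omega))
      -- The rule i_Φ(s ∧ Z) = Φ(s) Z - s ∧ i_Φ Z, read off from vertical lifts; for `k = 0` the
      -- second term is zero and may be placed in any degree.
      have e : contract Φ (mulSec (ofSec s) Z) = ⟨_, h2⟩ - ⟨_, h1⟩ := by
        refine (isVert_vl _).inj ?_
        have : vl (contract Φ (mulSec (ofSec s) Z)) =
            vl (ofFn (Φ s) : MultiSec n F E 0) * vl Z - vl (ofSec s) * vl (contract Φ Z) := by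
          rw [vl_contract, vl_mul, ListFun.cur_mul, (vl_isHom (ofSec s)).inv_eq, vl_contract, vl_fn,
            vl_sec, cur_tot_derOp, secV_iota]
          simp [sub_eq_add_neg]
        rw [this]
        exact ((isVert_vl _).mul (isVert_vl _)).sub ((isVert_vl _).mul (isVert_vl _))
      have e1 := A.cl_mul_of (ofSec s) (contract Φ Z) ⟨_, h1⟩
        (by rcases k with _ | k; exacts [Or.inr (Or.inr (contract_eq_zero Φ Z)), Or.inl (by omega)]) rfl
      have e2 := A.cl_mul_of (ofFn (Φ s)) Z ⟨_, h2⟩ (Or.inl (by omega)) rfl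
      have e3 : A.cl (contract Φ (mulSec (ofSec s) Z)) =
          A.cl (⟨_, h2⟩ : MultiSec n F E (1 + k - 1)) - A.cl (⟨_, h1⟩ : MultiSec n F E (1 + k - 1)) := by
        rw [e, cl, map_sub, tot_sub]
        rfl
      rw [e3, e1, e2, cl_mul, h, cur_add, ListFun.cur_mul, ListFun.cur_mul,
        (A.cl_isHom (ofSec s)).inv_eq, (vl_isHom (ofSec s)).inv_eq, cl_sec, vl_sec, cur_tot_derOp,
        cur_tot_derOp, secV_iota, A.secC_iota_of_isCocycle hΦ, vl_contract, vl_fn, cl_fn]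
      simp only [pow_one, neg_smul, one_smul, neg_mul]
      abel)
  exact fun k X => sub_eq_zero.1 (key k X)

/-- The contraction with a cocycle commutes with the Jacobi lift. -/
theorem jl_contract (hΦ : A.IsCocycle Φ) : A.jl Φ (contract Φ X) = cur (iota Φ) (A.jl Φ X) := by
  rcases k with _ | k
  · rw [contract_eq_zero, jl_zero, (A.jl_isHom Φ X).cur_zero]
  -- Contraction lowers the degree, hence the coefficient of `iota Φ`, by one. The difference is
  -- supplied by inserting `iota Φ` into the identity factor, while double contractions vanish.
  · rw [jl_eq, jl_eq, A.cl_contract hΦ, vl_contract, cur_add, cur_sub, cur_smul, cur_smul,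
      ListFun.cur_mul, (vl_isAlt X).cur_self, cur_tot_idOp, smul_mul_assoc, one_mul]
    simp only [mul_zero, add_zero, Nat.add_sub_cancel]
    push_cast
    module

variable (Φ)

theorem zpow_sub_one (k : ℕ) : (-1 : ℝ) ^ ((k : ℤ) - 1) = -(-1) ^ k := by
  have := neg_one_zpow_sub k 1
  simpa using this

/-- Graded commutation, with the sign in the shape produced by `nr_skew`: `k (l - 1)` is split as
`(k - 1) (l - 1) + (l - 1)`. -/
theorem vl_mul_cur : vl X * cur (iota Φ) (vl Y) =
    ((-1 : ℝ) ^ (((k : ℤ) - 1) * ((l : ℤ) - 1)) * (-1 : ℝ) ^ ((l : ℤ) - 1)) •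
      (cur (iota Φ) (vl Y) * vl X) := by
  rcases l with _ | l
  · simp [(vl_isHom Y).cur_zero]
  · rw [comm_graded (vl_isHom X) ((vl_isHom Y).cur _)]
    congr 1
    push_cast
    rw [add_sub_cancel_right, neg_one_zpow_sub, zpow_natCast]
    have h : ∀ j : ℕ, (-1 : ℝ) ^ j = if Even j then 1 else -1 := fun j => by
      split_ifs with hj
      exacts [hj.neg_one_pow, (Nat.not_even_iff_odd.1 hj).neg_one_pow]
    simp only [Int.even_coe_nat, pow_mul, h k]
    by_cases hk : Even k <;> by_cases hl : Even l <;> simp [h l, hk, hl]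

theorem vl_schoutenJacobi_eq : vl (A.schoutenJacobi Φ X Y) = nr k l (A.cl X) (vl Y) +
    ((k : ℝ) - 1) • (vl X * cur (iota Φ) (vl Y)) -
    ((-1 : ℝ) ^ ((k : ℤ) - 1) * ((l : ℝ) - 1)) • (cur (iota Φ) (vl X) * vl Y) := by
  rw [← vl_schoutenNijenhuis, ← vl_contract, ← vl_contract]
  exact IsVert.eq_vl (((isVert_vl _).add (((isVert_vl _).mul (isVert_vl _)).smul _)).sub
    (((isVert_vl _).mul (isVert_vl _)).smul _))

/-- Vertical lifts commute, so in the Leibniz rule for the product of the function `iota Φ` with `vl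
X` only the bracket with `iota Φ` remains. -/
theorem nr_smul_vl_vl : nr k l (iota Φ • vl X) (vl Y) = -(vl X * cur (iota Φ) (vl Y)) := by
  have h1 : iota Φ • vl X = (iota Φ • (1 : ListFun (TotFn n F E) (TotFn n F E))) * vl X := by
    rw [smul_mul_assoc, one_mul]
  have h2 := nr_mul_of_isDer (vl_isAlt Y) (vl_isDer Y) (isAlt_smul_one (iota Φ)) (vl_isAlt X)
    (vl_isHom Y) (isHom_smul_one (iota Φ)) (vl_isHom X)
  rw [zero_add, nr_vl_vl, mul_zero, smul_zero, add_zero, nr_smul_one _ _ (vl_isAlt Y)] at h2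
  rw [nr_skew, h1, h2, vl_mul_cur, zpow_sub_one, smul_mul_assoc]
  module

/-- Again only one factor matters: the bracket of `vl Y` with the identity, which multiplies by the
degree `l - 1`. With `nr_smul_vl_vl` this yields the two correction terms of the Schouten–Jacobi
bracket. -/
theorem nr_idOp_mul_vl : nr k l (tot idOp * cur (iota Φ) (vl X)) (vl Y) =
    -((-1 : ℝ) ^ ((k : ℤ) - 1) * ((l : ℝ) - 1)) • (cur (iota Φ) (vl X) * vl Y) := by
  rcases k with _ | k
  · rw [(vl_isHom X).cur_zero, mul_zero, zero_mul, smul_zero, nr_skew, nr_zero_right _ _ (vl_isAlt Y),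
      smul_zero]
  · have h2 := nr_mul_of_isDer (vl_isAlt Y) (vl_isDer Y) (tot_isAlt (idOp : AltOp (TotFn n F E) 1))
      (vl_isAlt (contract Φ X)) (vl_isHom Y) (tot_isHom _) (vl_isHom (contract Φ X))
    rw [nr_vl_vl, mul_zero, smul_zero, add_zero, nr_idOp (vl_isAlt Y) (vl_isHom Y), vl_contract,
      smul_mul_assoc, vl_mul_cur] at h2
    rw [show 1 + (k + 1 - 1) = k + 1 by omega] at h2
    rw [nr_skew, h2]
    have hs : (-1 : ℝ) ^ ((((k + 1 : ℕ) : ℤ) - 1) * ((l : ℤ) - 1)) *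
      (-1 : ℝ) ^ (((l : ℤ) - 1) * (((k + 1 : ℕ) : ℤ) - 1)) = 1 := by
      rw [mul_comm ((l : ℤ) - 1), ← zpow_add₀ (by norm_num)]
      exact Even.neg_one_zpow (Even.add_self _)
    rw [smul_smul, smul_smul]
    congr 1
    linear_combination (-(l : ℝ) + 1) * (-1 : ℝ) ^ (((k + 1 : ℕ) : ℤ) - 1) * hs

/-- The bracket of a Jacobi lift with a vertical lift. -/
theorem vl_schoutenJacobi : vl (A.schoutenJacobi Φ X Y) = nr k l (A.jl Φ X) (vl Y) := by
  rw [vl_schoutenJacobi_eq, jl_eq, nr_add_left _ _ (vl_isAlt Y), nr_sub_left _ _ (vl_isAlt Y),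
    nr_smul_left _ _ (vl_isAlt Y), nr_smul_vl_vl, nr_idOp_mul_vl]
  module

/-- On vertical lifts the Schouten–Nijenhuis part is skew by `nr_cl_vl_skew`, and graded commutation
exchanges the two terms containing `Φ`. -/
theorem schoutenJacobi_skew : (A.schoutenJacobi Φ Y X).1 =
    (-((-1 : ℝ) ^ (((k : ℤ) - 1) * ((l : ℤ) - 1)))) • (A.schoutenJacobi Φ X Y).1 := by
  have hm : (-((-1 : ℝ) ^ (((k : ℤ) - 1) * ((l : ℤ) - 1)))) • (A.schoutenJacobi Φ X Y).1 ∈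
      MultiSec n F E (l + k - 1) := mem_of_eq (by omega) (Submodule.smul_mem _ _ (Subtype.prop _))
  refine congrArg Subtype.val (a₂ := ⟨_, hm⟩) ((isVert_vl _).inj ?_)
  have h : vl (A.schoutenJacobi Φ Y X) =
      (-((-1 : ℝ) ^ (((k : ℤ) - 1) * ((l : ℤ) - 1)))) • vl (A.schoutenJacobi Φ X Y) := by
    have hs : (-1 : ℝ) ^ (((k : ℤ) - 1) * ((l : ℤ) - 1)) *
      (-1 : ℝ) ^ (((k : ℤ) - 1) * ((l : ℤ) - 1)) = 1 := by
      rw [← zpow_add₀ (by norm_num)]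
      exact Even.neg_one_zpow (Even.add_self _)
    rw [vl_schoutenJacobi_eq, vl_schoutenJacobi_eq, nr_cl_vl_skew A Y X, vl_mul_cur Φ X Y,
      vl_mul_cur Φ Y X, mul_comm ((l : ℤ) - 1)]
    match_scalars
    · ring
    · ring
    · linear_combination ((k : ℝ) - 1) * (-1 : ℝ) ^ ((l : ℤ) - 1) * hs
  rw [h]
  exact (isVert_vl _).smul _

theorem schoutenJacobi_zero (X Y : MultiSec n F E 0) : A.schoutenJacobi Φ X Y = 0 :=
  vl_injective (by
    rw [vl_schoutenJacobi, vl_zero, nr, jl, vl, ins_tot_zero, ins_tot_zero]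
    simp)

end LieAlgebroid

end JacobiLift

/-! ### The Jacobi lift and the Schouten–Jacobi bracket -/

section JacobiBracket

open ListFun

variable {n : ℕ} {M : Type*} [TopologicalSpace M] [ChartedSpace (EuclideanSpace ℝ (Fin n)) M]
  {F : Type*} [NormedAddCommGroup F] [NormedSpace ℝ F]
  {E : M → Type*} [TopologicalSpace (TotalSpace F E)] [∀ x, AddCommGroup (E x)]
  [∀ x, Module ℝ (E x)] [∀ x, TopologicalSpace (E x)] [FiberBundle F E] [VectorBundle ℝ F E]
  [IsManifold (𝓡 n) ∞ M] [T2Space M] [FiniteDimensional ℝ F] [ContMDiffVectorBundle ∞ F E (𝓡 n)]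

namespace LieAlgebroid

variable (A : LieAlgebroid n F E) (Φ : OneForm n F E) {k l m : ℕ}

theorem lieDer_eq (s : Sec n F E) (μ : OneForm n F E) :
    A.lieDer Φ s μ = A.lieDer 0 s μ + Φ s • μ := by
  refine LinearMap.ext fun t => ?_
  simp only [lieDer, dForm, dFun, act, LinearMap.coe_mk, AddHom.coe_mk, LinearMap.add_apply,
    LinearMap.smul_apply, LinearMap.zero_apply, smul_eq_mul]
  ring

theorem secC_iota_add (s : Sec n F E) (μ : OneForm n F E) :
    A.secC s (iota μ) + pullback n F E (Φ s) * iota μ = iota (A.lieDer Φ s μ) := by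
  rw [lieDer_eq, iota_add, iota_smul, secC_iota]

/-- The Leibniz rule for the Schouten–Jacobi bracket, with the Jacobi lifts of the summands. -/
theorem exists_schoutenJacobi_mulSec (X : MultiSec n F E k) (Y : MultiSec n F E l)
    (Z : MultiSec n F E m) :
    ∃ D₁ D₂ D₃ : MultiSec n F E (k + (l + m) - 1),
      A.schoutenJacobi Φ X (mulSec Y Z) =
        D₁ + ((-1 : ℝ) ^ (((k : ℤ) - 1) * l)) • D₂ + ((-1 : ℝ) ^ k) • D₃ ∧
      A.jl Φ D₁ = A.jl Φ (A.schoutenJacobi Φ X Y) * vl Z + vl (A.schoutenJacobi Φ X Y) * A.jl Φ Z -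
        iota Φ • (vl (A.schoutenJacobi Φ X Y) * vl Z) ∧
      A.jl Φ D₂ = A.jl Φ Y * vl (A.schoutenJacobi Φ X Z) + vl Y * A.jl Φ (A.schoutenJacobi Φ X Z) -
        iota Φ • (vl Y * vl (A.schoutenJacobi Φ X Z)) ∧
      A.jl Φ D₃ = A.jl Φ (contract Φ X) * vl (mulSec Y Z) +
        vl (contract Φ X) * A.jl Φ (mulSec Y Z) -
        iota Φ • (vl (contract Φ X) * vl (mulSec Y Z)) := by
  have c1 : k + l - 1 + m = k + (l + m) - 1 ∨ A.schoutenJacobi Φ X Y = 0 ∨ Z = 0 := by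
    by_cases h : k + l = 0
    · obtain ⟨rfl, rfl⟩ : k = 0 ∧ l = 0 := by omega
      exact Or.inr (Or.inl (A.schoutenJacobi_zero Φ X Y))
    · omega
  have c2 : l + (k + m - 1) = k + (l + m) - 1 ∨ Y = 0 ∨ A.schoutenJacobi Φ X Z = 0 := by
    by_cases h : k + m = 0
    · obtain ⟨rfl, rfl⟩ : k = 0 ∧ m = 0 := by omega
      exact Or.inr (Or.inr (A.schoutenJacobi_zero Φ X Z))
    · omega
  have c3 : k - 1 + (l + m) = k + (l + m) - 1 ∨ contract Φ X = 0 ∨ mulSec Y Z = 0 := by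
    rcases k with _ | k
    · exact Or.inr (Or.inl (contract_eq_zero Φ X))
    · omega
  -- The summands are [X, Y]^Φ ∧ Z, Y ∧ [X, Z]^Φ and i_Φ X ∧ Y ∧ Z, the last being the first-order
  -- defect in `nr_mul`. Where the degrees do not match, a factor is zero.
  refine ⟨⟨_, mul_mem_of _ _ c1⟩, ⟨_, mul_mem_of _ _ c2⟩, ⟨_, mul_mem_of _ _ c3⟩, ?_,
    A.jl_mul_of Φ _ _ _ c1 rfl, A.jl_mul_of Φ _ _ _ c2 rfl, A.jl_mul_of Φ _ _ _ c3 rfl⟩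
  refine vl_injective ?_
  have e1 : vl (⟨_, mul_mem_of _ _ c1⟩ : MultiSec n F E (k + (l + m) - 1)) =
      vl (A.schoutenJacobi Φ X Y) * vl Z := IsVert.eq_vl ((isVert_vl _).mul (isVert_vl _))
  have e2 : vl (⟨_, mul_mem_of _ _ c2⟩ : MultiSec n F E (k + (l + m) - 1)) =
      vl Y * vl (A.schoutenJacobi Φ X Z) := IsVert.eq_vl ((isVert_vl _).mul (isVert_vl _))
  have e3 : vl (⟨_, mul_mem_of _ _ c3⟩ : MultiSec n F E (k + (l + m) - 1)) =
      vl (contract Φ X) * vl (mulSec Y Z) := IsVert.eq_vl ((isVert_vl _).mul (isVert_vl _))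
  rw [vl_add, vl_add, vl_smul, vl_smul, e1, e2, e3, vl_schoutenJacobi, vl_mul,
    nr_mul (A.jl_isAlt Φ X) (A.jl_isFirst Φ X) (vl_isAlt Y) (vl_isAlt Z) (A.jl_isHom Φ X)
      (vl_isHom Y) (vl_isHom Z), cur_one_jl, vl_schoutenJacobi, vl_schoutenJacobi, vl_contract,
    mul_assoc (cur _ _)]

variable {Φ}

/-- The deviation of the Jacobi lift from being a homomorphism of brackets is a derivation. -/
theorem jl_bracket_mul (hΦ : A.IsCocycle Φ) (X : MultiSec n F E k) (Y : MultiSec n F E l)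
    (Z : MultiSec n F E m) :
    nr k (l + m) (A.jl Φ X) (A.jl Φ (mulSec Y Z)) - A.jl Φ (A.schoutenJacobi Φ X (mulSec Y Z)) =
      (nr k l (A.jl Φ X) (A.jl Φ Y) - A.jl Φ (A.schoutenJacobi Φ X Y)) * vl Z +
      ((-1 : ℝ) ^ (((k : ℤ) - 1) * l)) •
        (vl Y * (nr k m (A.jl Φ X) (A.jl Φ Z) - A.jl Φ (A.schoutenJacobi Φ X Z))) := by
  obtain ⟨D₁, D₂, D₃, hD, j1, j2, j3⟩ := A.exists_schoutenJacobi_mulSec Φ X Y Z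
  have hX := A.jl_isAlt Φ X
  have hX' := A.jl_isFirst Φ X
  have hXh := A.jl_isHom Φ X
  have n1 := nr_mul hX hX' (A.jl_isAlt Φ Y) (vl_isAlt Z) hXh (A.jl_isHom Φ Y) (vl_isHom Z)
  have n2 := nr_mul hX hX' (vl_isAlt Y) (A.jl_isAlt Φ Z) hXh (vl_isHom Y) (A.jl_isHom Φ Z)
  have n3 := nr_mul hX hX' (vl_isAlt Y) (vl_isAlt Z) hXh (vl_isHom Y) (vl_isHom Z)
  have n4 := nr_mul hX hX' (isAlt_smul_one (iota Φ)) ((vl_isAlt Y).mul (vl_isAlt Z)) hXh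
    (isHom_smul_one (iota Φ)) ((vl_isHom Y).mul (vl_isHom Z))
  rw [zero_add, zpow_mul_zero, one_smul, smul_mul_assoc, one_mul, nr_smul_one _ _ hX, n3] at n4
  -- The bracket with the factor `iota Φ` in (c) produces the contraction of the Jacobi lift with
  -- `iota Φ`. By `jl_contract`, the only use of the cocycle condition here, this is the lift of the
  -- contraction and cancels against the terms of `D₃`.
  rw [hD, jl_add, jl_add, jl_smul, jl_smul, j1, j2, j3, jl_mulSec, nr_sub_right _ _ hX,
    nr_add_right _ _ hX, n1, n2, n4, cur_one_jl, A.jl_contract X hΦ, vl_mul, vl_schoutenJacobi,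
    vl_schoutenJacobi, vl_contract]
  simp only [mul_add, mul_sub, add_mul, sub_mul, smul_mul_assoc, mul_smul_comm, one_mul, mul_one,
    ← mul_assoc, smul_add, smul_sub]
  module

/-- The Jacobi lift is a homomorphism of brackets. -/
theorem nr_jl_jl (hΦ : A.IsCocycle Φ) : ∀ (k l : ℕ) (X : MultiSec n F E k) (Y : MultiSec n F E l),
    nr k l (A.jl Φ X) (A.jl Φ Y) = A.jl Φ (A.schoutenJacobi Φ X Y) := by
  have key := eq_zero_of_generators₂ (fun k l (X : MultiSec n F E k) (Y : MultiSec n F E l) =>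
      nr k l (A.jl Φ X) (A.jl Φ Y) - A.jl Φ (A.schoutenJacobi Φ X Y))
    (fun k l X Y Z => by
      have : A.schoutenJacobi Φ X (Y + Z) = A.schoutenJacobi Φ X Y + A.schoutenJacobi Φ X Z :=
        vl_injective (by
          rw [vl_add, vl_schoutenJacobi, vl_schoutenJacobi, vl_schoutenJacobi, vl_add,
            nr_add_right _ _ (A.jl_isAlt Φ X)])
      simp only [this, jl_add, nr_add_right _ _ (A.jl_isAlt Φ X)]
      abel)
    (fun k l X Y h => by
      have h := sub_eq_zero.1 h
      have e : A.jl Φ (A.schoutenJacobi Φ Y X) =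
          (-((-1 : ℝ) ^ (((k : ℤ) - 1) * ((l : ℤ) - 1)))) • A.jl Φ (A.schoutenJacobi Φ X Y) := by
        rw [← jl_smul]
        exact A.jl_congr Φ (by omega) (A.schoutenJacobi_skew Φ X Y)
      simp only [e, nr_skew l k (A.jl Φ Y), h, mul_comm ((l : ℤ) - 1), sub_self])
    (fun f g => by
      simp only [schoutenJacobi_zero, jl_zero, jl_fn, nr_smul_one _ _ (isAlt_smul_one _), cur_smul,
        cur_one, smul_zero, sub_self])
    (fun s f => by
      have h : A.schoutenJacobi Φ (ofSec s) (ofFn f) = ofFn (A.act Φ s f) := by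
        refine vl_injective ((A.vl_schoutenJacobi Φ _ _).trans ?_)
        rw [vl_fn (n := n), vl_fn, nr_smul_one _ _ (A.jl_isAlt Φ _), cur_jl_sec, secC_pullback,
          ← pullback_mul, ← pullback_add, pow_one, neg_neg, one_smul]
        rfl
      have h' : A.jl Φ (A.schoutenJacobi Φ (ofSec s) (ofFn f)) =
          A.jl Φ (ofFn (A.act Φ s f) : MultiSec n F E 0) := congrArg (A.jl Φ) h
      -- What remains is £^Φ_s d^Φ f = d^Φ [s, f]^Φ; evaluated on a section `t` it is the
      -- representation property `act_bracket`.
      simp only [h', jl_fn, nr_smul_one _ _ (A.jl_isAlt Φ _), cur_jl_sec, secC_iota_add]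
      rw [pow_one, neg_neg, one_smul, sub_eq_zero]
      congr 2
      refine LinearMap.ext fun t => ?_
      have e := A.act_bracket Φ hΦ s t f
      rw [lieDer_eq, LinearMap.add_apply, lieDer_zero_apply]
      simp only [dFun, LinearMap.coe_mk, AddHom.coe_mk, LinearMap.smul_apply, smul_eq_mul] at e ⊢
      rw [e]
      simp only [act]
      ring)
    (fun s t => by
      have h : A.schoutenJacobi Φ (ofSec s) (ofSec t) = ofSec (A.bracket s t) := by
        refine vl_injective ((A.vl_schoutenJacobi_eq Φ _ _).trans ?_)
        rw [vl_sec (n := n), cl_sec, vl_sec, nr_derOp, commutator_secC_secV]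
        simp
        exact (vl_sec _).symm
      have h' : A.jl Φ (A.schoutenJacobi Φ (ofSec s) (ofSec t)) =
          A.jl Φ (ofSec (A.bracket s t)) := congrArg (A.jl Φ) h
      simp only [h']
      rw [sub_eq_zero]
      refine nr_linear (A.jl_isAlt Φ _) (A.jl_isAlt Φ _) (A.jl_isHom Φ _) (A.jl_isHom Φ _)
        (A.cur_jl_sec Φ s) (A.cur_jl_sec Φ t) (A.jl_isHom Φ _) fun x => ?_
      rw [cur_jl_sec]
      congr 1
      -- The commutator of the two first-order operators has derivation part the complete lift of
      -- `[s, t]` and zeroth-order part a(s)Φ(t) - a(t)Φ(s), equal to Φ([s, t]) by the cocycle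
      -- condition.
      have e := hΦ s t
      simp only [dForm, act, LinearMap.zero_apply, zero_mul, add_zero] at e
      rw [← sub_eq_zero.1 e, ← commutator_secC, Derivation.commutator_apply, pullback_sub]
      simp only [map_add, Derivation.leibniz, secC_pullback, smul_eq_mul]
      ring)
    (fun k l X f Z h => by
      rw [A.jl_bracket_mul hΦ, h, zero_mul, zero_add, zpow_mul_zero, one_smul, vl_fn, smul_mul_assoc,
        one_mul])
    (fun k l X s Z h h' => by
      rw [A.jl_bracket_mul hΦ, h, h', zero_mul, mul_zero, smul_zero, zero_add])
  exact fun k l X Y => sub_eq_zero.1 (key k l X Y)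

variable (Φ)

theorem jacobiLift_sec_apply (s : Sec n F E) (G : TotFn n F E) :
    A.jacobiLift Φ (ofSec s) ![G] = A.secC s G + pullback n F E (Φ s) * G := by
  have h := congrFun (A.cur_jl_sec Φ s G) []
  rw [ListFun.smul_apply, one_nil, smul_eq_mul, mul_one, cur_apply] at h
  rw [← h, jl]
  have := tot_ofFn (A.jacobiLift Φ (ofSec s)) ![G]
  rw [← this]
  simp

end LieAlgebroid

end JacobiBracket

end JacobiAlgebroid

end

theorem theorem11 (n : ℕ) (M : Type*) [TopologicalSpace M]
    [ChartedSpace (EuclideanSpace ℝ (Fin n)) M] [IsManifold (𝓡 n) ∞ M]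
    [T2Space M] [SecondCountableTopology M]
    (F : Type*) [NormedAddCommGroup F] [NormedSpace ℝ F] [FiniteDimensional ℝ F]
    (E : M → Type*) [TopologicalSpace (TotalSpace F E)] [∀ x, AddCommGroup (E x)]
    [∀ x, Module ℝ (E x)] [∀ x, TopologicalSpace (E x)] [FiberBundle F E] [VectorBundle ℝ F E]
    [ContMDiffVectorBundle ∞ F E (𝓡 n)]
    (A : LieAlgebroid n F E) (Φ : OneForm n F E) (hΦ : A.IsCocycle Φ) :
    -- the vertical lift, the complete lift and the Schouten–Nijenhuis bracket are well defined
    ((∃! v, IsVerticalLift n F E v) ∧ IsVerticalLift n F E (verticalLift n F E)) ∧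
    ((∃! c, A.IsCompleteLift c) ∧ A.IsCompleteLift A.completeLift) ∧
    ((∃! B, A.IsSchoutenNijenhuis B) ∧ A.IsSchoutenNijenhuis A.schoutenNijenhuis) ∧
    -- the Jacobi lift takes values in first-order multidifferential operators
    (∀ (k : ℕ) (X : MultiSec n F E k), IsFirstOrderMultiDiff (A.jacobiLift Φ X)) ∧
    -- (a)
    (∀ f : Fn n M, A.jacobiLift Φ (ofFn f) = constOp (iota (A.dFun Φ f))) ∧
    -- (b)
    (∀ (X : Sec n F E) (μ : OneForm n F E),
      A.jacobiLift Φ (ofSec X) ![iota μ] = iota (A.lieDer Φ X μ)) ∧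
    (∀ X : Sec n F E, A.jacobiLift Φ (ofSec X) ![1] = pullback n F E (Φ X)) ∧
    -- (c)
    (∀ (k l : ℕ) (X : MultiSec n F E k) (Y : MultiSec n F E l),
      A.jacobiLift Φ (mulSec X Y) =
        wedge (k + l) (A.jacobiLift Φ X) (verticalLift n F E l Y)
          + wedge (k + l) (verticalLift n F E k X) (A.jacobiLift Φ Y)
          - iota Φ • wedge (k + l) (verticalLift n F E k X) (verticalLift n F E l Y)) ∧
    -- (d)
    (∀ (k l : ℕ) (X : MultiSec n F E k) (Y : MultiSec n F E l),
      nrBracket (A.jacobiLift Φ X) (A.jacobiLift Φ Y) =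
        A.jacobiLift Φ (A.schoutenJacobi Φ X Y)) := by
  refine ⟨existsUnique_verticalLift, A.existsUnique_completeLift, A.existsUnique_schoutenNijenhuis,
    fun k X => isFirstOrderMultiDiff_of_isFirst (A.jl_isFirst Φ X), fun f => tot_injective ?_,
    fun X μ => ?_, fun X => ?_, fun k l X Y => tot_injective ?_, fun k l X Y => tot_injective ?_⟩
  · exact (A.jl_fn Φ f).trans (tot_constOp _).symm
  · rw [A.jacobiLift_sec_apply, A.secC_iota_add]
  · rw [A.jacobiLift_sec_apply, Derivation.map_one_eq_zero, zero_add, mul_one]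
  · rw [tot_sub, tot_add, tot_smul, tot_wedge rfl, tot_wedge rfl, tot_wedge rfl]
    exact A.jl_mulSec Φ X Y
  · rw [tot_nrBracket]
    exact A.nr_jl_jl hΦ k l X Y
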